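/- **Setting.** Let $S=\{1,2,3\}$, $B=\{(1,2),(2,3),(3,1)\}$, let $p_1,p_2,p_3\in\mathbb R^2$ with $p_1+p_2+p_3=0$ and $|p_i-p_j|=1$ for $i\ne j$, and let $0<\alpha<1$. Put $G_i(x)=\frac{1-\alpha}{2}(x-p_i)+p_i$, $G_w=G_{w_1}\circ\cdots\circ G_{w_m}$ for $w\in W_m=S^m$, $W_*=\bigcup_m W_m$. Let $e_{ij}$ be the segment from $G_i(p_j)$ to $G_j(p_i)$, and $e^w_{ij}=G_w(e_{ij})$. The stretched Sierpinski gasket $K$ is the unique compact set with $K=\bigcup_i G_i(K)\cup e_{12}\cup e_{23}\cup e_{31}$; write $V_0=\{p_1,p_2,p_3\}$. For a segment $pq$, $H^1(pq)$ and $\mathcal D_{pq}(u,v)=\int_0^1 (u\circ\xi)'(v\circ\xi)'\,dx$ are defined through $\xi(t)=(1-t)p+tq$, with $'$ the distributional derivative, required to be in $L^2$; elements of $H^1$ are continuous versions. Let $\widetilde{\mathcal F}$ be the set of $u\in C(K)$ with $u|_{e^w_{ij}}\in H^1(e^w_{ij})$ for all $w\in W_*$, $(i,j)\in B$, let $\mathcal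 D^I_m(u,v)=\sum_{w\in W_{m-1},(i,j)\in B}\mathcal D_{e^w_{ij}}(u,v)$ for $m\ge1$, and $$Q_m^\Sigma(u,v)=\sum_{w\in W_m}\sum_{(i,j)\in B}\big(u(G_wp_i)-u(G_wp_j)\big)\big(v(G_wp_i)-v(G_wp_j)\big)\qquad(m\ge 0).$$ **Completely symmetric forms.** A resistance form on a set $X$ is a pair $(\mathcal E,\mathcal F)$ such that: (RF1) $\mathcal F$ is a linear space of functions $X\to\mathbb R$ containing the constants, and $\mathcal E$ is a nonnegative symmetric bilinear form on $\mathcal F$ with $\mathcal E(u,u)=0$ iff $u$ is constant; (RF2) $\mathcal F$ modulo constants, with $\mathcal E$, is a Hilbert space; (RF3) $\mathcal F$ separates the points of $X$; (RF4) $R(x,y)=\sup\{|u(x)-u(y)|^2/\mathcal E(u,u): u\in\mathcal F,\ \mathcal E(u,u)>0\}<\infty$ for all $x,y$ ($R$ is the resistance metric); (RF5) if $u\in\mathcal F$ and $\bar u=\max(0,\min(u,1))$, then $\bar u\in\mathcal F$ and $\mathcal E(\bar u,\bar u)\le\mathcal E(u,u)$. For nonempty $Y\subseteq X$ its trace on $Y$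 is $\mathcal E|_Y(f,g)=\mathcal E(h_Yf,h_Yg)$, where $h_Yf$ is the element of $\mathcal F$ of least energy $\mathcal E(v,v)$ among all $v\in\mathcal F$ with $v|_Y=f$. Let $\mathcal{RF}^{(0)}_S$ be the set of resistance forms $(\mathcal E,\mathcal F)$ on $K$ such that (a) $\mathcal F\subseteq C(K)$, and $u\in\mathcal F$ iff $u|_{G_i(K)}\in\{v|_{G_i(K)}:v\in\mathcal F\}$ for all $i\in S$ and $u|_{e_{ij}}\in H^1(e_{ij})$ for all $(i,j)\in B$; (b) the resistance metric induces the Euclidean topology of $K$; (c) for every linear $\varphi:\mathbb R^2\to\mathbb R^2$ with $\varphi(K)=K$ and all $u\in\mathcal F$, $u\circ\varphi\in\mathcal F$ and $\mathcal E(u\circ\varphi,u\circ\varphi)=\mathcal E(u,u)$. A resolution of $(\mathcal E,\mathcal F)$ consists of $(\mathcal E_m,\mathcal F_m)\in\mathcal{RF}^{(0)}_S$ ($m\ge0$) and $\eta_m>0$ ($m\ge1$) with $(\mathcal E_0,\mathcal F_0)=(\mathcal E,\mathcal F)$, $\mathcal F_m=\{u\circ G_i:u\in\mathcal F_{m-1}\}$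 for all $m\ge1$, $i\in S$, and $$\mathcal E_{m-1}(u,v)=\sum_{i=1}^3\mathcal E_m(u\circ G_i,v\circ G_i)+\frac1{\eta_m}\mathcal D^I_1(u,v)\qquad(m\ge1,\ u,v\in\mathcal F_{m-1}).$$ The class $\mathcal{RF}_S$ of completely symmetric resistance forms consists of the elements of $\mathcal{RF}^{(0)}_S$ that have a resolution. For such a form, $r_0(\mathcal E,\mathcal F)$ denotes the constant $r_0>0$ with $\mathcal E|_{V_0}=\frac1{r_0}Q^\Sigma_0$. **Forms from matching pairs.** Let $\mathcal{MP}^{\mathbb N}$ be the set of sequences $\mathcal R=\{(r_m,\rho_m)\}_{m\ge1}$ with $r_m,\rho_m>0$ and $\frac53r_m+\rho_m=1$. Put $\delta_m=r_1\cdots r_m$, $\gamma_m=\delta_{m-1}\rho_m$, $\mathcal R^{(n)}=\{(r_{n+m},\rho_{n+m})\}_{m\ge1}$, $\mathcal E_{\mathcal R,m}=\frac1{\delta_m}Q_m^\Sigma+\sum_{k=1}^m\frac1{\gamma_k}\mathcal D^I_k$, $$\mathcal F_{\mathcal R}=\{u\in\widetilde{\mathcal F}:\lim_{m\to\infty}\mathcal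 E_{\mathcal R,m}(u,u)<\infty\},\qquad \mathcal E_{\mathcal R}(u,v)=\lim_{m\to\infty}\mathcal E_{\mathcal R,m}(u,v),$$ $\mathcal E^I_{\mathcal R}=\sum_{k\ge1}\frac1{\gamma_k}\mathcal D^I_k$, $\mathcal E^\Sigma_{\mathcal R}=\mathcal E_{\mathcal R}-\mathcal E^I_{\mathcal R}$ on $\mathcal F_{\mathcal R}$, and $\mathcal F^I_{\mathcal R}=\{u\in\mathcal F_{\mathcal R}:\mathcal E^\Sigma_{\mathcal R}(u,u)=0\}$. **Theorem.** Let $\mathcal R\in\mathcal{MP}^{\mathbb N}$. Then $(\mathcal E^I_{\mathcal R},\mathcal F^I_{\mathcal R})\in\mathcal{RF}_S$, and its (unique) resolution is $\{((\delta_m)^{-1}\mathcal E^I_{\mathcal R^{(m)}},\mathcal F^I_{\mathcal R^{(m)}},\gamma_m)\}_{m\ge0}$ (the value of $\gamma_0$ being irrelevant). Moreover $r_0(\mathcal E^I_{\mathcal R},\mathcal F^I_{\mathcal R})$ exists and is at most $1$, and there is a unique $\mathcal R'\in\mathcal{MP}^{\mathbb N}$ with $$\big(r_0(\mathcal E^I_{\mathcal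 R},\mathcal F^I_{\mathcal R})\,\mathcal E^I_{\mathcal R},\ \mathcal F^I_{\mathcal R}\big)=(\mathcal E_{\mathcal R'},\mathcal F_{\mathcal R'}).$$ -/

import Mathlib

open MeasureTheory Filter Topology Set
open scoped ContDiff unitInterval

noncomputable section

namespace SSG

/-! ## Resistance forms on an arbitrary set -/

/-- A pair `(𝓔, 𝓕)`: a set `𝓕` of real functions on `X` and a two-variable functional `𝓔`, of which only
the values on `𝓕 × 𝓕` are meaningful. -/
structure FormPair (X : Type*) where
  dom : Set (X → ℝ)
  form : (X → ℝ) → (X → ℝ) → ℝ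

namespace FormPair

variable {X : Type*}

/-- Equality of pairs: same domain `𝓕`, and the same values on `𝓕 × 𝓕`. -/
def Same (A B : FormPair X) : Prop :=
  A.dom = B.dom ∧ ∀ u ∈ A.dom, ∀ v ∈ A.dom, A.form u v = B.form u v

/-- The pair `(c 𝓔, 𝓕)`. -/
def scale (c : ℝ) (A : FormPair X) : FormPair X where
  dom := A.dom
  form u v := c * A.form u v

/-- The set of quotients whose supremum is `R(x, y)`. -/
def resistanceSet (A : FormPair X) (x y : X) : Set ℝ :=
  {t | ∃ u ∈ A.dom, 0 < A.form u u ∧ t = |u x - u y| ^ 2 / A.form u u}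

/-- The resistance metric associated with `(𝓔, 𝓕)`. -/
def resistance (A : FormPair X) (x y : X) : ℝ := sSup (A.resistanceSet x y)

/-- The unit truncation of a function. -/
def truncate (u : X → ℝ) : X → ℝ := fun x => max 0 (min (u x) 1)

/-- Resistance forms, axioms (RF1) to (RF5). -/
structure IsResistanceForm (A : FormPair X) : Prop where
  const_mem : ∀ c : ℝ, (fun _ => c) ∈ A.dom
  add_mem : ∀ u ∈ A.dom, ∀ v ∈ A.dom, u + v ∈ A.dom
  smul_mem : ∀ c : ℝ, ∀ u ∈ A.dom, c • u ∈ A.dom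
  add_left : ∀ u ∈ A.dom, ∀ v ∈ A.dom, ∀ w ∈ A.dom, A.form (u + v) w = A.form u w + A.form v w
  smul_left : ∀ c : ℝ, ∀ u ∈ A.dom, ∀ v ∈ A.dom, A.form (c • u) v = c * A.form u v
  symm : ∀ u ∈ A.dom, ∀ v ∈ A.dom, A.form u v = A.form v u
  nonneg : ∀ u ∈ A.dom, 0 ≤ A.form u u
  eq_zero_iff : ∀ u ∈ A.dom, (A.form u u = 0 ↔ ∃ c : ℝ, u = fun _ => c)
  /-- Completeness of `𝓕` modulo constants with respect to the norm `√(𝓔(u, u))`. -/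
  complete : ∀ s : ℕ → X → ℝ, (∀ n, s n ∈ A.dom) →
    (∀ ε > 0, ∃ N, ∀ m ≥ N, ∀ n ≥ N, A.form (s m - s n) (s m - s n) < ε) →
    ∃ u ∈ A.dom, Tendsto (fun n => A.form (s n - u) (s n - u)) atTop (𝓝 0)
  separates : ∀ x y : X, x ≠ y → ∃ u ∈ A.dom, u x ≠ u y
  bounded : ∀ x y : X, BddAbove (A.resistanceSet x y)
  markov : ∀ u ∈ A.dom, truncate u ∈ A.dom ∧ A.form (truncate u) (truncate u) ≤ A.form u u

/-- `u ∈ 𝓕` minimises `𝓔(v, v)` among all `v ∈ 𝓕` with the same values as `u` on `Y`. -/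
def IsHarmonic (A : FormPair X) (Y : Set X) (u : X → ℝ) : Prop :=
  u ∈ A.dom ∧ ∀ v ∈ A.dom, EqOn v u Y → A.form u u ≤ A.form v v

open Classical in
/-- The `Y`-harmonic extension `h_Y(f)` of `f : Y → ℝ` (the zero function if there is none). -/
def harmonicExt (A : FormPair X) (Y : Set X) (f : Y → ℝ) : X → ℝ :=
  if h : ∃ u, A.IsHarmonic Y u ∧ Y.domRestrict u = f then h.choose else 0

/-- The trace `(𝓔|_Y, 𝓕|_Y)`. -/
def trace (A : FormPair X) (Y : Set X) : FormPair Y where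
  dom := {f | ∃ u ∈ A.dom, Y.domRestrict u = f}
  form f g := A.form (A.harmonicExt Y f) (A.harmonicExt Y g)

end FormPair

/-! ## The Sobolev space `H¹([0, 1])` -/

/-- `g` is a derivative of `f` on `(0, 1)` in the sense of distributions. -/
def HasWeakDeriv (f g : ℝ → ℝ) : Prop :=
  ∀ φ : ℝ → ℝ, ContDiff ℝ ∞ φ → HasCompactSupport φ → tsupport φ ⊆ Ioo 0 1 →
    ∫ x in Ioo (0 : ℝ) 1, f x * deriv φ x = - ∫ x in Ioo (0 : ℝ) 1, g x * φ x

/-- `g ∈ L²(0, 1)` is the distributional derivative of `f : [0, 1] → ℝ`. -/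
def IsL2Deriv (f : I → ℝ) (g : ℝ → ℝ) : Prop :=
  MemLp g 2 (volume.restrict (Ioo (0 : ℝ) 1)) ∧ HasWeakDeriv (IccExtend zero_le_one f) g

/-- `f ∈ H¹([0, 1])`, where, as usual in dimension one, an element of `H¹` is its continuous version. -/
def MemH1 (f : I → ℝ) : Prop := Continuous f ∧ ∃ g, IsL2Deriv f g

open Classical in
/-- The distributional derivative of `f ∈ H¹([0, 1])` (unique almost everywhere). -/
def weakDeriv (f : I → ℝ) : ℝ → ℝ := if h : ∃ g, IsL2Deriv f g then h.choose else 0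

/-- The Dirichlet integral over `[0, 1]`. -/
def dirichlet (f g : I → ℝ) : ℝ := ∫ x in Ioo (0 : ℝ) 1, weakDeriv f x * weakDeriv g x

/-! ## The stretched Sierpinski gasket

The vertices are `p 0`, `p 1`, `p 2`. The three bonds are the cyclic pairs `(i, i + 1)`, `i : Fin 3`. -/

abbrev Plane : Type := EuclideanSpace ℝ (Fin 2)

/-- The contraction `G_i`. -/
def G (p : Fin 3 → Plane) (α : ℝ) (i : Fin 3) (x : Plane) : Plane :=
  ((1 - α) / 2) • (x - p i) + p i

/-- `G_w = G_{w₁} ∘ ⋯ ∘ G_{w_m}`. -/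
def Gw (p : Fin 3 → Plane) (α : ℝ) : List (Fin 3) → Plane → Plane
  | [] => id
  | i :: w => G p α i ∘ Gw p α w

/-- `V_m`, the union of `G_w {p₁, p₂, p₃}` over all words `w` of length `m`. -/
def V (p : Fin 3 → Plane) (α : ℝ) (m : ℕ) : Set Plane :=
  ⋃ w : Fin m → Fin 3, Gw p α (List.ofFn w) '' range p

/-- The line segment `e_{ij}` with end points `G_i(p_j)` and `G_j(p_i)`, where `j = i + 1`. -/
def bond (p : Fin 3 → Plane) (α : ℝ) (i : Fin 3) : Set Plane :=
  segment ℝ (G p α i (p (i + 1))) (G p α (i + 1) (p i))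

/-- `Σ`, see `cantorPart_eq_iff` for its characterisation as a self-similar set. -/
def cantorPart (p : Fin 3 → Plane) (α : ℝ) : Set Plane := closure (⋃ m, V p α m)

/-- `K`, see `gasket_eq_iff` for its characterisation by a fixed point equation. -/
def gasket (p : Fin 3 → Plane) (α : ℝ) : Set Plane :=
  cantorPart p α ∪ ⋃ (w : List (Fin 3)) (i : Fin 3), Gw p α w '' bond p α i

variable (p : Fin 3 → Plane) (α : ℝ)

theorem continuous_G (i : Fin 3) : Continuous (G p α i) := by
  unfold G; fun_prop

theorem mem_iUnion_V {x : Plane} :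
    x ∈ (⋃ m, V p α m) ↔ ∃ w : List (Fin 3), x ∈ Gw p α w '' range p := by
  simp only [V, mem_iUnion]
  constructor
  · rintro ⟨m, w, h⟩
    exact ⟨_, h⟩
  · rintro ⟨w, h⟩
    exact ⟨w.length, w.get, by rwa [List.ofFn_get]⟩

theorem mapsTo_G_cantorPart (i : Fin 3) : MapsTo (G p α i) (cantorPart p α) (cantorPart p α) := by
  refine MapsTo.closure ?_ (continuous_G p α i)
  intro x hx
  rw [mem_iUnion_V] at hx ⊢
  obtain ⟨w, y, hy, rfl⟩ := hx
  exact ⟨i :: w, y, hy, rfl⟩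

theorem mapsTo_G (i : Fin 3) : MapsTo (G p α i) (gasket p α) (gasket p α) := by
  rintro x (hx | hx)
  · exact Or.inl (mapsTo_G_cantorPart p α i hx)
  · simp only [mem_iUnion] at hx
    obtain ⟨w, j, y, hy, rfl⟩ := hx
    exact Or.inr (mem_iUnion.2 ⟨i :: w, mem_iUnion.2 ⟨j, y, hy, rfl⟩⟩)

theorem bond_subset (i : Fin 3) : bond p α i ⊆ gasket p α := fun x hx =>
  Or.inr (mem_iUnion.2 ⟨[], mem_iUnion.2 ⟨i, x, hx, rfl⟩⟩)

theorem vertex_mem (i : Fin 3) : p i ∈ gasket p α :=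
  Or.inl (subset_closure ((mem_iUnion_V p α).2 ⟨[], p i, mem_range_self i, rfl⟩))

theorem dist_G (hα : α < 1) (i : Fin 3) (x y : Plane) :
    dist (G p α i x) (G p α i y) = (1 - α) / 2 * dist x y := by
  have h : (0 : ℝ) ≤ (1 - α) / 2 := by linarith
  simp only [G, dist_add_right, dist_smul₀, dist_sub_right, Real.norm_of_nonneg h]

theorem dist_Gw (hα : α < 1) (w : List (Fin 3)) (x y : Plane) :
    dist (Gw p α w x) (Gw p α w y) = ((1 - α) / 2) ^ w.length * dist x y := by
  induction w with
  | nil => simp [Gw]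
  | cons i w ih =>
    simp only [Gw, Function.comp_apply, dist_G p α hα, ih, List.length_cons, pow_succ]
    ring

theorem subset_of_subset_union (h0 : 0 < α) (h1 : α < 1) {C D E : Set Plane} (hC : IsCompact C)
    (hD : IsClosed D) (hne : D.Nonempty) (hDG : ∀ i, MapsTo (G p α i) D D) (hE : E ⊆ D)
    (hCE : C ⊆ (⋃ i, G p α i '' C) ∪ E) : C ⊆ D := by
  have hc : (0 : ℝ) ≤ (1 - α) / 2 := by linarith
  obtain ⟨M, hM⟩ := (hC.image (Metric.continuous_infDist_pt D)).bddAbove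
  have key : ∀ n : ℕ, ∀ x ∈ C, Metric.infDist x D ≤ ((1 - α) / 2) ^ n * max M 0 := by
    intro n
    induction n with
    | zero =>
      intro x hx
      simpa using Or.inl (hM ⟨x, hx, rfl⟩)
    | succ n ih =>
      intro x hx
      rcases hCE hx with h | h
      · obtain ⟨i, y, hy, rfl⟩ := mem_iUnion.1 h
        have h2 : Metric.infDist (G p α i y) D ≤ (1 - α) / 2 * Metric.infDist y D := by
          refine le_of_forall_pos_lt_add fun ε hε => ?_
          obtain ⟨z, hz, hyz⟩ := (Metric.infDist_lt_iff (x := y) hne).1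
            (lt_add_of_pos_right (Metric.infDist y D) hε)
          calc Metric.infDist (G p α i y) D ≤ dist (G p α i y) (G p α i z) :=
                Metric.infDist_le_dist_of_mem (hDG i hz)
            _ = (1 - α) / 2 * dist y z := dist_G p α h1 i y z
            _ < (1 - α) / 2 * Metric.infDist y D + ε := by nlinarith
        calc _ ≤ _ := h2
          _ ≤ (1 - α) / 2 * (((1 - α) / 2) ^ n * max M 0) :=
              mul_le_mul_of_nonneg_left (ih y hy) hc
          _ = _ := by ring
      · rw [Metric.infDist_zero_of_mem (hE h)]
        positivity
  intro x hx
  have hlim : Tendsto (fun n : ℕ => ((1 - α) / 2) ^ n * max M 0) atTop (𝓝 (0 * max M 0)) :=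
    (tendsto_pow_atTop_nhds_zero_of_lt_one hc (by linarith)).mul_const _
  rw [zero_mul] at hlim
  have h2 : Metric.infDist x D = 0 :=
    le_antisymm (ge_of_tendsto' hlim fun n => key n x hx) Metric.infDist_nonneg
  exact (hD.mem_iff_infDist_zero hne).2 h2

theorem cantorPart_subset (h0 : 0 < α) (h1 : α < 1) {D : Set Plane}
    (hD : IsClosed D) (hne : D.Nonempty) (hDG : ∀ i, MapsTo (G p α i) D D) :
    cantorPart p α ⊆ D := by
  have hp : range p ⊆ D := by
    rintro _ ⟨i, rfl⟩
    refine subset_of_subset_union p α h0 h1 (C := {p i}) (E := ∅) isCompact_singleton hD hne hDG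
      (empty_subset _) ?_ rfl
    rintro _ rfl
    exact Or.inl (mem_iUnion.2 ⟨i, p i, rfl, by simp [G]⟩)
  refine closure_minimal ?_ hD
  intro x hx
  rw [mem_iUnion_V] at hx
  obtain ⟨w, y, hy, rfl⟩ := hx
  induction w with
  | nil => exact hp hy
  | cons i w ih => exact hDG i ih

theorem isBounded_cantorPart (h0 : 0 < α) (h1 : α < 1) : Bornology.IsBounded (cantorPart p α) := by
  have hM : ∀ i, ‖p i‖ ≤ ∑ j, ‖p j‖ := fun i =>
    Finset.single_le_sum (f := fun j => ‖p j‖) (fun _ _ => norm_nonneg _) (Finset.mem_univ i)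
  refine Metric.isBounded_closedBall.subset
    (cantorPart_subset p α h0 h1 (D := Metric.closedBall 0 (∑ j, ‖p j‖))
      Metric.isClosed_closedBall ⟨p 0, by simpa using hM 0⟩ ?_)
  intro i x hx
  rw [mem_closedBall_zero_iff] at hx ⊢
  have e : G p α i x = ((1 - α) / 2) • x + (1 - (1 - α) / 2) • p i := by
    simp only [G, smul_sub, sub_smul, one_smul]; abel
  rw [e]
  refine (norm_add_le _ _).trans ?_
  rw [norm_smul, norm_smul, Real.norm_of_nonneg (by linarith), Real.norm_of_nonneg (by linarith)]
  have := hM i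
  nlinarith

theorem isCompact_cantorPart (h0 : 0 < α) (h1 : α < 1) : IsCompact (cantorPart p α) :=
  Metric.isCompact_of_isClosed_isBounded isClosed_closure (isBounded_cantorPart p α h0 h1)

theorem cantorPart_fixed (h0 : 0 < α) (h1 : α < 1) :
    cantorPart p α = ⋃ i, G p α i '' cantorPart p α := by
  refine Subset.antisymm (closure_minimal ?_ ?_)
    (iUnion_subset fun i => (mapsTo_G_cantorPart p α i).image_subset)
  · intro x hx
    rw [mem_iUnion_V] at hx
    obtain ⟨w, y, hy, rfl⟩ := hx
    cases w with
    | nil =>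
      obtain ⟨i, rfl⟩ := hy
      exact mem_iUnion.2 ⟨i, p i, subset_closure ((mem_iUnion_V p α).2
        ⟨[], p i, mem_range_self i, rfl⟩), by simp [G, Gw]⟩
    | cons i w =>
      exact mem_iUnion.2 ⟨i, Gw p α w y, subset_closure ((mem_iUnion_V p α).2 ⟨w, y, hy, rfl⟩), rfl⟩
  · exact isClosed_iUnion_of_finite fun i =>
      ((isCompact_cantorPart p α h0 h1).image (continuous_G p α i)).isClosed

/-- `Σ` is the unique nonempty compact set with `Σ = G_1(Σ) ∪ G_2(Σ) ∪ G_3(Σ)`. -/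
theorem cantorPart_eq_iff (h0 : 0 < α) (h1 : α < 1) (C : Set Plane) :
    (IsCompact C ∧ C.Nonempty ∧ C = ⋃ i, G p α i '' C) ↔ C = cantorPart p α := by
  have hne : (cantorPart p α).Nonempty :=
    ⟨p 0, subset_closure ((mem_iUnion_V p α).2 ⟨[], p 0, mem_range_self 0, rfl⟩)⟩
  constructor
  · rintro ⟨hC, hCne, hCG⟩
    refine Subset.antisymm ?_ (cantorPart_subset p α h0 h1 hC.isClosed hCne fun i x hx => ?_)
    · exact subset_of_subset_union p α h0 h1 (E := ∅) hC isClosed_closure hne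
        (mapsTo_G_cantorPart p α) (empty_subset _) (by rw [union_empty]; exact hCG.subset)
    · rw [hCG]
      exact mem_iUnion.2 ⟨i, x, hx, rfl⟩
  · rintro rfl
    exact ⟨isCompact_cantorPart p α h0 h1, hne, cantorPart_fixed p α h0 h1⟩

theorem continuous_Gw (w : List (Fin 3)) : Continuous (Gw p α w) := by
  induction w with
  | nil => exact continuous_id
  | cons i w ih => exact (continuous_G p α i).comp ih

theorem isCompact_bond (i : Fin 3) : IsCompact (bond p α i) := by
  rw [bond, segment_eq_image_lineMap]
  exact isCompact_Icc.image AffineMap.lineMap_continuous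

theorem isCompact_gasket (h0 : 0 < α) (h1 : α < 1) : IsCompact (gasket p α) := by
  have hc : (0 : ℝ) ≤ (1 - α) / 2 := by linarith
  have hS := isCompact_cantorPart p α h0 h1
  obtain ⟨b, hb⟩ : ∃ b : ℝ, ∀ i, ∀ y ∈ bond p α i, dist y (p i) ≤ b := by
    have : ∀ i, ∃ b : ℝ, ∀ y ∈ bond p α i, dist y (p i) ≤ b := fun i => by
      obtain ⟨b, hb⟩ := ((isCompact_bond p α i).image
        (continuous_id.dist (continuous_const (y := p i)))).bddAbove
      exact ⟨b, fun y hy => hb ⟨y, hy, rfl⟩⟩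
    choose b hb using this
    exact ⟨∑ i, |b i|, fun i y hy => (hb i y hy).trans ((le_abs_self _).trans
      (Finset.single_le_sum (f := fun j => |b j|) (fun _ _ => abs_nonneg _) (Finset.mem_univ i)))⟩
  have hnear : ∀ w i, ∀ y ∈ bond p α i,
      Gw p α w y ∈ Metric.cthickening (((1 - α) / 2) ^ w.length * b) (cantorPart p α) := by
    intro w i y hy
    refine Metric.mem_cthickening_of_dist_le _ (Gw p α w (p i)) _ _ (subset_closure
      ((mem_iUnion_V p α).2 ⟨w, p i, mem_range_self i, rfl⟩)) ?_
    rw [dist_Gw p α h1]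
    exact mul_le_mul_of_nonneg_left (hb i y hy) (pow_nonneg hc _)
  have hb0 : 0 ≤ b := dist_nonneg.trans (hb 0 _ (left_mem_segment ℝ _ _))
  have hc1 : (1 - α) / 2 ≤ 1 := by linarith
  have heq : gasket p α = ⋂ m : ℕ, (Metric.cthickening (((1 - α) / 2) ^ m * b) (cantorPart p α) ∪
      ⋃ w ∈ {w : List (Fin 3) | w.length < m}, ⋃ i, Gw p α w '' bond p α i) := by
    ext x
    constructor
    · rintro (hx | hx)
      · exact mem_iInter.2 fun m => Or.inl (Metric.self_subset_cthickening _ hx)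
      · obtain ⟨w, hw⟩ := mem_iUnion.1 hx
        obtain ⟨i, y, hy, rfl⟩ := mem_iUnion.1 hw
        refine mem_iInter.2 fun m => ?_
        rcases lt_or_ge w.length m with h | h
        · exact Or.inr (mem_biUnion h (mem_iUnion.2 ⟨i, y, hy, rfl⟩))
        · exact Or.inl (Metric.cthickening_mono
            (mul_le_mul_of_nonneg_right (pow_le_pow_of_le_one hc hc1 h) hb0) _ (hnear w i y hy))
    · intro hx
      by_cases hE : ∃ w i, x ∈ Gw p α w '' bond p α i
      · obtain ⟨w, i, h⟩ := hE
        exact Or.inr (mem_iUnion.2 ⟨w, mem_iUnion.2 ⟨i, h⟩⟩)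
      · left
        have h2 : ∀ m : ℕ, Metric.infDist x (cantorPart p α) ≤ ((1 - α) / 2) ^ m * b := by
          intro m
          rcases mem_iInter.1 hx m with h | h
          · rw [Metric.mem_cthickening_iff] at h
            exact ENNReal.toReal_le_of_le_ofReal (by positivity) h
          · obtain ⟨w, -, h⟩ := mem_iUnion₂.1 h
            exact absurd ⟨w, mem_iUnion.1 h⟩ hE
        have hlim : Tendsto (fun n : ℕ => ((1 - α) / 2) ^ n * b) atTop (𝓝 (0 * b)) :=
          (tendsto_pow_atTop_nhds_zero_of_lt_one hc (by linarith)).mul_const _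
        rw [zero_mul] at hlim
        have hne : (cantorPart p α).Nonempty :=
          ⟨p 0, subset_closure ((mem_iUnion_V p α).2 ⟨[], p 0, mem_range_self 0, rfl⟩)⟩
        exact (isClosed_closure.mem_iff_infDist_zero hne).2
          (le_antisymm (ge_of_tendsto' hlim h2) Metric.infDist_nonneg)
  have hfin : ∀ m : ℕ, {w : List (Fin 3) | w.length < m}.Finite := fun m =>
    List.finite_length_lt (Fin 3) m
  have hcpt : ∀ m : ℕ, IsCompact (⋃ w ∈ {w : List (Fin 3) | w.length < m}, ⋃ i,
      Gw p α w '' bond p α i) := fun m =>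
    (hfin m).isCompact_biUnion fun w _ => isCompact_iUnion fun i =>
      (isCompact_bond p α i).image (continuous_Gw p α w)
  refine Metric.isCompact_of_isClosed_isBounded ?_ ?_
  · rw [heq]
    exact isClosed_iInter fun m => Metric.isClosed_cthickening.union (hcpt m).isClosed
  · rw [heq]
    exact (hS.isBounded.cthickening.union (hcpt 0).isBounded).subset (iInter_subset _ 0)

/-- `K` is the unique compact set with `K = G_1(K) ∪ G_2(K) ∪ G_3(K) ∪ e_{12} ∪ e_{23} ∪ e_{31}`. -/
theorem gasket_eq_iff (h0 : 0 < α) (h1 : α < 1) (C : Set Plane) :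
    (IsCompact C ∧ C = (⋃ i, G p α i '' C) ∪ ⋃ i, bond p α i) ↔ C = gasket p α := by
  constructor
  · rintro ⟨hC, hCG⟩
    have hmap : ∀ i, MapsTo (G p α i) C C := fun i x hx => by
      rw [hCG]
      exact Or.inl (mem_iUnion.2 ⟨i, x, hx, rfl⟩)
    have hbond : ∀ i, bond p α i ⊆ C := fun i x hx => by
      rw [hCG]
      exact Or.inr (mem_iUnion.2 ⟨i, hx⟩)
    refine Subset.antisymm ?_ (union_subset (cantorPart_subset p α h0 h1 hC.isClosed
      ⟨_, hbond 0 (left_mem_segment ℝ _ _)⟩ hmap) (iUnion_subset fun w => iUnion_subset fun i => ?_))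
    · exact subset_of_subset_union p α h0 h1 hC (isCompact_gasket p α h0 h1).isClosed
        ⟨_, vertex_mem p α 0⟩ (mapsTo_G p α) (iUnion_subset (bond_subset p α)) hCG.subset
    · rintro _ ⟨y, hy, rfl⟩
      induction w with
      | nil => exact hbond i hy
      | cons j w ih => exact hmap j ih
  · rintro rfl
    refine ⟨isCompact_gasket p α h0 h1, Subset.antisymm ?_ (union_subset
      (iUnion_subset fun i => (mapsTo_G p α i).image_subset) (iUnion_subset (bond_subset p α)))⟩
    rintro x (hx | hx)
    · rw [cantorPart_fixed p α h0 h1] at hx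
      obtain ⟨i, y, hy, rfl⟩ := mem_iUnion.1 hx
      exact Or.inl (mem_iUnion.2 ⟨i, y, Or.inl hy, rfl⟩)
    · obtain ⟨w, hw⟩ := mem_iUnion.1 hx
      obtain ⟨i, y, hy, rfl⟩ := mem_iUnion.1 hw
      cases w with
      | nil => exact Or.inr (mem_iUnion.2 ⟨i, hy⟩)
      | cons j w => exact Or.inl (mem_iUnion.2 ⟨j, Gw p α w y,
          Or.inr (mem_iUnion.2 ⟨w, mem_iUnion.2 ⟨i, y, hy, rfl⟩⟩), rfl⟩)

/-- The space `K` itself; it carries the topology of the Euclidean metric. -/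
abbrev K : Type := gasket p α

/-- `G_i : K → K`. -/
def GK (i : Fin 3) : K p α → K p α := (mapsTo_G p α i).restrict

/-- `G_w : K → K`. -/
def GwK : List (Fin 3) → K p α → K p α
  | [] => id
  | i :: w => GK p α i ∘ GwK w

/-- The vertices as points of `K`. -/
def vertex (i : Fin 3) : K p α := ⟨p i, vertex_mem p α i⟩

/-- The parametrisation `ξ(t) = (1 - t) G_i(p_j) + t G_j(p_i)` of `e_{ij}`, where `j = i + 1`. -/
def bondPath (i : Fin 3) (t : I) : K p α :=
  ⟨AffineMap.lineMap (G p α i (p (i + 1))) (G p α (i + 1) (p i)) (t : ℝ),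
    bond_subset p α i (by
      rw [bond, segment_eq_image_lineMap]
      exact ⟨t, t.2, rfl⟩)⟩

/-- The restriction of `u` to `e_{ij}^w = G_w(e_{ij})` in the affine parametrisation `G_w ∘ ξ`. -/
def onBond (u : K p α → ℝ) (w : List (Fin 3)) (i : Fin 3) : I → ℝ :=
  fun t => u (GwK p α w (bondPath p α i t))

/-! ## Completely symmetric resistance forms -/

/-- `𝓕̃`: continuous functions on `K` that are `H¹` on every line segment `e_{ij}^w`. -/
def FTilde : Set (K p α → ℝ) :=
  {u | Continuous u ∧ ∀ w i, MemH1 (onBond p α u w i)}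

/-- `DI k` is `𝓓^I_{k+1}`, the sum of the Dirichlet integrals over `e_{ij}^w` with `|w| = k`. -/
def DI (k : ℕ) (u v : K p α → ℝ) : ℝ :=
  ∑ w : Fin k → Fin 3, ∑ i : Fin 3,
    dirichlet (onBond p α u (List.ofFn w) i) (onBond p α v (List.ofFn w) i)

/-- The class `𝓡𝓕_S^{(0)}`. -/
structure IsRF0 (A : FormPair (K p α)) : Prop where
  isResistanceForm : A.IsResistanceForm
  continuous : ∀ u ∈ A.dom, Continuous u
  mem_iff : ∀ u : K p α → ℝ, u ∈ A.dom ↔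
    (∀ i, ∃ v ∈ A.dom, EqOn u v (range (GK p α i))) ∧ ∀ i, MemH1 (onBond p α u [] i)
  /-- The resistance metric induces the Euclidean topology of `K`. -/
  isOpen_iff : ∀ U : Set (K p α), IsOpen U ↔
    ∀ x ∈ U, ∃ ε > 0, ∀ y, A.resistance x y < ε → y ∈ U
  /-- Invariance under all linear maps of the plane that map `K` onto itself. -/
  invariant : ∀ (φ : Plane →ₗ[ℝ] Plane) (hφ : φ '' gasket p α = gasket p α), ∀ u ∈ A.dom,
    u ∘ (mapsTo_iff_image_subset.2 hφ.subset).restrict ∈ A.dom ∧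
    A.form (u ∘ (mapsTo_iff_image_subset.2 hφ.subset).restrict)
      (u ∘ (mapsTo_iff_image_subset.2 hφ.subset).restrict) = A.form u u

/-- `{(𝓔_m, 𝓕_m, η_m)}_{m ≥ 0}` is a resolution of `A`, where `B m = (𝓔_m, 𝓕_m)` and `η m` stands for
`η_{m+1}`. -/
structure IsResolution (A : FormPair (K p α)) (B : ℕ → FormPair (K p α)) (η : ℕ → ℝ) : Prop where
  isRF0 : ∀ m, IsRF0 p α (B m)
  pos : ∀ m, 0 < η m
  zero : (B 0).Same A
  dom_succ : ∀ m i, (B (m + 1)).dom = {f | ∃ u ∈ (B m).dom, f = u ∘ GK p α i}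
  form_eq : ∀ m, ∀ u ∈ (B m).dom, ∀ v ∈ (B m).dom, (B m).form u v =
    ∑ i, (B (m + 1)).form (u ∘ GK p α i) (v ∘ GK p α i) + 1 / η m * DI p α 0 u v

/-- The class `𝓡𝓕_S` of completely symmetric resistance forms. -/
def IsRFS (A : FormPair (K p α)) : Prop :=
  IsRF0 p α A ∧ ∃ B η, IsResolution p α A B η

/-- The form with unit conductances on a triangle. -/
def Q0 (a b : Fin 3 → ℝ) : ℝ := ∑ i, (a i - a (i + 1)) * (b i - b (i + 1))

/-- `r > 0` and the trace of `A` on `V_0 = {p₁, p₂, p₃}` is `(1 / r) Q_0^Σ`. -/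
def IsTraceConstant (A : FormPair (K p α)) (r : ℝ) : Prop :=
  0 < r ∧ ∀ f g : range (vertex p α) → ℝ, (A.trace (range (vertex p α))).form f g =
    1 / r * Q0 (fun i => f ⟨vertex p α i, mem_range_self i⟩)
      (fun i => g ⟨vertex p α i, mem_range_self i⟩)

/-- The constant `r_0(𝓔, 𝓕)`. -/
def r0 (A : FormPair (K p α)) : ℝ := Classical.epsilon (IsTraceConstant p α A)

/-! ## Forms given by sequences of matching pairs -/

/-- `(r, ρ)` is a matching pair. -/
def IsMatching (a : ℝ × ℝ) : Prop := 0 < a.1 ∧ 0 < a.2 ∧ 5 / 3 * a.1 + a.2 = 1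

/-- The set of sequences of matching pairs; `R m` stands for `(r_{m+1}, ρ_{m+1})`. -/
def MPSeq : Set (ℕ → ℝ × ℝ) := {R | ∀ m, IsMatching (R m)}

/-- The shifted sequence `𝓡^{(n)}`. -/
def shift (R : ℕ → ℝ × ℝ) (n : ℕ) : ℕ → ℝ × ℝ := fun m => R (n + m)

/-- `δ_m = r_1 ⋯ r_m`. -/
def delta (R : ℕ → ℝ × ℝ) (m : ℕ) : ℝ := ∏ k ∈ Finset.range m, (R k).1

/-- `gamma R k` is `γ_{k+1} = δ_k ρ_{k+1}`. -/
def gamma (R : ℕ → ℝ × ℝ) (k : ℕ) : ℝ := delta R k * (R k).2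

/-- `Q_m^Σ`. -/
def QSigma (m : ℕ) (u v : K p α → ℝ) : ℝ :=
  ∑ w : Fin m → Fin 3, Q0 (fun i => u (GwK p α (List.ofFn w) (vertex p α i)))
    (fun i => v (GwK p α (List.ofFn w) (vertex p α i)))

/-- `𝓔_{𝓡, m} = δ_m⁻¹ Q_m^Σ + ∑_{k=1}^m γ_k⁻¹ 𝓓_k^I`. -/
def approxForm (R : ℕ → ℝ × ℝ) (m : ℕ) (u v : K p α → ℝ) : ℝ :=
  1 / delta R m * QSigma p α m u v + ∑ k ∈ Finset.range m, 1 / gamma R k * DI p α k u v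

/-- `(𝓔_𝓡, 𝓕_𝓡)`. -/
def fullForm (R : ℕ → ℝ × ℝ) : FormPair (K p α) where
  dom := {u | u ∈ FTilde p α ∧ ∃ l, Tendsto (fun m => approxForm p α R m u u) atTop (𝓝 l)}
  form u v := limUnder atTop (fun m => approxForm p α R m u v)

/-- The line part `𝓔_𝓡^I = ∑_{k ≥ 1} γ_k⁻¹ 𝓓_k^I` as a functional on `𝓕_𝓡 × 𝓕_𝓡`. -/
def lineEnergy (R : ℕ → ℝ × ℝ) (u v : K p α → ℝ) : ℝ := ∑' k, 1 / gamma R k * DI p α k u v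

/-- The SG part `𝓔_𝓡^Σ = 𝓔_𝓡 - 𝓔_𝓡^I`. -/
def sgEnergy (R : ℕ → ℝ × ℝ) (u v : K p α → ℝ) : ℝ :=
  (fullForm p α R).form u v - lineEnergy p α R u v

/-- `(𝓔_𝓡^I, 𝓕_𝓡^I)`, where `𝓕_𝓡^I` is the set of all `u ∈ 𝓕_𝓡` with `𝓔_𝓡^Σ(u, u) = 0`. -/
def lineForm (R : ℕ → ℝ × ℝ) : FormPair (K p α) where
  dom := {u | u ∈ (fullForm p α R).dom ∧ sgEnergy p α R u u = 0}
  form := lineEnergy p α R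

end SSG

end

noncomputable section

namespace SSG

/-! ## The Sobolev space `H¹` through absolutely continuous functions -/

/-! Everything rests on cutting `K` into three cells and three bonds. With `r = r_1` and `ρ = ρ_1`,
the line energy of `𝓡` is `1/r` times the sum of the line energies of `𝓡^{(1)}` on the cells plus
`1/ρ` times the Dirichlet integrals over the bonds (`lineEnergy_succ`). The domain splits in the
same way (`mem_lineDom_iff_pieces`), and pieces may be glued freely once their values agree at the
ends of the bonds.

The matching condition makes `𝓔_{𝓡,m}(u,u)` increase with `m` (`approxForm_mono`). Hence `u ∈ 𝓕̃`
belongs to `𝓕^I` iff its weighted Dirichlet integrals are summable and `δ_m⁻¹ Q_m^Σ(u,u) → 0`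
(`mem_lineDom_iff`), and its line energy then dominates every `𝓔_{𝓡,m}(u,u)`. As `r_m ≤ 3/5`,
passing to a cell multiplies the square root of the energy by at most `4/5`. Summing a geometric
series bounds the oscillation by the energy (`abs_sub_le_sqrt`), and this yields finite resistances,
completeness and continuity of the resistance metric. So the line form is in `𝓡𝓕_S^{(0)}`
(`isRF0_lineForm`), and iterating the splitting produces its resolution (`isResolution_lineForm`).
Uniqueness comes from testing with functions that vanish on two of the cells: a locally constant one
detects `η_m`, and the others then recover the form on the remaining cell (`IsDecomposition.same`).

Rotational symmetry and the vanishing energy of constants force the trace on `V_0` to be `s(𝓡)⁻¹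
Q_0^Σ` (`exists_harmonic_constant`), and `Q_0^Σ ≤ 𝓔^I` gives `s(𝓡) ≤ 1`. Seen from its vertices a
cell is a triangle of resistors `r s(𝓡^{(1)})`, while a bond is a resistor `ρ`. Reducing this
network gives `s(𝓡) = 5/3 r s(𝓡^{(1)}) + ρ` (`lineConst_eq`). With `s_m = s(𝓡^{(m)})`, the pairs
`(r_m s_m / s_{m-1}, ρ_m / s_{m-1})` are therefore matching, and they form `𝓡'`. For this choice
`s_0⁻¹ 𝓔_{𝓡',m}` is the trace of the line form on `V_m` together with the bonds of the first `m`
levels (`exists_isLevelApprox`). These sets exhaust a dense subset of `K`, so the traces converge to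
the line energy and the two forms coincide (`same_lineSeq`). Finally, `𝓔_{𝓡'}` splits with weights
`γ'_m`, which determine `𝓡'` (`eq_of_same_fullForm`). -/

theorem _root_.AbsolutelyContinuousOnInterval.congr_uIcc {f g : ℝ → ℝ} {a b : ℝ}
    (hf : AbsolutelyContinuousOnInterval f a b) (h : EqOn f g (uIcc a b)) :
    AbsolutelyContinuousOnInterval g a b := by
  rw [absolutelyContinuousOnInterval_iff] at hf ⊢
  intro ε hε
  obtain ⟨δ, hδ, H⟩ := hf ε hε
  refine ⟨δ, hδ, fun E hE hlt => ?_⟩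
  refine lt_of_eq_of_lt (Finset.sum_congr rfl fun i hi => ?_) (H E hE hlt)
  have := hE.1 i hi
  rw [h this.1, h this.2]

theorem restrict_Ioo_eq_Ioc : volume.restrict (Ioo (0 : ℝ) 1) = volume.restrict (Ioc (0 : ℝ) 1) :=
  Measure.restrict_congr_set Ioo_ae_eq_Ioc

theorem integral_Ioo_eq (f : ℝ → ℝ) : ∫ x in Ioo (0 : ℝ) 1, f x = ∫ x in (0 : ℝ)..1, f x := by
  rw [intervalIntegral.integral_of_le zero_le_one, restrict_Ioo_eq_Ioc]

theorem integrableOn_Ioo_iff (f : ℝ → ℝ) :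
    IntegrableOn f (Ioo 0 1) ↔ IntervalIntegrable f volume 0 1 := by
  rw [intervalIntegrable_iff_integrableOn_Ioo_of_le zero_le_one]

theorem integrableOn_mul_continuous {f g : ℝ → ℝ} (hf : IntegrableOn f (Ioo 0 1))
    (hg : Continuous g) : IntegrableOn (fun x => f x * g x) (Ioo 0 1) :=
  hf.mul_continuousOn_of_subset hg.continuousOn measurableSet_Ioo isCompact_Icc Ioo_subset_Icc_self

theorem continuous_integrableOn_Ioo {f : ℝ → ℝ} (hf : Continuous f) : IntegrableOn f (Ioo 0 1) :=
  hf.integrableOn_Icc.mono_set Ioo_subset_Icc_self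

theorem _root_.MeasureTheory.MemLp.integrableOn_Ioo {g : ℝ → ℝ}
    (hg : MemLp g 2 (volume.restrict (Ioo (0 : ℝ) 1))) : IntegrableOn g (Ioo 0 1) :=
  hg.integrable (by norm_num)

theorem HasWeakDeriv.congr_ae {f g g' : ℝ → ℝ} (h : HasWeakDeriv f g)
    (hg : g =ᵐ[volume.restrict (Ioo 0 1)] g') : HasWeakDeriv f g' := by
  intro φ h1 h2 h3
  rw [h φ h1 h2 h3]
  congr 1
  refine integral_congr_ae ?_
  filter_upwards [hg] with x hx
  rw [hx]

theorem HasWeakDeriv.sub {f₁ f₂ g₁ g₂ : ℝ → ℝ} (h₁ : HasWeakDeriv f₁ g₁) (h₂ : HasWeakDeriv f₂ g₂)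
    (hf₁ : Continuous f₁) (hf₂ : Continuous f₂) (hg₁ : IntegrableOn g₁ (Ioo 0 1))
    (hg₂ : IntegrableOn g₂ (Ioo 0 1)) :
    HasWeakDeriv (fun x => f₁ x - f₂ x) (fun x => g₁ x - g₂ x) := by
  intro φ h1 h2 h3
  have hd : Continuous (deriv φ) := h1.continuous_deriv (by simp)
  simp only [sub_mul]
  rw [integral_sub, integral_sub, h₁ φ h1 h2 h3, h₂ φ h1 h2 h3]
  · ring
  · exact integrableOn_mul_continuous hg₁ h1.continuous
  · exact integrableOn_mul_continuous hg₂ h1.continuous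
  · exact continuous_integrableOn_Ioo (hf₁.mul hd)
  · exact continuous_integrableOn_Ioo (hf₂.mul hd)

theorem hasWeakDeriv_deriv {f : ℝ → ℝ} (hf : AbsolutelyContinuousOnInterval f 0 1) :
    HasWeakDeriv f (deriv f) := by
  intro φ h1 h2 h3
  have hφ : AbsolutelyContinuousOnInterval φ 0 1 :=
    ((h1.of_le (by exact_mod_cast le_top)).contDiffOn).absolutelyContinuousOnInterval
  have h0 : φ 0 = 0 := image_eq_zero_of_notMem_tsupport fun h => by simpa using h3 h
  have h1 : φ 1 = 0 := image_eq_zero_of_notMem_tsupport fun h => by simpa using h3 h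
  rw [integral_Ioo_eq, integral_Ioo_eq, hf.integral_mul_deriv_eq_deriv_mul hφ, h0, h1]
  simp

theorem ae_eq_zero_of_forall_integral_mul {g : ℝ → ℝ} (hg : IntegrableOn g (Ioo 0 1))
    (h : ∀ φ : ℝ → ℝ, ContDiff ℝ ∞ φ → HasCompactSupport φ → tsupport φ ⊆ Ioo 0 1 →
      ∫ x in Ioo (0 : ℝ) 1, g x * φ x = 0) : g =ᵐ[volume.restrict (Ioo 0 1)] 0 := by
  have := isOpen_Ioo.ae_eq_zero_of_integral_contDiff_smul_eq_zero (U := Ioo (0 : ℝ) 1)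
    (μ := volume) (f := g) hg.locallyIntegrableOn ?_
  · rw [EventuallyEq, ae_restrict_iff' measurableSet_Ioo]
    exact this
  · intro φ h1 h2 h3
    rw [← h φ h1 h2 h3, setIntegral_eq_integral_of_forall_compl_eq_zero]
    · simp [mul_comm]
    · intro x hx
      rw [image_eq_zero_of_notMem_tsupport fun h => hx (h3 h), mul_zero]

theorem HasWeakDeriv.ae_unique {f g g' : ℝ → ℝ} (h : HasWeakDeriv f g) (h' : HasWeakDeriv f g')
    (hg : IntegrableOn g (Ioo 0 1)) (hg' : IntegrableOn g' (Ioo 0 1)) :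
    g =ᵐ[volume.restrict (Ioo 0 1)] g' := by
  have := ae_eq_zero_of_forall_integral_mul (hg.sub hg') ?_
  · filter_upwards [this] with x hx
    simpa [sub_eq_zero] using hx
  · intro φ h1 h2 h3
    simp only [Pi.sub_apply, sub_mul]
    rw [integral_sub (integrableOn_mul_continuous hg h1.continuous)
      (integrableOn_mul_continuous hg' h1.continuous)]
    have := h φ h1 h2 h3
    have := h' φ h1 h2 h3
    linarith

/-- The vanishing mean is what makes the primitive from `0` vanish again to the right of the
support, so that it is itself a test function. -/
theorem exists_antideriv_test {θ : ℝ → ℝ} (h1 : ContDiff ℝ ∞ θ) (h2 : HasCompactSupport θ)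
    (h3 : tsupport θ ⊆ Ioo 0 1) (h4 : ∫ x in (0 : ℝ)..1, θ x = 0) :
    ∃ φ : ℝ → ℝ, ContDiff ℝ ∞ φ ∧ HasCompactSupport φ ∧ tsupport φ ⊆ Ioo 0 1 ∧ deriv φ = θ := by
  have hc := h1.continuous
  have hd : ∀ x, HasDerivAt (fun x => ∫ t in (0 : ℝ)..x, θ t) (θ x) x := fun x =>
    intervalIntegral.integral_hasDerivAt_right (hc.intervalIntegrable _ _)
      hc.stronglyMeasurable.stronglyMeasurableAtFilter hc.continuousAt
  have hderiv : deriv (fun x => ∫ t in (0 : ℝ)..x, θ t) = θ := funext fun x => (hd x).deriv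
  -- The primitive need not vanish in gaps of the support of `θ`, so an interval containing that
  -- support is needed.
  obtain ⟨a, b, ha, hb, hab⟩ : ∃ a b : ℝ, 0 < a ∧ b < 1 ∧ tsupport θ ⊆ Icc a b := by
    rcases (tsupport θ).eq_empty_or_nonempty with h | h
    · exact ⟨1 / 2, 1 / 2, by norm_num, by norm_num, by simp [h]⟩
    · have hb := h2.isCompact.isBounded
      exact ⟨sInf (tsupport θ), sSup (tsupport θ), (h3 (h2.isCompact.sInf_mem h)).1,
        (h3 (h2.isCompact.sSup_mem h)).2, fun x hx =>
          ⟨csInf_le h2.isCompact.bddBelow hx, le_csSup h2.isCompact.bddAbove hx⟩⟩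
  have hz : ∀ x, x ∉ Icc a b → θ x = 0 := fun x hx =>
    image_eq_zero_of_notMem_tsupport fun h => hx (hab h)
  have hsupp : Function.support (fun x => ∫ t in (0 : ℝ)..x, θ t) ⊆ Icc a b := by
    intro x hx
    by_contra hcon
    refine hx ?_
    rw [mem_Icc, not_and_or, not_le, not_le] at hcon
    rcases hcon with h | h
    · refine intervalIntegral.integral_zero_ae (ae_of_all _ fun t ht => hz t fun ht' => ?_)
      have := ht.2
      have h5 := ht'.1
      rcases le_max_iff.1 this with h | h <;> linarith
    · change ∫ t in (0 : ℝ)..x, θ t = 0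
      rw [← intervalIntegral.integral_add_adjacent_intervals (hc.intervalIntegrable 0 1)
        (hc.intervalIntegrable 1 x), h4, zero_add]
      refine intervalIntegral.integral_zero_ae (ae_of_all _ fun t ht => hz t fun ht' => ?_)
      have := ht.1
      have h5 := ht'.2
      rcases min_lt_iff.1 this with h | h <;> linarith
  have hts : tsupport (fun x => ∫ t in (0 : ℝ)..x, θ t) ⊆ Icc a b :=
    closure_minimal hsupp isClosed_Icc
  refine ⟨_, ?_, ?_, ?_, hderiv⟩
  · rw [contDiff_infty_iff_deriv]
    exact ⟨fun x => (hd x).differentiableAt, by rwa [hderiv]⟩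
  · exact isCompact_Icc.of_isClosed_subset (isClosed_tsupport _) hts
  · exact hts.trans fun x hx => ⟨ha.trans_le hx.1, hx.2.trans_lt hb⟩

/-- Du Bois-Reymond's argument: subtracting from a test function its integral times a fixed bump `χ`
of mass one leaves the derivative of a test function, to which `f` is orthogonal. Hence `f - ∫ f χ`
is orthogonal to all test functions. -/
theorem const_of_hasWeakDeriv_zero {f : ℝ → ℝ} (hf : Continuous f) (h : HasWeakDeriv f 0) :
    ∃ c, ∀ x ∈ Icc (0 : ℝ) 1, f x = c := by
  let B : ContDiffBump (1 / 2 : ℝ) := ⟨1 / 8, 1 / 4, by norm_num, by norm_num⟩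
  set χ : ℝ → ℝ := B.normed volume with hχ
  have χ1 : ContDiff ℝ ∞ χ := B.contDiff_normed
  have χ2 : HasCompactSupport χ := B.hasCompactSupport_normed
  have χ3 : tsupport χ ⊆ Ioo 0 1 := by
    rw [hχ, B.tsupport_normed_eq, Real.closedBall_eq_Icc]
    intro x hx
    constructor <;> norm_num [B] at hx ⊢ <;> linarith [hx.1, hx.2]
  have hIoo : ∀ ψ : ℝ → ℝ, tsupport ψ ⊆ Ioo 0 1 → ∫ x in Ioo (0 : ℝ) 1, ψ x = ∫ x, ψ x :=
    fun ψ hψ => setIntegral_eq_integral_of_forall_compl_eq_zero fun x hx =>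
      image_eq_zero_of_notMem_tsupport fun h => hx (hψ h)
  have χ4 : ∫ x in Ioo (0 : ℝ) 1, χ x = 1 := by
    rw [hIoo χ χ3]; exact B.integral_normed
  refine ⟨∫ x in Ioo (0 : ℝ) 1, f x * χ x, ?_⟩
  set c := ∫ x in Ioo (0 : ℝ) 1, f x * χ x with hcdef
  have key := ae_eq_zero_of_forall_integral_mul (g := fun x => f x - c)
    (continuous_integrableOn_Ioo (by fun_prop)) ?_
  · have hae : f =ᵐ[volume.restrict (Icc (0 : ℝ) 1)] fun _ => c := by
      rw [← Measure.restrict_congr_set Ioo_ae_eq_Icc]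
      filter_upwards [key] with x hx
      simpa [sub_eq_zero] using hx
    exact Measure.eqOn_Icc_of_ae_eq _ (by norm_num) hae hf.continuousOn continuousOn_const
  · intro ψ h1 h2 h3
    set d := ∫ x in Ioo (0 : ℝ) 1, ψ x with hd
    have hψI := continuous_integrableOn_Ioo h1.continuous
    have hχI := continuous_integrableOn_Ioo χ1.continuous
    have hts : tsupport (fun x => ψ x - d * χ x) ⊆ tsupport ψ ∪ tsupport χ := by
      refine closure_minimal ?_ ((isClosed_tsupport _).union (isClosed_tsupport _))
      intro x hx
      by_contra hcon
      rw [mem_union, not_or] at hcon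
      refine hx ?_
      simp [image_eq_zero_of_notMem_tsupport hcon.1, image_eq_zero_of_notMem_tsupport hcon.2]
    obtain ⟨φ, p1, p2, p3, p4⟩ := exists_antideriv_test (θ := fun x => ψ x - d * χ x)
      (h1.sub (contDiff_const.mul χ1))
      ((h2.isCompact.union χ2.isCompact).of_isClosed_subset (isClosed_tsupport _) hts)
      (hts.trans (union_subset h3 χ3)) (by
        rw [← integral_Ioo_eq, integral_sub hψI (hχI.const_mul d), integral_const_mul, χ4]
        simp [hd])
    have h5 := h φ p1 p2 p3
    rw [p4] at h5
    have i1 : IntegrableOn (fun x => f x * ψ x) (Ioo 0 1) :=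
      continuous_integrableOn_Ioo (hf.mul h1.continuous)
    have i2 : IntegrableOn (fun x => f x * χ x) (Ioo 0 1) :=
      continuous_integrableOn_Ioo (hf.mul χ1.continuous)
    have e1 : ∫ x in Ioo (0 : ℝ) 1, f x * (ψ x - d * χ x) =
        (∫ x in Ioo (0 : ℝ) 1, f x * ψ x) - d * c := by
      rw [hcdef, ← integral_const_mul, ← integral_sub i1 (i2.const_mul d)]
      congr 1; ext x; ring
    have e2 : ∫ x in Ioo (0 : ℝ) 1, (f x - c) * ψ x =
        (∫ x in Ioo (0 : ℝ) 1, f x * ψ x) - c * d := by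
      rw [hd, ← integral_const_mul, ← integral_sub i1 (hψI.const_mul c)]
      congr 1; ext x; ring
    simp only [Pi.zero_apply, zero_mul, integral_zero, neg_zero] at h5
    rw [e2, mul_comm c d, ← e1, h5]

theorem hasWeakDeriv_primitive {g : ℝ → ℝ} (hg : IntegrableOn g (Ioo 0 1)) :
    HasWeakDeriv (fun x => ∫ t in (0 : ℝ)..x, g t) g := by
  have hI := (integrableOn_Ioo_iff g).1 hg
  refine (hasWeakDeriv_deriv
    (hI.absolutelyContinuousOnInterval_intervalIntegral (c := 0) (by simp))).congr_ae ?_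
  rw [EventuallyEq, ae_restrict_iff' measurableSet_Ioo]
  filter_upwards [hI.ae_hasDerivAt_integral] with x hx hx'
  exact (hx (by rw [uIcc_of_le zero_le_one]; exact Ioo_subset_Icc_self hx') 0 (by simp)).deriv

/-- The fundamental theorem of calculus for weak derivatives. -/
theorem HasWeakDeriv.eq_primitive {f g : ℝ → ℝ} (hf : Continuous f)
    (hg : IntegrableOn g (Ioo 0 1)) (h : HasWeakDeriv f g) {x : ℝ} (hx : x ∈ Icc (0 : ℝ) 1) :
    f x = f 0 + ∫ t in (0 : ℝ)..x, g t := by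
  -- Outside `(0, 1)` nothing is known about `g`; the cut-off has a primitive that is continuous on
  -- the whole line, as `HasWeakDeriv.sub` demands.
  set g0 := (Ioo (0 : ℝ) 1).indicator g with hg0
  have hg0i : Integrable g0 := (integrable_indicator_iff measurableSet_Ioo).2 hg
  have hae : g0 =ᵐ[volume.restrict (Ioo 0 1)] g := by
    rw [EventuallyEq, ae_restrict_iff' measurableSet_Ioo]
    exact ae_of_all _ fun x hx => indicator_of_mem hx _
  have hP : Continuous fun x => ∫ t in (0 : ℝ)..x, g0 t :=
    intervalIntegral.continuous_primitive (fun a b => hg0i.intervalIntegrable) 0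
  have hw := (h.sub (hasWeakDeriv_primitive hg0i.integrableOn) hf hP hg hg0i.integrableOn).congr_ae
    (g' := 0) (by filter_upwards [hae] with x hx; simp [hx])
  obtain ⟨c, hc⟩ := const_of_hasWeakDeriv_zero (hf.sub hP) hw
  have h0 := hc 0 (left_mem_Icc.2 zero_le_one)
  have h1 := hc x hx
  have e : ∫ t in (0 : ℝ)..x, g0 t = ∫ t in (0 : ℝ)..x, g t := by
    rw [intervalIntegral.integral_of_le hx.1, intervalIntegral.integral_of_le hx.1,
      integral_Ioc_eq_integral_Ioo, integral_Ioc_eq_integral_Ioo]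
    refine setIntegral_congr_fun measurableSet_Ioo fun t ht => ?_
    have ht' : t ∈ Ioo (0 : ℝ) 1 := ⟨ht.1, ht.2.trans_le hx.2⟩
    rw [hg0, indicator_of_mem ht']
  change f 0 - ∫ t in (0 : ℝ)..0, g0 t = c at h0
  change f x - ∫ t in (0 : ℝ)..x, g0 t = c at h1
  rw [intervalIntegral.integral_same] at h0
  rw [← e]; linarith

theorem absolutelyContinuous_primitive {f g : ℝ → ℝ} (hg : IntegrableOn g (Ioo 0 1))
    (h : ∀ x ∈ Icc (0 : ℝ) 1, f x = f 0 + ∫ t in (0 : ℝ)..x, g t) :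
    AbsolutelyContinuousOnInterval f 0 1 := by
  have h1 := ((integrableOn_Ioo_iff g).1 hg).absolutelyContinuousOnInterval_intervalIntegral
    (c := 0) (by simp)
  have h2 : AbsolutelyContinuousOnInterval (fun _ : ℝ => f 0) 0 1 :=
    (contDiff_const (n := 1)).contDiffOn.absolutelyContinuousOnInterval
  refine (h2.add h1).congr_uIcc fun x hx => ?_
  rw [uIcc_of_le zero_le_one] at hx
  exact (h x hx).symm

/-! ### Functions on `[0, 1]` as primitives of square integrable functions -/

/-- The extension of a function on `[0, 1]` to the line by its boundary values. -/
abbrev extend (f : I → ℝ) : ℝ → ℝ := IccExtend zero_le_one f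

theorem extend_coe (f : I → ℝ) (t : I) : extend f t = f t := IccExtend_val _ _ _

theorem extend_of_mem (f : I → ℝ) {x : ℝ} (hx : x ∈ Icc (0 : ℝ) 1) : extend f x = f ⟨x, hx⟩ :=
  IccExtend_of_mem _ _ hx

theorem continuous_extend {f : I → ℝ} (hf : Continuous f) : Continuous (extend f) :=
  hf.Icc_extend'

/-- The measure space in which derivatives are square integrable. -/
abbrev lebI : Measure ℝ := volume.restrict (Ioo (0 : ℝ) 1)

theorem IsL2Deriv.eq_primitive {f : I → ℝ} {g : ℝ → ℝ} (hf : Continuous f) (h : IsL2Deriv f g)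
    (t : I) : f t = f 0 + ∫ s in (0 : ℝ)..t, g s := by
  have := h.2.eq_primitive (continuous_extend hf) h.1.integrableOn_Ioo t.2
  rwa [extend_coe, show (0 : ℝ) = ((0 : I) : ℝ) from rfl, extend_coe] at this

/-- Lebesgue's differentiation theorem. Together with `IsL2Deriv.eq_primitive` it replaces
distributions by primitives: sums, multiples and reflections in `H¹` are handled by exhibiting the
derivative under the integral. -/
theorem isL2Deriv_of_primitive {f : I → ℝ} {g : ℝ → ℝ} (hg : MemLp g 2 lebI)
    (h : ∀ t : I, f t = f 0 + ∫ s in (0 : ℝ)..t, g s) : IsL2Deriv f g := by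
  have h' : ∀ x ∈ Icc (0 : ℝ) 1, extend f x = extend f 0 + ∫ t in (0 : ℝ)..x, g t := by
    intro x hx
    rw [extend_of_mem f hx, extend_of_mem f (by simp : (0 : ℝ) ∈ Icc (0 : ℝ) 1)]
    exact h ⟨x, hx⟩
  have hac := absolutelyContinuous_primitive hg.integrableOn_Ioo h'
  have hI := (integrableOn_Ioo_iff g).1 hg.integrableOn_Ioo
  refine ⟨hg, (hasWeakDeriv_deriv hac).congr_ae ?_⟩
  rw [EventuallyEq, ae_restrict_iff' measurableSet_Ioo]
  filter_upwards [hI.ae_hasDerivAt_integral] with x hx hx'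
  have h1 := hx (by rw [uIcc_of_le zero_le_one]; exact Ioo_subset_Icc_self hx') 0 (by simp)
  refine ((h1.const_add (extend f 0)).congr_of_eventuallyEq ?_).deriv
  filter_upwards [Ioo_mem_nhds hx'.1 hx'.2] with y hy
  exact h' y (Ioo_subset_Icc_self hy)

theorem continuous_of_primitive {f : I → ℝ} {g : ℝ → ℝ} (hg : MemLp g 2 lebI)
    (h : ∀ t : I, f t = f 0 + ∫ s in (0 : ℝ)..t, g s) : Continuous f := by
  have h' : ∀ x ∈ Icc (0 : ℝ) 1, extend f x = extend f 0 + ∫ t in (0 : ℝ)..x, g t := by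
    intro x hx
    rw [extend_of_mem f hx, extend_of_mem f (by simp : (0 : ℝ) ∈ Icc (0 : ℝ) 1)]
    exact h ⟨x, hx⟩
  have hac := (absolutelyContinuous_primitive hg.integrableOn_Ioo h').continuousOn
  rw [uIcc_of_le zero_le_one] at hac
  have := hac.domRestrict
  convert this using 1
  ext t
  exact (extend_coe f t).symm

theorem weakDeriv_spec {f : I → ℝ} (hf : MemH1 f) : IsL2Deriv f (weakDeriv f) := by
  have := hf.2
  rw [weakDeriv, dif_pos this]
  exact this.choose_spec

theorem IsL2Deriv.weakDeriv_ae {f : I → ℝ} {g : ℝ → ℝ} (h : IsL2Deriv f g) :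
    weakDeriv f =ᵐ[lebI] g := by
  have hex : ∃ g, IsL2Deriv f g := ⟨g, h⟩
  have h2 : IsL2Deriv f (weakDeriv f) := by
    rw [weakDeriv, dif_pos hex]
    exact hex.choose_spec
  exact h2.2.ae_unique h.2 h2.1.integrableOn_Ioo h.1.integrableOn_Ioo

theorem MemH1.memLp {f : I → ℝ} (hf : MemH1 f) : MemLp (weakDeriv f) 2 lebI := (weakDeriv_spec hf).1

theorem MemH1.eq_primitive {f : I → ℝ} (hf : MemH1 f) (t : I) :
    f t = f 0 + ∫ s in (0 : ℝ)..t, weakDeriv f s := (weakDeriv_spec hf).eq_primitive hf.1 t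

theorem MemH1.intervalIntegrable {f : I → ℝ} (hf : MemH1 f) (a b : I) :
    IntervalIntegrable (weakDeriv f) volume a b :=
  ((integrableOn_Ioo_iff _).1 hf.memLp.integrableOn_Ioo).mono_set (by
    rw [uIcc_of_le zero_le_one, ← uIcc_of_le (zero_le_one' ℝ)]
    exact uIcc_subset_uIcc (by rw [uIcc_of_le zero_le_one]; exact a.2)
      (by rw [uIcc_of_le zero_le_one]; exact b.2))

theorem MemH1.sub_eq_integral {f : I → ℝ} (hf : MemH1 f) (a b : I) :
    f b - f a = ∫ s in (a : ℝ)..b, weakDeriv f s := by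
  have h1 := hf.eq_primitive a
  have h2 := hf.eq_primitive b
  have h3 := intervalIntegral.integral_add_adjacent_intervals (hf.intervalIntegrable 0 a)
    (hf.intervalIntegrable a b)
  simp only [Icc.coe_zero] at h3
  linarith

/-- A primitive of a square integrable function is in `H¹`. -/
theorem memH1_of_primitive {f : I → ℝ} {g : ℝ → ℝ} (hg : MemLp g 2 lebI)
    (h : ∀ t : I, f t = f 0 + ∫ s in (0 : ℝ)..t, g s) : MemH1 f :=
  ⟨continuous_of_primitive hg h, g, isL2Deriv_of_primitive hg h⟩

theorem weakDeriv_of_primitive {f : I → ℝ} {g : ℝ → ℝ} (hg : MemLp g 2 lebI)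
    (h : ∀ t : I, f t = f 0 + ∫ s in (0 : ℝ)..t, g s) : weakDeriv f =ᵐ[lebI] g :=
  (isL2Deriv_of_primitive hg h).weakDeriv_ae

theorem MemH1.add_prim {f g : I → ℝ} (hf : MemH1 f) (hg : MemH1 g) (t : I) :
    (f + g) t = (f + g) 0 + ∫ s in (0 : ℝ)..t, (weakDeriv f + weakDeriv g) s := by
  have := intervalIntegral.integral_add (hf.intervalIntegrable 0 t) (hg.intervalIntegrable 0 t)
  simp only [Icc.coe_zero] at this
  simp only [Pi.add_apply]
  rw [this]
  linarith [hf.eq_primitive t, hg.eq_primitive t]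

theorem MemH1.add {f g : I → ℝ} (hf : MemH1 f) (hg : MemH1 g) : MemH1 (f + g) :=
  memH1_of_primitive (hf.memLp.add hg.memLp) (hf.add_prim hg)

theorem weakDeriv_add {f g : I → ℝ} (hf : MemH1 f) (hg : MemH1 g) :
    weakDeriv (f + g) =ᵐ[lebI] weakDeriv f + weakDeriv g :=
  weakDeriv_of_primitive (hf.memLp.add hg.memLp) (hf.add_prim hg)

theorem MemH1.smul_prim {f : I → ℝ} (hf : MemH1 f) (c : ℝ) (t : I) :
    (c • f) t = (c • f) 0 + ∫ s in (0 : ℝ)..t, (c • weakDeriv f) s := by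
  simp only [Pi.smul_apply, smul_eq_mul, intervalIntegral.integral_const_mul]
  linarith [congrArg (c * ·) (hf.eq_primitive t)]

theorem MemH1.smul {f : I → ℝ} (hf : MemH1 f) (c : ℝ) : MemH1 (c • f) :=
  memH1_of_primitive (hf.memLp.const_smul c) (hf.smul_prim c)

theorem weakDeriv_smul {f : I → ℝ} (hf : MemH1 f) (c : ℝ) :
    weakDeriv (c • f) =ᵐ[lebI] c • weakDeriv f :=
  weakDeriv_of_primitive (hf.memLp.const_smul c) (hf.smul_prim c)

theorem dirichlet_comm (f g : I → ℝ) : dirichlet f g = dirichlet g f := by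
  simp only [dirichlet, mul_comm]

theorem dirichlet_self_nonneg (f : I → ℝ) : 0 ≤ dirichlet f f :=
  integral_nonneg fun _ => mul_self_nonneg _

theorem integrable_weakDeriv_mul {f g : I → ℝ} (hf : MemH1 f) (hg : MemH1 g) :
    Integrable (fun x => weakDeriv f x * weakDeriv g x) lebI :=
  hf.memLp.integrable_mul hg.memLp

theorem dirichlet_add_left {f g h : I → ℝ} (hf : MemH1 f) (hg : MemH1 g) (hh : MemH1 h) :
    dirichlet (f + g) h = dirichlet f h + dirichlet g h := by
  rw [dirichlet, dirichlet, dirichlet,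
    ← integral_add (integrable_weakDeriv_mul hf hh) (integrable_weakDeriv_mul hg hh)]
  refine integral_congr_ae ?_
  filter_upwards [weakDeriv_add hf hg] with x hx
  rw [hx, Pi.add_apply, add_mul]

theorem dirichlet_smul_left {f h : I → ℝ} (hf : MemH1 f) (c : ℝ) :
    dirichlet (c • f) h = c * dirichlet f h := by
  rw [dirichlet, dirichlet, ← integral_const_mul]
  refine integral_congr_ae ?_
  filter_upwards [weakDeriv_smul hf c] with x hx
  rw [hx, Pi.smul_apply, smul_eq_mul, mul_assoc]

theorem affine_prim (a b : ℝ) (t : I) :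
    a + (b - a) * (t : ℝ) = (a + (b - a) * ((0 : I) : ℝ)) + ∫ _ in (0 : ℝ)..t, (b - a) := by
  simp; ring

theorem memH1_affine (a b : ℝ) : MemH1 fun t : I => a + (b - a) * (t : ℝ) :=
  memH1_of_primitive (memLp_const _) (affine_prim a b)

/-- The derivative of an affine function is constant, so the pairing sees only the end values of
`f`. This is why a bond carrying an affine function acts as a resistor. -/
theorem dirichlet_affine_left (a b : ℝ) {f : I → ℝ} (hf : MemH1 f) :
    dirichlet (fun t : I => a + (b - a) * (t : ℝ)) f = (b - a) * (f 1 - f 0) := by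
  rw [hf.sub_eq_integral 0 1, dirichlet, ← intervalIntegral.integral_const_mul, Icc.coe_zero,
    Icc.coe_one, ← integral_Ioo_eq]
  refine integral_congr_ae ?_
  filter_upwards [weakDeriv_of_primitive (memLp_const _) (affine_prim a b)] with x hx
  rw [hx]

theorem memH1_const (c : ℝ) : MemH1 fun _ : I => c := by
  have := memH1_affine c c
  simpa using this

theorem dirichlet_const_left (c : ℝ) {f : I → ℝ} (hf : MemH1 f) :
    dirichlet (fun _ : I => c) f = 0 := by
  have := dirichlet_affine_left c c hf
  simpa using this

/-- Hölder continuity of functions in `H¹`. -/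
theorem MemH1.sq_sub_le {f : I → ℝ} (hf : MemH1 f) (a b : I) :
    (f b - f a) ^ 2 ≤ |(b : ℝ) - a| * dirichlet f f := by
  wlog hab : a ≤ b generalizing a b
  · have := this b a (le_of_not_ge hab)
    rw [abs_sub_comm]
    linarith [sq_nonneg (f b - f a), (by ring : (f b - f a) ^ 2 = (f a - f b) ^ 2)]
  have hab' : (a : ℝ) ≤ b := hab
  rw [hf.sub_eq_integral a b, abs_of_nonneg (by linarith)]
  set g := weakDeriv f with hg
  have hsub : Ioo (a : ℝ) b ⊆ Ioo 0 1 := Ioo_subset_Ioo a.2.1 b.2.2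
  have hi2 : IntegrableOn (fun x => g x * g x) (Ioo (0 : ℝ) 1) := integrable_weakDeriv_mul hf hf
  have hi2' := hi2.mono_set hsub
  have hi1 : IntegrableOn g (Ioo (a : ℝ) b) := hf.memLp.integrableOn_Ioo.mono_set hsub
  have hD : ∫ x in Ioo (a : ℝ) b, g x * g x ≤ dirichlet f f :=
    setIntegral_mono_set hi2 (ae_of_all _ fun x => mul_self_nonneg _) (ae_of_all _ hsub)
  rw [intervalIntegral.integral_of_le hab', integral_Ioc_eq_integral_Ioo]
  set m := ∫ x in Ioo (a : ℝ) b, g x with hm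
  have hd0 := dirichlet_self_nonneg f
  rcases hab'.eq_or_lt with h | h
  · have : m = 0 := by rw [hm, h]; simp
    rw [this]; nlinarith
  -- The Cauchy–Schwarz inequality as nonnegativity of a variance: `m / (b - a)` is the mean of `g`
  -- over `(a, b)`.
  · have hquad : 0 ≤ ∫ x in Ioo (a : ℝ) b, (((b : ℝ) - a) * g x - m) ^ 2 :=
      integral_nonneg fun _ => sq_nonneg _
    have hc : IntegrableOn (fun _ : ℝ => m ^ 2) (Ioo (a : ℝ) b) := by simp
    have e : ∫ x in Ioo (a : ℝ) b, (((b : ℝ) - a) * g x - m) ^ 2 =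
        ((b : ℝ) - a) ^ 2 * (∫ x in Ioo (a : ℝ) b, g x * g x) - 2 * ((b : ℝ) - a) * m * m
          + m ^ 2 * ((b : ℝ) - a) := by
      have : ∀ x, (((b : ℝ) - a) * g x - m) ^ 2 =
        ((b : ℝ) - a) ^ 2 * (g x * g x) - 2 * ((b : ℝ) - a) * m * g x + m ^ 2 := fun x => by ring
      simp only [this]
      have i1 : IntegrableOn (fun x => ((b : ℝ) - a) ^ 2 * (g x * g x) - 2 * ((b : ℝ) - a) * m * g x)
          (Ioo (a : ℝ) b) := (hi2'.const_mul _).sub (hi1.const_mul _)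
      rw [integral_add i1 hc,
        integral_sub (hi2'.const_mul _) (hi1.const_mul _), integral_const_mul, integral_const_mul,
        ← hm]
      simp [h.le, mul_comm]
    rw [e] at hquad
    have hba : 0 < (b : ℝ) - a := by linarith
    have : m ^ 2 * ((b : ℝ) - a) ≤ ((b : ℝ) - a) * (((b : ℝ) - a) * dirichlet f f) := by
      nlinarith [mul_le_mul_of_nonneg_left hD (sq_nonneg ((b : ℝ) - a))]
    nlinarith

theorem MemH1.sub {f g : I → ℝ} (hf : MemH1 f) (hg : MemH1 g) : MemH1 (f - g) := by
  have := hf.add (hg.smul (-1))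
  rwa [neg_one_smul, ← sub_eq_add_neg] at this

theorem measurePreserving_one_sub : MeasurePreserving (fun x : ℝ => 1 - x) lebI lebI := by
  have := (Measure.measurePreserving_sub_left volume (1 : ℝ)).restrict_preimage
    (s := Ioo (0 : ℝ) 1) measurableSet_Ioo
  simpa [lebI] using this

theorem MemH1.symm_prim {f : I → ℝ} (hf : MemH1 f) (t : I) :
    f (σ t) = f (σ 0) + ∫ s in (0 : ℝ)..t, -weakDeriv f (1 - s) := by
  have h := hf.sub_eq_integral (σ t) 1
  rw [intervalIntegral.integral_neg, intervalIntegral.integral_comp_sub_left (weakDeriv f),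
    sub_zero, unitInterval.symm_zero]
  simp only [unitInterval.coe_symm_eq, Icc.coe_one] at h
  linarith

theorem MemH1.memLp_symm {f : I → ℝ} (hf : MemH1 f) :
    MemLp (fun s => -weakDeriv f (1 - s)) 2 lebI :=
  (hf.memLp.comp_measurePreserving measurePreserving_one_sub).neg

theorem MemH1.symm {f : I → ℝ} (hf : MemH1 f) : MemH1 (f ∘ σ) :=
  memH1_of_primitive hf.memLp_symm hf.symm_prim

theorem dirichlet_symm {f g : I → ℝ} (hf : MemH1 f) (hg : MemH1 g) :
    dirichlet (f ∘ σ) (g ∘ σ) = dirichlet f g := by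
  have h : ∫ s in (0 : ℝ)..1, weakDeriv f (1 - s) * weakDeriv g (1 - s) =
      ∫ s in (0 : ℝ)..1, weakDeriv f s * weakDeriv g s := by
    rw [intervalIntegral.integral_comp_sub_left (fun s => weakDeriv f s * weakDeriv g s)]
    simp
  rw [dirichlet, dirichlet, integral_Ioo_eq (fun s => weakDeriv f s * weakDeriv g s), ← h,
    ← integral_Ioo_eq]
  refine integral_congr_ae ?_
  filter_upwards [weakDeriv_of_primitive hf.memLp_symm hf.symm_prim,
    weakDeriv_of_primitive hg.memLp_symm hg.symm_prim] with x hx hy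
  change weakDeriv (fun t => f (σ t)) x * weakDeriv (fun t => g (σ t)) x = _
  rw [hx, hy]; ring

theorem MemH1.absolutelyContinuous {f : I → ℝ} (hf : MemH1 f) :
    AbsolutelyContinuousOnInterval (extend f) 0 1 :=
  absolutelyContinuous_primitive hf.memLp.integrableOn_Ioo fun _ hx =>
    (weakDeriv_spec hf).2.eq_primitive (continuous_extend hf.1) hf.memLp.integrableOn_Ioo hx

theorem isL2Deriv_deriv {f : I → ℝ} (hf : AbsolutelyContinuousOnInterval (extend f) 0 1)
    (h : MemLp (deriv (extend f)) 2 lebI) : IsL2Deriv f (deriv (extend f)) :=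
  ⟨h, hasWeakDeriv_deriv hf⟩

theorem MemH1.weakDeriv_ae_deriv {f : I → ℝ} (hf : MemH1 f) :
    weakDeriv f =ᵐ[lebI] deriv (extend f) :=
  (weakDeriv_spec hf).2.ae_unique (hasWeakDeriv_deriv hf.absolutelyContinuous)
    hf.memLp.integrableOn_Ioo
    ((integrableOn_Ioo_iff _).2 hf.absolutelyContinuous.intervalIntegrable_deriv)

theorem abs_deriv_le_of_abs_sub_le {f g : ℝ → ℝ} {x : ℝ} (hf : DifferentiableAt ℝ f x)
    (hg : DifferentiableAt ℝ g x) (h : ∀ y, |f y - f x| ≤ |g y - g x|) :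
    |deriv f x| ≤ |deriv g x| := by
  have h1 := (hasDerivAt_iff_tendsto_slope.1 hf.hasDerivAt).abs
  have h2 := (hasDerivAt_iff_tendsto_slope.1 hg.hasDerivAt).abs
  refine le_of_tendsto_of_tendsto' h1 h2 fun y => ?_
  rw [slope_def_field, slope_def_field, abs_div, abs_div]
  exact div_le_div_of_nonneg_right (h y) (abs_nonneg _)

theorem abs_truncate_sub_le (a b : ℝ) : |max 0 (min a 1) - max 0 (min b 1)| ≤ |a - b| := by
  refine (abs_max_sub_max_le_max _ _ _ _).trans ?_
  rw [sub_self, abs_zero]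
  refine max_le (abs_nonneg _) ((abs_min_sub_min_le_max _ _ _ _).trans ?_)
  simp

/-- Compositions with contractions of the line operate on `H¹`. -/
theorem MemH1.comp_contraction {f h : I → ℝ} (hf : MemH1 f)
    (hh : ∀ s t, |h s - h t| ≤ |f s - f t|) : MemH1 h ∧ dirichlet h h ≤ dirichlet f f := by
  have hE : ∀ x y, |extend h x - extend h y| ≤ |extend f x - extend f y| := fun x y => hh _ _
  have hac : AbsolutelyContinuousOnInterval (extend h) 0 1 := by
    have := hf.absolutelyContinuous
    rw [absolutelyContinuousOnInterval_iff] at this ⊢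
    intro ε hε
    obtain ⟨δ, hδ, H⟩ := this ε hε
    refine ⟨δ, hδ, fun E hE' hlt => lt_of_le_of_lt (Finset.sum_le_sum fun i _ => ?_) (H E hE' hlt)⟩
    exact hE _ _
  have hc : Continuous h := by
    have := hac.continuousOn
    rw [uIcc_of_le zero_le_one] at this
    convert this.domRestrict using 1
    ext t
    exact (extend_coe h t).symm
  have hle : ∀ᵐ x ∂lebI, |deriv (extend h) x| ≤ |deriv (extend f) x| := by
    rw [ae_restrict_iff' measurableSet_Ioo]
    filter_upwards [hac.ae_differentiableAt, hf.absolutelyContinuous.ae_differentiableAt]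
      with x h1 h2 hx
    have hx' : x ∈ uIcc (0 : ℝ) 1 := by
      rw [uIcc_of_le zero_le_one]; exact Ioo_subset_Icc_self hx
    exact abs_deriv_le_of_abs_sub_le (h1 hx') (h2 hx') fun y => hE y x
  have hLf : MemLp (deriv (extend f)) 2 lebI := hf.memLp.ae_eq hf.weakDeriv_ae_deriv
  have hLh : MemLp (deriv (extend h)) 2 lebI :=
    hLf.mono (measurable_deriv _).aestronglyMeasurable hle
  have hmem : MemH1 h := ⟨hc, _, isL2Deriv_deriv hac hLh⟩
  refine ⟨hmem, integral_mono_ae (integrable_weakDeriv_mul hmem hmem)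
    (integrable_weakDeriv_mul hf hf) ?_⟩
  filter_upwards [hle, hf.weakDeriv_ae_deriv, hmem.weakDeriv_ae_deriv] with x h1 h2 h3
  rw [h2, h3, ← abs_mul_abs_self (deriv (extend h) x), ← abs_mul_abs_self (deriv (extend f) x)]
  exact mul_self_le_mul_self (abs_nonneg _) h1

theorem norm_toLp_sq {g : ℝ → ℝ} (hg : MemLp g 2 lebI) :
    ‖hg.toLp g‖ ^ 2 = ∫ x in Ioo (0 : ℝ) 1, g x * g x := by
  rw [← real_inner_self_eq_norm_sq, L2.inner_def]
  refine integral_congr_ae ?_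
  filter_upwards [hg.coeFn_toLp] with x hx
  rw [hx]; rfl

theorem weakDeriv_sub {f g : I → ℝ} (hf : MemH1 f) (hg : MemH1 g) :
    weakDeriv (f - g) =ᵐ[lebI] weakDeriv f - weakDeriv g := by
  have := weakDeriv_add hf (hg.smul (-1))
  rw [neg_one_smul, ← sub_eq_add_neg] at this
  filter_upwards [this, weakDeriv_smul hg (-1)] with x h1 h2
  rw [neg_one_smul] at h2
  rw [h1, Pi.add_apply, h2]
  simp [sub_eq_add_neg]

theorem dirichlet_sub_self {f g : I → ℝ} (hf : MemH1 f) (hg : MemH1 g) :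
    dirichlet (f - g) (f - g) =
      ∫ x in Ioo (0 : ℝ) 1, (weakDeriv f - weakDeriv g) x * (weakDeriv f - weakDeriv g) x := by
  refine integral_congr_ae ?_
  filter_upwards [weakDeriv_sub hf hg] with x h1
  rw [h1]

/-- Completeness of `H¹`. -/
theorem MemH1.of_cauchy {f : ℕ → I → ℝ} {f' : I → ℝ} (hf : ∀ n, MemH1 (f n))
    (hc : ∀ ε > 0, ∃ N, ∀ m ≥ N, ∀ n ≥ N, dirichlet (f m - f n) (f m - f n) < ε)
    (hl : ∀ t, Tendsto (fun n => f n t) atTop (𝓝 (f' t))) :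
    MemH1 f' ∧ Tendsto (fun n => dirichlet (f n - f') (f n - f')) atTop (𝓝 0) := by
  have hcs : CauchySeq fun n => (hf n).memLp.toLp := by
    rw [Metric.cauchySeq_iff]
    intro ε hε
    obtain ⟨N, hN⟩ := hc (ε ^ 2) (by positivity)
    refine ⟨N, fun m hm n hn => ?_⟩
    rw [dist_eq_norm, ← MemLp.toLp_sub]
    refine lt_of_pow_lt_pow_left₀ 2 hε.le ?_
    rw [norm_toLp_sq, ← dirichlet_sub_self (hf m) (hf n)]
    exact hN m hm n hn
  obtain ⟨G, hG⟩ := cauchySeq_tendsto_of_complete hcs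
  have hGm : MemLp G 2 lebI := Lp.memLp G
  -- The primitive of the `L²` limit of the derivatives. Its constant is fixed by the pointwise
  -- limit at `0`, and the Hölder estimate then identifies it with `f'` everywhere.
  set F : I → ℝ := fun t => f' 0 + ∫ s in (0 : ℝ)..t, G s with hF
  have hprim : ∀ t : I, F t = F 0 + ∫ s in (0 : ℝ)..t, G s := fun t => by simp [hF]
  have hFm := memH1_of_primitive hGm hprim
  have hlim : Tendsto (fun n => dirichlet (f n - F) (f n - F)) atTop (𝓝 0) := by
    have h2 : ∀ n, dirichlet (f n - F) (f n - F) = ‖(hf n).memLp.toLp - G‖ ^ 2 := by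
      intro n
      have : (hf n).memLp.toLp - G = ((hf n).memLp.sub hGm).toLp := by
        rw [MemLp.toLp_sub _ hGm, Lp.toLp_coeFn]
      rw [this, norm_toLp_sq, dirichlet_sub_self (hf n) hFm]
      refine integral_congr_ae ?_
      filter_upwards [weakDeriv_of_primitive hGm hprim] with x hx
      simp only [Pi.sub_apply, hx]
    simp only [h2]
    have := (tendsto_iff_norm_sub_tendsto_zero.1 hG).pow 2
    simpa using this
  have hfF : f' = F := by
    ext t
    have h3 : Tendsto (fun n => ((f n - F) t - (f n - F) 0) ^ 2) atTop
        (𝓝 ((f' t - F t - (f' 0 - F 0)) ^ 2)) :=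
      ((((hl t).sub_const _).sub ((hl 0).sub_const _)).pow 2)
    have h4 : (f' t - F t - (f' 0 - F 0)) ^ 2 ≤ |(t : ℝ) - (0 : I)| * 0 :=
      le_of_tendsto_of_tendsto' h3 (hlim.const_mul _) fun n => ((hf n).sub hFm).sq_sub_le 0 t
    have h5 : F 0 = f' 0 := by simp [hF]
    rw [mul_zero, h5] at h4
    have := pow_eq_zero_iff (two_ne_zero) |>.1 (le_antisymm h4 (sq_nonneg _))
    linarith
  rw [hfF]
  exact ⟨hFm, hlim⟩

/-! ## Geometry of the stretched gasket -/

/-- The standing assumptions on the vertices and on the stretching parameter. -/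
structure Standard (p : Fin 3 → Plane) (α : ℝ) : Prop where
  sum_eq : ∑ i, p i = 0
  dist_eq : ∀ i j, i ≠ j → dist (p i) (p j) = 1
  pos : 0 < α
  lt_one : α < 1

variable {p : Fin 3 → Plane} {α : ℝ}

/-- Barycentric coordinates with respect to the vertices. -/
def bary (p : Fin 3 → Plane) (i : Fin 3) (x : Plane) : ℝ := 1 / 3 + 2 * inner ℝ (p i) x

theorem fin3_cases (i j : Fin 3) : j = i ∨ j = i + 1 ∨ j = i + 2 := by
  revert i j; decide

theorem fin3_one_ne (i : Fin 3) : i + 1 ≠ i := by revert i; decide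

theorem fin3_two_ne (i : Fin 3) : i + 2 ≠ i := by revert i; decide

theorem fin3_two_ne_one (i : Fin 3) : i + 2 ≠ i + 1 := by revert i; decide

theorem fin3_one_one (i : Fin 3) : i + 1 + 1 = i + 2 := by revert i; decide

theorem fin3_two_one (i : Fin 3) : i + 2 + 1 = i := by revert i; decide

theorem fin3_sum (f : Fin 3 → ℝ) (i : Fin 3) : ∑ j, f j = f i + f (i + 1) + f (i + 2) := by
  fin_cases i <;> simp [Fin.sum_univ_three] <;> ring

namespace Standard

variable (H : Standard p α)
include H

/-- Unit side lengths and centroid `0` determine the Gram matrix. Its entries explain the constants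
in `bary`: `1/3 + 2/3 = 1` and `1/3 - 2/6 = 0`. -/
theorem inner_eq (i j : Fin 3) : inner ℝ (p i) (p j) = if i = j then (1 / 3 : ℝ) else -(1 / 6) := by
  have hd : ∀ i j, i ≠ j →
      inner ℝ (p i) (p i) + inner ℝ (p j) (p j) - 2 * inner ℝ (p i) (p j) = (1 : ℝ) := by
    intro i j hij
    have h := H.dist_eq i j hij
    rw [dist_eq_norm] at h
    have h2 := norm_sub_sq_real (p i) (p j)
    rw [h, ← real_inner_self_eq_norm_sq, ← real_inner_self_eq_norm_sq] at h2
    linarith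
  have hs : ∀ i, inner ℝ (p i) (p 0) + inner ℝ (p i) (p 1) + inner ℝ (p i) (p 2) = (0 : ℝ) := by
    intro i
    have := congrArg (fun x => inner ℝ (p i) x) H.sum_eq
    simpa [Fin.sum_univ_three, inner_add_right] using this
  have a := hd 0 1 (by decide)
  have b := hd 0 2 (by decide)
  have c := hd 1 2 (by decide)
  have s0 := hs 0
  have s1 := hs 1
  have s2 := hs 2
  rw [real_inner_comm (p 0) (p 1)] at s1
  rw [real_inner_comm (p 0) (p 2), real_inner_comm (p 1) (p 2)] at s2
  fin_cases i <;> fin_cases j <;>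
    simp <;> first
      | linarith
      | (rw [← real_inner_self_eq_norm_sq]; linarith)
      | (rw [real_inner_comm]; linarith)

theorem bary_vertex (i j : Fin 3) : bary p i (p j) = if i = j then 1 else 0 := by
  rw [bary, H.inner_eq]
  split_ifs <;> norm_num

theorem bary_sum (x : Plane) : ∑ i, bary p i x = 1 := by
  have := congrArg (fun y => inner ℝ y x) H.sum_eq
  simp only [Fin.sum_univ_three, inner_add_left, inner_zero_left] at this
  simp only [bary, Fin.sum_univ_three]
  linarith

theorem bary_G (i j : Fin 3) (x : Plane) :
    bary p j (G p α i x) = (1 - α) / 2 * bary p j x + if i = j then (1 + α) / 2 else 0 := by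
  simp only [bary, G, inner_add_right, inner_smul_right, inner_sub_right, H.inner_eq, eq_comm]
  split_ifs <;> ring

theorem eq_zero_of_inner (v : Plane) (h : ∀ i, inner ℝ (p i) v = 0) : v = 0 := by
  have e00 := (H.inner_eq 0 0).trans (if_pos rfl)
  have e01 := (H.inner_eq 0 1).trans (if_neg (by decide))
  have e11 := (H.inner_eq 1 1).trans (if_pos rfl)
  have h0 := h 0
  have h1 := h 1
  simp only [PiLp.inner_apply, Fin.sum_univ_two, RCLike.inner_apply, conj_trivial]
    at e00 e01 e11 h0 h1
  -- The squared determinant is the Gram determinant `1/9 - 1/36`, so `p 0` and `p 1` are a basis of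
  -- the plane.
  have hdet : (p 0 0 * p 1 1 - p 0 1 * p 1 0) ^ 2 = 1 / 12 := by
    have : (p 0 0 * p 1 1 - p 0 1 * p 1 0) ^ 2 =
      (p 0 0 * p 0 0 + p 0 1 * p 0 1) * (p 1 0 * p 1 0 + p 1 1 * p 1 1) -
      (p 1 0 * p 0 0 + p 1 1 * p 0 1) ^ 2 := by ring
    rw [this, e01]
    have f0 : p 0 0 * p 0 0 + p 0 1 * p 0 1 = 1 / 3 := by linarith
    have f1 : p 1 0 * p 1 0 + p 1 1 * p 1 1 = 1 / 3 := by linarith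
    rw [f0, f1]; norm_num
  have hne : p 0 0 * p 1 1 - p 0 1 * p 1 0 ≠ 0 := fun h => by rw [h] at hdet; norm_num at hdet
  ext k
  fin_cases k
  · have : (p 0 0 * p 1 1 - p 0 1 * p 1 0) * v 0 = 0 := by
      linear_combination p 1 1 * h0 - p 0 1 * h1
    simpa [hne] using this
  · have : (p 0 0 * p 1 1 - p 0 1 * p 1 0) * v 1 = 0 := by
      linear_combination p 0 0 * h1 - p 1 0 * h0
    simpa [hne] using this

theorem eq_sum_bary (x : Plane) : x = ∑ i, bary p i x • p i := by
  rw [← sub_eq_zero]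
  refine H.eq_zero_of_inner _ fun j => ?_
  have hs := congrArg (fun y => inner ℝ y x) H.sum_eq
  simp only [Fin.sum_univ_three, inner_add_left, inner_zero_left] at hs
  simp only [inner_sub_right, Fin.sum_univ_three, inner_add_right, inner_smul_right, H.inner_eq,
    bary]
  fin_cases j <;> simp <;> linarith

/-- The full triangle is closed, convex and mapped into itself by each `G_i`, hence contains `Σ` and
all bonds. -/
theorem bary_nonneg {x : Plane} (hx : x ∈ gasket p α) (i : Fin 3) : 0 ≤ bary p i x := by
  have hc : 0 ≤ (1 - α) / 2 := by linarith [H.lt_one]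
  have hd : 0 ≤ (1 + α) / 2 := by linarith [H.pos]
  set T : Set Plane := {x | ∀ i, 0 ≤ bary p i x} with hT
  have hTG : ∀ i, MapsTo (G p α i) T T := fun i x hx j => by
    rw [H.bary_G]
    have := mul_nonneg hc (hx j)
    split_ifs <;> linarith
  have hpT : ∀ i, p i ∈ T := fun i j => by
    rw [H.bary_vertex]; split_ifs <;> norm_num
  have hclosed : IsClosed T := by
    have : T = ⋂ i, {x | 0 ≤ bary p i x} := by ext; simp [hT]
    rw [this]
    refine isClosed_iInter fun i => isClosed_le continuous_const ?_
    unfold bary; fun_prop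
  have hconv : Convex ℝ T := by
    intro x hx y hy a b ha hb hab i
    have : bary p i (a • x + b • y) = a * bary p i x + b * bary p i y := by
      simp only [bary, inner_add_right, inner_smul_right]
      linear_combination (-1 / 3 : ℝ) * hab
    rw [this]
    exact add_nonneg (mul_nonneg ha (hx i)) (mul_nonneg hb (hy i))
  have hsub : gasket p α ⊆ T := by
    refine union_subset (cantorPart_subset p α H.pos H.lt_one hclosed ⟨p 0, hpT 0⟩ hTG)
      (iUnion_subset fun w => iUnion_subset fun i => ?_)
    rintro _ ⟨y, hy, rfl⟩
    induction w with
    | nil => exact hconv.segment_subset (hTG _ (hpT _)) (hTG _ (hpT _)) hy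
    | cons j w ih => exact hTG j ih
  exact hsub hx i

theorem bary_le_one {x : Plane} (hx : x ∈ gasket p α) (i : Fin 3) : bary p i x ≤ 1 := by
  have h := H.bary_sum x
  rw [fin3_sum _ i] at h
  linarith [H.bary_nonneg hx (i + 1), H.bary_nonneg hx (i + 2)]

theorem GK_injective (i : Fin 3) : Function.Injective (GK p α i) := by
  intro x y h
  have h' : G p α i x = G p α i y := congrArg Subtype.val h
  have := dist_G p α H.lt_one i x y
  rw [h', dist_self] at this
  have hc : (1 - α) / 2 ≠ 0 := by linarith [H.lt_one]
  exact Subtype.ext (dist_eq_zero.1 ((mul_eq_zero.1 this.symm).resolve_left hc))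

/-- With `bary_GK_ne` this separates the cells: the `i`-th coordinate is at least `(1 + α) / 2` on
cell `i` and at most `(1 - α) / 2` on the others, and `α > 0`. -/
theorem bary_GK_self (i : Fin 3) (x : K p α) : (1 + α) / 2 ≤ bary p i (GK p α i x) := by
  have : ((GK p α i x : K p α) : Plane) = G p α i x := rfl
  rw [this, H.bary_G, if_pos rfl]
  nlinarith [H.bary_nonneg x.2 i, H.lt_one]

theorem bary_GK_ne {i j : Fin 3} (hij : i ≠ j) (x : K p α) :
    bary p j (GK p α i x) ≤ (1 - α) / 2 := by
  have : ((GK p α i x : K p α) : Plane) = G p α i x := rfl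
  rw [this, H.bary_G, if_neg hij]
  nlinarith [H.bary_le_one x.2 j, H.lt_one]

theorem GK_ne {i j : Fin 3} (hij : i ≠ j) (x y : K p α) : GK p α i x ≠ GK p α j y := by
  intro h
  have h1 := H.bary_GK_ne hij x
  rw [h] at h1
  linarith [H.bary_GK_self j y, H.pos]

omit H in
theorem bary_lineMap (k : Fin 3) (x y : Plane) (t : ℝ) :
    bary p k (AffineMap.lineMap x y t) = (1 - t) * bary p k x + t * bary p k y := by
  simp only [bary, AffineMap.lineMap_apply_module, inner_add_right, inner_smul_right]
  ring

theorem bary_bondPath (i : Fin 3) (t : I) :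
    bary p i (bondPath p α i t) = (1 + α) / 2 - α * t ∧
    bary p (i + 1) (bondPath p α i t) = (1 - α) / 2 + α * t ∧
    bary p (i + 2) (bondPath p α i t) = 0 := by
  have h : ∀ k, bary p k (bondPath p α i t) =
      (1 - t) * ((1 - α) / 2 * (if k = i + 1 then 1 else 0) + if i = k then (1 + α) / 2 else 0)
      + t * ((1 - α) / 2 * (if k = i then 1 else 0) + if i + 1 = k then (1 + α) / 2 else 0) := by
    intro k
    rw [← H.bary_vertex, ← H.bary_vertex, ← H.bary_G, ← H.bary_G, ← bary_lineMap]
    rfl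
  have e1 := fin3_one_ne i
  have e2 := fin3_two_ne i
  have e3 := fin3_two_ne_one i
  refine ⟨?_, ?_, ?_⟩
  · rw [h]; simp [e1.symm, e1]; ring
  · rw [h]; simp [e1.symm, e1]; ring
  · rw [h]; simp [e2, e2.symm, e3, e3.symm]

omit H in
theorem bondPath_zero (i : Fin 3) : bondPath p α i 0 = GK p α i (vertex p α (i + 1)) :=
  Subtype.ext (by simp [bondPath, GK, vertex])

omit H in
theorem bondPath_one (i : Fin 3) : bondPath p α i 1 = GK p α (i + 1) (vertex p α i) :=
  Subtype.ext (by simp [bondPath, GK, vertex])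

/-- On cell `j` the `j`-th coordinate is at least `(1 + α) / 2`; bond `i` attains this value only at
its two ends, for `j = i` and `j = i + 1`. -/
theorem GK_eq_bondPath {i j : Fin 3} {x : K p α} {t : I} (h : GK p α j x = bondPath p α i t) :
    (j = i ∧ t = 0 ∧ x = vertex p α (i + 1)) ∨ (j = i + 1 ∧ t = 1 ∧ x = vertex p α i) := by
  obtain ⟨h1, h2, h3⟩ := H.bary_bondPath i t
  have hj := H.bary_GK_self j x
  rw [h] at hj
  have hα := H.pos
  rcases fin3_cases i j with rfl | rfl | rfl
  · left
    rw [h1] at hj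
    have ht : t = 0 := Subtype.ext (le_antisymm (by simp; nlinarith) t.2.1)
    subst ht
    rw [bondPath_zero] at h
    exact ⟨rfl, rfl, H.GK_injective _ h⟩
  · right
    rw [h2] at hj
    have ht : t = 1 := Subtype.ext (le_antisymm t.2.2 (by simp; nlinarith))
    subst ht
    rw [bondPath_one] at h
    exact ⟨rfl, rfl, H.GK_injective _ h⟩
  · rw [h3] at hj; linarith

/-- On each bond exactly one barycentric coordinate vanishes, which identifies the bond; a second
one is affine in the parameter with slope `α`, which identifies the point. -/
theorem bondPath_inj {i j : Fin 3} {s t : I} (h : bondPath p α i s = bondPath p α j t) :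
    i = j ∧ s = t := by
  obtain ⟨h1, h2, h3⟩ := H.bary_bondPath i s
  obtain ⟨k1, k2, k3⟩ := H.bary_bondPath j t
  have hα := H.pos
  have hα1 := H.lt_one
  have hs := s.2.1
  have ht := t.2.2
  have ht0 := t.2.1
  have hs1 := s.2.2
  rw [h] at h1 h2 h3
  rcases fin3_cases i j with rfl | rfl | rfl
  · refine ⟨rfl, Subtype.ext ?_⟩
    rw [h2] at k2
    exact mul_left_cancel₀ hα.ne' (by linarith)
  · exfalso
    rw [fin3_one_one, h3] at k2
    nlinarith
  · exfalso
    rw [h3] at k1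
    nlinarith

theorem cover (x : K p α) :
    (∃ i y, GK p α i y = x) ∨ ∃ i t, bondPath p α i t = x := by
  have h := ((gasket_eq_iff p α H.pos H.lt_one _).2 rfl).2
  rcases h.subset x.2 with hx | hx
  · obtain ⟨i, y, hy, hyx⟩ := mem_iUnion.1 hx
    exact Or.inl ⟨i, ⟨y, hy⟩, Subtype.ext hyx⟩
  · obtain ⟨i, hi⟩ := mem_iUnion.1 hx
    rw [bond, segment_eq_image_lineMap] at hi
    obtain ⟨t, ht, htx⟩ := hi
    exact Or.inr ⟨i, ⟨t, ht⟩, Subtype.ext htx⟩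

theorem compactSpace : CompactSpace (K p α) :=
  isCompact_iff_compactSpace.1 (isCompact_gasket p α H.pos H.lt_one)

end Standard

/-! ### Assembling the gasket from cells and bonds -/

theorem continuous_GK (i : Fin 3) : Continuous (GK p α i) :=
  (continuous_G p α i).restrict _

theorem continuous_bondPath (i : Fin 3) : Continuous (bondPath p α i) :=
  Continuous.subtype_mk (AffineMap.lineMap_continuous.comp continuous_subtype_val) _

/-- The map that assembles the gasket from three copies of itself and three intervals. -/
def assemble (p : Fin 3 → Plane) (α : ℝ) : (Σ _ : Fin 3, K p α) ⊕ (Σ _ : Fin 3, I) → K p α :=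
  Sum.elim (fun x => GK p α x.1 x.2) (fun x => bondPath p α x.1 x.2)

namespace Standard

variable (H : Standard p α)
include H

/-- A continuous surjection from a compact space onto a Hausdorff space is closed. It makes
continuity on `K` a condition on the pieces. -/
theorem isQuotientMap_assemble : IsQuotientMap (assemble p α) := by
  have := H.compactSpace
  have hc : Continuous (assemble p α) :=
    (continuous_sigma fun i => continuous_GK i).sumElim
      (continuous_sigma fun i => continuous_bondPath i)
  refine hc.isClosedMap.isQuotientMap hc fun x => ?_
  rcases H.cover x with ⟨i, y, h⟩ | ⟨i, t, h⟩
  · exact ⟨Sum.inl ⟨i, y⟩, h⟩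
  · exact ⟨Sum.inr ⟨i, t⟩, h⟩

theorem continuous_iff (u : K p α → ℝ) : Continuous u ↔
    (∀ i, Continuous (u ∘ GK p α i)) ∧ ∀ i, Continuous (onBond p α u [] i) := by
  constructor
  · intro h
    exact ⟨fun i => h.comp (continuous_GK i), fun i => h.comp (continuous_bondPath i)⟩
  · rintro ⟨h1, h2⟩
    rw [H.isQuotientMap_assemble.continuous_iff]
    exact continuous_sum_dom.2 ⟨continuous_sigma h1, continuous_sigma h2⟩

/-- Functions on the cells and on the bonds with matching values can be glued. -/
theorem exists_glue (f : Fin 3 → K p α → ℝ) (g : Fin 3 → I → ℝ)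
    (h0 : ∀ i, g i 0 = f i (vertex p α (i + 1))) (h1 : ∀ i, g i 1 = f (i + 1) (vertex p α i)) :
    ∃ u : K p α → ℝ, (∀ i, u ∘ GK p α i = f i) ∧ ∀ i, onBond p α u [] i = g i := by
  set F : (Σ _ : Fin 3, K p α) ⊕ (Σ _ : Fin 3, I) → ℝ :=
    Sum.elim (fun x => f x.1 x.2) (fun x => g x.1 x.2) with hF
  -- A cell and a bond meet only at an end of the bond, where `h0` or `h1` applies.
  have key : ∀ i j x t, GK p α j x = bondPath p α i t → f j x = g i t := by
    intro i j x t h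
    rcases H.GK_eq_bondPath h with ⟨rfl, rfl, rfl⟩ | ⟨rfl, rfl, rfl⟩
    · exact (h0 _).symm
    · exact (h1 _).symm
  have hfac : F.FactorsThrough (assemble p α) := by
    rintro (⟨i, x⟩ | ⟨i, s⟩) (⟨j, y⟩ | ⟨j, t⟩) h
    · by_cases hij : i = j
      · subst hij
        have hxy : x = y := H.GK_injective i h
        rw [hxy]
      · exact absurd h (H.GK_ne hij x y)
    · exact key j i x t h
    · exact (key i j y s h.symm).symm
    · obtain ⟨rfl, rfl⟩ := H.bondPath_inj h
      rfl
  refine ⟨Function.extend (assemble p α) F 0, fun i => ?_, fun i => ?_⟩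
  · ext x
    exact hfac.extend_apply 0 (Sum.inl ⟨i, x⟩)
  · ext t
    exact hfac.extend_apply 0 (Sum.inr ⟨i, t⟩)

end Standard

theorem coe_GwK (w : List (Fin 3)) (x : K p α) : (GwK p α w x : Plane) = Gw p α w x := by
  induction w with
  | nil => rfl
  | cons i w ih =>
    change G p α i (GwK p α w x) = G p α i (Gw p α w x)
    rw [ih]

/-- A closed set that contains the bonds and the images of the vertices is everything. -/
theorem forall_mem_of_isClosed {C : Set (K p α)} (hC : IsClosed C)
    (h1 : ∀ w i, GwK p α w (vertex p α i) ∈ C) (h2 : ∀ w i t, GwK p α w (bondPath p α i t) ∈ C)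
    (x : K p α) : x ∈ C := by
  obtain ⟨x, hx⟩ := x
  rcases hx with hx | hx
  · have hmem : (⟨x, Or.inl hx⟩ : K p α) ∈
        closure {y : K p α | ∃ w i, GwK p α w (vertex p α i) = y} := by
      rw [closure_subtype]
      refine closure_mono ?_ hx
      intro y hy
      rw [mem_iUnion_V] at hy
      obtain ⟨w, _, ⟨i, rfl⟩, rfl⟩ := hy
      exact ⟨GwK p α w (vertex p α i), ⟨w, i, rfl⟩, coe_GwK w _⟩
    refine closure_minimal ?_ hC hmem
    rintro _ ⟨w, i, rfl⟩
    exact h1 w i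
  · have hx0 := hx
    simp only [mem_iUnion] at hx
    obtain ⟨w, i, y, hy, rfl⟩ := hx
    rw [bond, segment_eq_image_lineMap] at hy
    obtain ⟨t, ht, rfl⟩ := hy
    have e : (⟨Gw p α w (AffineMap.lineMap (G p α i (p (i + 1))) (G p α (i + 1) (p i)) t),
        Or.inr hx0⟩ : K p α) = GwK p α w (bondPath p α i ⟨t, ht⟩) :=
      Subtype.ext (coe_GwK w (bondPath p α i ⟨t, ht⟩)).symm
    rw [e]
    exact h2 w i _

/-! ## Symmetries -/

/-- `Φ` permutes the cells, the vertices and the bonds as `s` does. -/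
structure IsSymmetry (p : Fin 3 → Plane) (α : ℝ) (s : Equiv.Perm (Fin 3)) (Φ : K p α → K p α) :
    Prop where
  continuous : Continuous Φ
  comp_GK : ∀ i, Φ ∘ GK p α i = GK p α (s i) ∘ Φ
  vertex : ∀ i, Φ (vertex p α i) = vertex p α (s i)
  bond_pos : ∀ i t, s (i + 1) = s i + 1 → Φ (bondPath p α i t) = bondPath p α (s i) t
  bond_neg : ∀ i t, s i = s (i + 1) + 1 → Φ (bondPath p α i t) = bondPath p α (s (i + 1)) (σ t)

theorem linear_comp_G (φ : Plane →ₗ[ℝ] Plane) (s : Equiv.Perm (Fin 3)) (h : ∀ i, φ (p i) = p (s i))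
    (i : Fin 3) (x : Plane) : φ (G p α i x) = G p α (s i) (φ x) := by
  simp [G, h]

theorem isSymmetry_of_linear (φ : Plane →ₗ[ℝ] Plane) (s : Equiv.Perm (Fin 3))
    (h : ∀ i, φ (p i) = p (s i)) (hm : MapsTo φ (gasket p α) (gasket p α)) :
    IsSymmetry p α s hm.restrict where
  continuous := (LinearMap.continuous_of_finiteDimensional φ).restrict _
  comp_GK i := by
    ext1 x
    exact Subtype.ext (linear_comp_G φ s h i x)
  vertex i := Subtype.ext (h i)
  bond_pos i t hi := by
    refine Subtype.ext ?_
    change φ (AffineMap.lineMap _ _ (t : ℝ)) = AffineMap.lineMap _ _ (t : ℝ)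
    rw [← hi, AffineMap.lineMap_apply_module, AffineMap.lineMap_apply_module, map_add, map_smul,
      map_smul, linear_comp_G φ s h, linear_comp_G φ s h, h, h]
  bond_neg i t hi := by
    refine Subtype.ext ?_
    change φ (AffineMap.lineMap _ _ (t : ℝ)) = AffineMap.lineMap _ _ ((σ t : I) : ℝ)
    rw [← hi, unitInterval.coe_symm_eq, AffineMap.lineMap_apply_one_sub,
      AffineMap.lineMap_apply_module, AffineMap.lineMap_apply_module, map_add, map_smul,
      map_smul, linear_comp_G φ s h, linear_comp_G φ s h, h, h]

namespace Standard

variable (H : Standard p α)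
include H

/-- The vertices are extreme points of the triangle. If `p i = φ x`, then `p i` is a convex
combination of the points `φ (p j)`, which lie in the triangle, so one of them is `p i`. -/
theorem exists_perm_of_image_eq (φ : Plane →ₗ[ℝ] Plane) (hφ : φ '' gasket p α = gasket p α) :
    ∃ s : Equiv.Perm (Fin 3), ∀ i, φ (p i) = p (s i) := by
  have hmem : ∀ j, φ (p j) ∈ gasket p α := fun j => by
    rw [← hφ]; exact ⟨_, vertex_mem p α j, rfl⟩
  have key : ∀ i, ∃ j, φ (p j) = p i := by
    intro i
    obtain ⟨x, hx, hxi⟩ : p i ∈ φ '' gasket p α := by rw [hφ]; exact vertex_mem p α i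
    have h1 : p i = ∑ j, bary p j x • φ (p j) := by
      conv_lhs => rw [← hxi, H.eq_sum_bary x]
      simp
    have hsum := H.bary_sum x
    have h2 : ∑ j, bary p j x * bary p i (φ (p j)) = 1 := by
      have h3 : bary p i (p i) = 1 := by simp [H.bary_vertex]
      have h4 : bary p i (p i) = 1 / 3 + 2 * ∑ j, bary p j x * inner ℝ (p i) (φ (p j)) := by
        have h5 := congrArg (fun y => inner ℝ (p i) y) h1
        simp only [inner_sum, inner_smul_right] at h5
        rw [bary, h5]
      rw [h3] at h4
      simp only [bary, Fin.sum_univ_three] at h4 hsum ⊢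
      linear_combination (1 / 3 : ℝ) * hsum - h4
    -- Otherwise every `φ (p j)` has `i`-th coordinate below one, and so has every convex
    -- combination of them.
    by_contra hcon
    push Not at hcon
    have hlt : ∀ j, bary p i (φ (p j)) < 1 := by
      intro j
      refine lt_of_le_of_ne (H.bary_le_one (hmem j) i) fun he => hcon j ?_
      have hs := H.bary_sum (φ (p j))
      rw [fin3_sum _ i, he] at hs
      have a1 := H.bary_nonneg (hmem j) (i + 1)
      have a2 := H.bary_nonneg (hmem j) (i + 2)
      have b1 : bary p (i + 1) (φ (p j)) = 0 := by linarith
      have b2 : bary p (i + 2) (φ (p j)) = 0 := by linarith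
      rw [H.eq_sum_bary (φ (p j)), H.eq_sum_bary (p i)]
      refine Finset.sum_congr rfl fun k _ => ?_
      congr 1
      rw [H.bary_vertex]
      rcases fin3_cases i k with rfl | rfl | rfl
      · simpa using he
      · rw [b1, if_neg (fin3_one_ne i)]
      · rw [b2, if_neg (fin3_two_ne i)]
    have h5 : ∑ j, bary p j x * (1 - bary p i (φ (p j))) = 0 := by
      simp only [mul_sub, mul_one, Finset.sum_sub_distrib, h2, hsum, sub_self]
    rw [Finset.sum_eq_zero_iff_of_nonneg fun j _ =>
      mul_nonneg (H.bary_nonneg hx j) (by linarith [hlt j])] at h5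
    have h6 : ∀ j, bary p j x = 0 := fun j =>
      (mul_eq_zero.1 (h5 j (Finset.mem_univ j))).resolve_right (by linarith [hlt j])
    simp [h6] at hsum
  have hpinj : Function.Injective p := by
    intro i j hij
    by_contra hne
    have := H.dist_eq i j hne
    rw [hij, dist_self] at this
    norm_num at this
  choose τ hτ using key
  have hτi : Function.Injective τ := fun i j hij => hpinj (by rw [← hτ i, ← hτ j, hij])
  refine ⟨(Equiv.ofBijective τ (Finite.injective_iff_bijective.1 hτi)).symm, fun i => ?_⟩
  obtain ⟨j, rfl⟩ := (Finite.injective_iff_surjective.1 hτi) i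
  rw [hτ j]
  congr 1
  exact ((Equiv.ofBijective τ _).symm_apply_apply j).symm

/-- The gasket has a rotational symmetry. -/
theorem exists_rotation : ∃ (φ : Plane →ₗ[ℝ] Plane), φ '' gasket p α = gasket p α ∧
    ∀ i, φ (p i) = p (i + 1) := by
  -- As the vertices sum to zero, `x = ∑ 2 ⟨p i, x⟩ p i`; the rotation moves each `p i` in this
  -- expansion to `p (i + 1)`.
  let φ : Plane →ₗ[ℝ] Plane :=
    ∑ i, ((2 : ℝ) • (innerₛₗ ℝ (p i))).smulRight (p (i + 1))
  have hφ : ∀ x, φ x = ∑ i, (2 * inner ℝ (p i) x) • p (i + 1) := fun x => by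
    simp [φ, LinearMap.sum_apply]
  have hv : ∀ i, φ (p i) = p (i + 1) := by
    intro i
    have hs := H.sum_eq
    rw [hφ]
    simp only [H.inner_eq, Fin.sum_univ_three] at hs ⊢
    have h2 : p 2 = -(p 0 + p 1) := by rw [← sub_eq_zero, ← hs]; abel
    fin_cases i <;> simp [h2] <;> module
  have hmaps : MapsTo φ (gasket p α) (gasket p α) := by
    have hG := linear_comp_G (α := α) φ (Equiv.addRight 1) hv
    have hGw : ∀ w : List (Fin 3), ∀ x, φ (Gw p α w x) = Gw p α (w.map (· + 1)) (φ x) := by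
      intro w x
      induction w with
      | nil => rfl
      | cons i w ih =>
        change φ (G p α i (Gw p α w x)) = G p α (i + 1) (Gw p α (w.map (· + 1)) (φ x))
        rw [hG, ih]; rfl
    have hcont : Continuous φ := LinearMap.continuous_of_finiteDimensional φ
    rintro x (hx | hx)
    · refine Or.inl ((MapsTo.closure ?_ hcont) hx)
      intro y hy
      rw [mem_iUnion_V] at hy ⊢
      obtain ⟨w, _, ⟨i, rfl⟩, rfl⟩ := hy
      exact ⟨w.map (· + 1), p (i + 1), mem_range_self _, by rw [hGw, hv]⟩
    · simp only [mem_iUnion] at hx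
      obtain ⟨w, i, y, hy, rfl⟩ := hx
      refine Or.inr (mem_iUnion.2 ⟨w.map (· + 1), mem_iUnion.2 ⟨i + 1, φ y, ?_, (hGw w y).symm⟩⟩)
      rw [bond] at hy ⊢
      have : φ y ∈ φ '' segment ℝ (G p α i (p (i + 1))) (G p α (i + 1) (p i)) := ⟨y, hy, rfl⟩
      rw [show (φ : Plane → Plane) = φ.toAffineMap from rfl, image_segment] at this
      change φ y ∈ segment ℝ (φ (G p α i (p (i + 1)))) (φ (G p α (i + 1) (p i))) at this
      rw [hG, hG, hv, hv] at this
      exact this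
  -- The rotation has order three, so its square provides preimages.
  refine ⟨φ, Subset.antisymm hmaps.image_subset fun x hx => ⟨φ (φ x), hmaps (hmaps hx), ?_⟩, hv⟩
  conv_rhs => rw [H.eq_sum_bary x]
  conv_lhs => rw [H.eq_sum_bary x]
  simp only [map_sum, map_smul, hv]
  refine Finset.sum_congr rfl fun i _ => ?_
  congr 2
  revert i; decide

end Standard

/-! ## Self-similarity of the energies -/

theorem sum_words_zero (F : List (Fin 3) → ℝ) : ∑ w : Fin 0 → Fin 3, F (List.ofFn w) = F [] := by
  simp

theorem sum_words_succ (F : List (Fin 3) → ℝ) (k : ℕ) :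
    ∑ w : Fin (k + 1) → Fin 3, F (List.ofFn w) =
      ∑ i, ∑ w : Fin k → Fin 3, F (i :: List.ofFn w) := by
  rw [← Fintype.sum_prod_type']
  refine (Fintype.sum_equiv (Fin.consEquiv fun _ => Fin 3) _ _ fun x => ?_).symm
  simp [Fin.consEquiv]

theorem Standard.mem_FTilde_iff (H : Standard p α) (u : K p α → ℝ) : u ∈ FTilde p α ↔
    (∀ i, u ∘ GK p α i ∈ FTilde p α) ∧ ∀ i, MemH1 (onBond p α u [] i) := by
  constructor
  · rintro ⟨h1, h2⟩
    exact ⟨fun i => ⟨h1.comp (continuous_GK i), fun w j => h2 (i :: w) j⟩, fun i => h2 [] i⟩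
  · rintro ⟨h1, h2⟩
    refine ⟨(H.continuous_iff u).2 ⟨fun i => (h1 i).1, fun i => (h2 i).1⟩, fun w j => ?_⟩
    cases w with
    | nil => exact h2 j
    | cons i w => exact (h1 i).2 w j

theorem DI_zero (u v : K p α → ℝ) :
    DI p α 0 u v = ∑ i, dirichlet (onBond p α u [] i) (onBond p α v [] i) :=
  sum_words_zero fun w => ∑ i, dirichlet (onBond p α u w i) (onBond p α v w i)

theorem DI_succ (k : ℕ) (u v : K p α → ℝ) :
    DI p α (k + 1) u v = ∑ i, DI p α k (u ∘ GK p α i) (v ∘ GK p α i) :=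
  sum_words_succ (fun w => ∑ i, dirichlet (onBond p α u w i) (onBond p α v w i)) k

theorem QSigma_zero (u v : K p α → ℝ) : QSigma p α 0 u v =
    Q0 (fun i => u (vertex p α i)) (fun i => v (vertex p α i)) :=
  sum_words_zero fun w => Q0 (fun i => u (GwK p α w (vertex p α i)))
    (fun i => v (GwK p α w (vertex p α i)))

theorem QSigma_succ (k : ℕ) (u v : K p α → ℝ) :
    QSigma p α (k + 1) u v = ∑ i, QSigma p α k (u ∘ GK p α i) (v ∘ GK p α i) :=
  sum_words_succ (fun w => Q0 (fun i => u (GwK p α w (vertex p α i)))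
    (fun i => v (GwK p α w (vertex p α i)))) k

/-! ### Nonnegative bilinear functionals on spaces of functions -/

theorem FTilde_add {u v : K p α → ℝ} (hu : u ∈ FTilde p α) (hv : v ∈ FTilde p α) :
    u + v ∈ FTilde p α := ⟨hu.1.add hv.1, fun w i => (hu.2 w i).add (hv.2 w i)⟩

theorem FTilde_smul {u : K p α → ℝ} (hu : u ∈ FTilde p α) (c : ℝ) : c • u ∈ FTilde p α :=
  ⟨hu.1.const_smul c, fun w i => (hu.2 w i).smul c⟩

theorem FTilde_sub {u v : K p α → ℝ} (hu : u ∈ FTilde p α) (hv : v ∈ FTilde p α) :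
    u - v ∈ FTilde p α := ⟨hu.1.sub hv.1, fun w i => (hu.2 w i).sub (hv.2 w i)⟩

theorem FTilde_const (c : ℝ) : (fun _ => c) ∈ FTilde p α :=
  ⟨continuous_const, fun _ _ => memH1_const c⟩

/-- A functional that is a nonnegative symmetric bilinear form on a set of functions closed under
linear combinations. -/
structure IsBilin {X : Type*} (S : Set (X → ℝ)) (B : (X → ℝ) → (X → ℝ) → ℝ) : Prop where
  add_mem : ∀ u ∈ S, ∀ v ∈ S, u + v ∈ S
  smul_mem : ∀ c : ℝ, ∀ u ∈ S, c • u ∈ S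
  add_left : ∀ u ∈ S, ∀ v ∈ S, ∀ w ∈ S, B (u + v) w = B u w + B v w
  smul_left : ∀ c : ℝ, ∀ u ∈ S, ∀ v ∈ S, B (c • u) v = c * B u v
  symm : ∀ u ∈ S, ∀ v ∈ S, B u v = B v u
  nonneg : ∀ u ∈ S, 0 ≤ B u u

namespace IsBilin

variable {X : Type*} {S : Set (X → ℝ)} {B B' : (X → ℝ) → (X → ℝ) → ℝ} (h : IsBilin S B)
include h

theorem sub_mem {u v : X → ℝ} (hu : u ∈ S) (hv : v ∈ S) : u - v ∈ S := by
  have := h.add_mem u hu _ (h.smul_mem (-1) v hv)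
  rwa [neg_one_smul, ← sub_eq_add_neg] at this

theorem sub_left {u v w : X → ℝ} (hu : u ∈ S) (hv : v ∈ S) (hw : w ∈ S) :
    B (u - v) w = B u w - B v w := by
  have := h.add_left u hu _ (h.smul_mem (-1) v hv) w hw
  rw [neg_one_smul, ← sub_eq_add_neg] at this
  rw [this, ← neg_one_smul ℝ v, h.smul_left _ v hv w hw]
  ring

theorem add_right {u v w : X → ℝ} (hu : u ∈ S) (hv : v ∈ S) (hw : w ∈ S) :
    B u (v + w) = B u v + B u w := by
  rw [h.symm u hu _ (h.add_mem v hv w hw), h.add_left v hv w hw u hu, h.symm v hv u hu,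
    h.symm w hw u hu]

theorem smul_right {u v : X → ℝ} (c : ℝ) (hu : u ∈ S) (hv : v ∈ S) :
    B u (c • v) = c * B u v := by
  rw [h.symm u hu _ (h.smul_mem c v hv), h.smul_left c v hv u hu, h.symm v hv u hu]

theorem sub_right {u v w : X → ℝ} (hu : u ∈ S) (hv : v ∈ S) (hw : w ∈ S) :
    B u (v - w) = B u v - B u w := by
  rw [h.symm u hu _ (h.sub_mem hv hw), h.sub_left hv hw hu, h.symm v hv u hu,
    h.symm w hw u hu]

theorem sub_self {u v : X → ℝ} (hu : u ∈ S) (hv : v ∈ S) :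
    B (u - v) (u - v) = B u u - 2 * B u v + B v v := by
  rw [h.sub_left hu hv (h.sub_mem hu hv), h.sub_right hu hu hv, h.sub_right hv hu hv,
    h.symm v hv u hu]
  ring

theorem add_self {u v : X → ℝ} (hu : u ∈ S) (hv : v ∈ S) :
    B (u + v) (u + v) = B u u + 2 * B u v + B v v := by
  rw [h.add_left u hu v hv _ (h.add_mem u hu v hv), h.add_right hu hu hv, h.add_right hv hu hv,
    h.symm v hv u hu]
  ring

theorem polar {u v : X → ℝ} (hu : u ∈ S) (hv : v ∈ S) :
    B u v = (B (u + v) (u + v) - B u u - B v v) / 2 := by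
  rw [h.add_self hu hv]; ring

theorem add_self_le {u v : X → ℝ} (hu : u ∈ S) (hv : v ∈ S) :
    B (u + v) (u + v) ≤ 2 * B u u + 2 * B v v := by
  have := h.nonneg _ (h.sub_mem hu hv)
  rw [h.sub_self hu hv] at this
  rw [h.add_self hu hv]
  linarith

/-- Expanding `B` at `u ± v` gives this cheap substitute for the Cauchy–Schwarz inequality, which
suffices for the summability of mixed terms. -/
theorem abs_le {u v : X → ℝ} (hu : u ∈ S) (hv : v ∈ S) : |B u v| ≤ B u u + B v v := by
  have h1 := h.nonneg _ (h.sub_mem hu hv)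
  have h2 := h.nonneg _ (h.add_mem u hu v hv)
  have h3 := h.nonneg u hu
  have h4 := h.nonneg v hv
  rw [h.sub_self hu hv] at h1
  rw [h.add_self hu hv] at h2
  rw [_root_.abs_le]
  constructor <;> linarith

theorem const_mul {c : ℝ} (hc : 0 ≤ c) : IsBilin S fun u v => c * B u v where
  add_mem := h.add_mem
  smul_mem := h.smul_mem
  add_left u hu v hv w hw := by rw [h.add_left u hu v hv w hw]; ring
  smul_left c u hu v hv := by rw [h.smul_left c u hu v hv]; ring
  symm u hu v hv := by rw [h.symm u hu v hv]
  nonneg u hu := mul_nonneg hc (h.nonneg u hu)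

theorem add (h' : IsBilin S B') : IsBilin S fun u v => B u v + B' u v where
  add_mem := h.add_mem
  smul_mem := h.smul_mem
  add_left u hu v hv w hw := by rw [h.add_left u hu v hv w hw, h'.add_left u hu v hv w hw]; ring
  smul_left c u hu v hv := by rw [h.smul_left c u hu v hv, h'.smul_left c u hu v hv]; ring
  symm u hu v hv := by rw [h.symm u hu v hv, h'.symm u hu v hv]
  nonneg u hu := add_nonneg (h.nonneg u hu) (h'.nonneg u hu)

end IsBilin

theorem IsBilin.sum {X ι : Type*} {S : Set (X → ℝ)} {B : ι → (X → ℝ) → (X → ℝ) → ℝ}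
    (s : Finset ι) (hadd : ∀ u ∈ S, ∀ v ∈ S, u + v ∈ S)
    (hsmul : ∀ c : ℝ, ∀ u ∈ S, c • u ∈ S) (h : ∀ i, IsBilin S (B i)) :
    IsBilin S fun u v => ∑ i ∈ s, B i u v where
  add_mem := hadd
  smul_mem := hsmul
  add_left u hu v hv w hw := by
    rw [← Finset.sum_add_distrib]
    exact Finset.sum_congr rfl fun i _ => (h i).add_left u hu v hv w hw
  smul_left c u hu v hv := by
    rw [Finset.mul_sum]
    exact Finset.sum_congr rfl fun i _ => (h i).smul_left c u hu v hv
  symm u hu v hv := Finset.sum_congr rfl fun i _ => (h i).symm u hu v hv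
  nonneg u hu := Finset.sum_nonneg fun i _ => (h i).nonneg u hu

theorem isBilin_dirichlet (w : List (Fin 3)) (i : Fin 3) : IsBilin (FTilde p α)
    fun u v => dirichlet (onBond p α u w i) (onBond p α v w i) where
  add_mem _ hu _ hv := FTilde_add hu hv
  smul_mem c _ hu := FTilde_smul hu c
  add_left _ hu _ hv _ hw := dirichlet_add_left (hu.2 _ _) (hv.2 _ _) (hw.2 _ _)
  smul_left c _ hu _ _ := dirichlet_smul_left (hu.2 _ _) c
  symm _ _ _ _ := dirichlet_comm _ _
  nonneg _ _ := dirichlet_self_nonneg _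

theorem isBilin_DI (k : ℕ) : IsBilin (FTilde p α) (DI p α k) :=
  IsBilin.sum _ (fun _ hu _ hv => FTilde_add hu hv) (fun c _ hu => FTilde_smul hu c) fun _ =>
    IsBilin.sum _ (fun _ hu _ hv => FTilde_add hu hv) (fun c _ hu => FTilde_smul hu c) fun _ =>
      isBilin_dirichlet _ _

theorem Q0_add_left (a b c : Fin 3 → ℝ) : Q0 (a + b) c = Q0 a c + Q0 b c := by
  simp only [Q0, ← Finset.sum_add_distrib]
  exact Finset.sum_congr rfl fun i _ => by simp only [Pi.add_apply]; ring

theorem Q0_smul_left (r : ℝ) (a c : Fin 3 → ℝ) : Q0 (r • a) c = r * Q0 a c := by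
  simp only [Q0, Finset.mul_sum]
  exact Finset.sum_congr rfl fun i _ => by simp only [Pi.smul_apply, smul_eq_mul]; ring

theorem Q0_comm (a b : Fin 3 → ℝ) : Q0 a b = Q0 b a := by
  simp only [Q0, mul_comm]

theorem Q0_self_nonneg (a : Fin 3 → ℝ) : 0 ≤ Q0 a a :=
  Finset.sum_nonneg fun _ _ => mul_self_nonneg _

theorem isBilin_QSigma (k : ℕ) : IsBilin (FTilde p α) (QSigma p α k) :=
  IsBilin.sum _ (fun _ hu _ hv => FTilde_add hu hv) (fun c _ hu => FTilde_smul hu c) fun _ =>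
    { add_mem := fun _ hu _ hv => FTilde_add hu hv
      smul_mem := fun c _ hu => FTilde_smul hu c
      add_left := fun _ _ _ _ _ _ => Q0_add_left _ _ _
      smul_left := fun c _ _ _ _ => Q0_smul_left c _ _
      symm := fun _ _ _ _ => Q0_comm _ _
      nonneg := fun _ _ => Q0_self_nonneg _ }

/-! ## Matching pairs -/

variable {R : ℕ → ℝ × ℝ}

theorem shift_mem (hR : R ∈ MPSeq) (n : ℕ) : shift R n ∈ MPSeq := fun m => hR (n + m)

theorem fst_pos (hR : R ∈ MPSeq) (m : ℕ) : 0 < (R m).1 := (hR m).1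

theorem snd_pos (hR : R ∈ MPSeq) (m : ℕ) : 0 < (R m).2 := (hR m).2.1

theorem fst_le (hR : R ∈ MPSeq) (m : ℕ) : (R m).1 ≤ 3 / 5 := by
  have := (hR m).2.2
  have := snd_pos hR m
  linarith

theorem snd_le_one (hR : R ∈ MPSeq) (m : ℕ) : (R m).2 ≤ 1 := by
  have := (hR m).2.2
  have := fst_pos hR m
  linarith

theorem delta_pos (hR : R ∈ MPSeq) (m : ℕ) : 0 < delta R m :=
  Finset.prod_pos fun k _ => fst_pos hR k

theorem gamma_pos (hR : R ∈ MPSeq) (m : ℕ) : 0 < gamma R m :=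
  mul_pos (delta_pos hR m) (snd_pos hR m)

theorem delta_zero : delta R 0 = 1 := by simp [delta]

theorem delta_shift (m : ℕ) : delta R (m + 1) = (R 0).1 * delta (shift R 1) m := by
  rw [delta, Finset.prod_range_succ', mul_comm]
  simp only [delta, shift, add_comm]

theorem delta_succ (m : ℕ) : delta R (m + 1) = delta R m * (R m).1 := Finset.prod_range_succ _ _

theorem gamma_zero : gamma R 0 = (R 0).2 := by simp [gamma, delta]

theorem gamma_shift (k : ℕ) : gamma R (k + 1) = (R 0).1 * gamma (shift R 1) k := by
  rw [gamma, delta_shift, gamma, mul_assoc, shift, add_comm 1 k]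

theorem shift_zero : shift R 0 = R := by ext <;> simp [shift]

theorem shift_shift (m n : ℕ) : shift (shift R m) n = shift R (m + n) := by
  ext <;> simp [shift, add_assoc]

theorem approxForm_zero (u v : K p α → ℝ) : approxForm p α R 0 u v =
    Q0 (fun i => u (vertex p α i)) (fun i => v (vertex p α i)) := by
  simp [approxForm, QSigma_zero, delta_zero]

/-- Removing the first letter of each word takes a factor `r_1` out of every `δ` and of every `γ`
but the first, which is `ρ_1`. -/
theorem approxForm_succ (m : ℕ) (u v : K p α → ℝ) : approxForm p α R (m + 1) u v =
    1 / (R 0).1 * ∑ i, approxForm p α (shift R 1) m (u ∘ GK p α i) (v ∘ GK p α i) +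
      1 / (R 0).2 * DI p α 0 u v := by
  simp only [approxForm]
  rw [Finset.sum_range_succ', gamma_zero, delta_shift, QSigma_succ, ← add_assoc]
  congr 1
  simp only [DI_succ, gamma_shift, Finset.sum_add_distrib, Finset.mul_sum, mul_add, one_div,
    mul_inv, mul_assoc]
  congr 1
  exact Finset.sum_comm

theorem isBilin_approxForm (hR : R ∈ MPSeq) (m : ℕ) :
    IsBilin (FTilde p α) (approxForm p α R m) :=
  ((isBilin_QSigma m).const_mul (one_div_pos.2 (delta_pos hR m)).le).add
    (IsBilin.sum _ (fun _ hu _ hv => FTilde_add hu hv) (fun c _ hu => FTilde_smul hu c) fun k =>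
      (isBilin_DI k).const_mul (one_div_pos.2 (gamma_pos hR k)).le)

/-! ### The resistor network of the first level -/

/-- Potentials at the vertices of the cells of the first level of the harmonic extension. -/
def harmonicValue (r : ℝ) (a : Fin 3 → ℝ) (i j : Fin 3) : ℝ :=
  a i - r / 3 * (3 * a i - 2 * a j - a (-(i + j)))

theorem harmonicValue_self (r : ℝ) (a : Fin 3 → ℝ) (i : Fin 3) : harmonicValue r a i i = a i := by
  -- In `Fin 3` the index `-(i + j)` is the third one when `i ≠ j`, and `i` itself when `i = j`,
  -- where the bracket vanishes.
  have : -(i + i) = i := by revert i; decide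
  rw [harmonicValue, this]; ring

/-- Kirchhoff's laws in weak form for three triangles with edge resistance `A`, joined by three
resistors `B`. By star-triangle reduction the triangles become stars with arms `A/3`, the inner loop
a triangle of edges `2A/3 + B`, and the whole network a triangle of edges `5A/3 + B`. -/
theorem harmonicValue_Q0 {A B : ℝ} (hA : 0 < A) (hB : 0 < B) (a : Fin 3 → ℝ)
    (b : Fin 3 → Fin 3 → ℝ) :
    1 / A * ∑ i, Q0 (harmonicValue (A / (5 / 3 * A + B)) a i) (b i) + 1 / B * ∑ i,
      (harmonicValue (A / (5 / 3 * A + B)) a (i + 1) i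
        - harmonicValue (A / (5 / 3 * A + B)) a i (i + 1)) * (b (i + 1) i - b i (i + 1)) =
    1 / (5 / 3 * A + B) * Q0 a fun i => b i i := by
  have hC : 5 / 3 * A + B ≠ 0 := by positivity
  set C := 5 / 3 * A + B with hCd
  have hBe : B = C - 5 / 3 * A := by rw [hCd]; ring
  have hB' : C - 5 / 3 * A ≠ 0 := by rw [← hBe]; exact hB.ne'
  rw [hBe]
  have e1 : (1 : Fin 3) + 1 = 2 := rfl
  have e2 : (2 : Fin 3) + 1 = 0 := rfl
  have e3 : (-1 : Fin 3) = 2 := rfl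
  have e4 : (-2 : Fin 3) = 1 := rfl
  have e5 : (1 : Fin 3) + 2 = 0 := rfl
  have e6 : (2 : Fin 3) + 2 = 1 := rfl
  simp only [Q0, harmonicValue, Fin.sum_univ_three, zero_add, add_zero, e1, e2, e3, e4, e5, e6,
    neg_zero]
  have key : ∀ X Y Z : ℝ, X * (C - 5 / 3 * A) + Y * A = Z * (A * (C - 5 / 3 * A)) →
      1 / A * X + 1 / (C - 5 / 3 * A) * Y = Z := by
    intro X Y Z h
    rw [div_mul_eq_mul_div, div_mul_eq_mul_div, div_add_div _ _ hA.ne' hB',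
      div_eq_iff (mul_ne_zero hA.ne' hB')]
    linarith
  apply key
  -- The potentials depend on `A` and `C` only through their ratio `t`.
  obtain ⟨t, ht⟩ : ∃ t, A = t * C := ⟨A / C, by field_simp⟩
  rw [ht, mul_div_assoc, div_self hC, one_div]
  field_simp
  ring

/-- For a matching pair the network of the first level has effective resistance one. The harmonic
potentials `c` minimise its energy: pairing `c` with `b` and with itself gives `Q0 a a` both times,
and the energy of `b - c` is nonnegative. -/
theorem Q0_le_of_matching {r ρ : ℝ} (hr : 0 < r) (hρ : 0 < ρ) (h : 5 / 3 * r + ρ = 1)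
    (b : Fin 3 → Fin 3 → ℝ) :
    Q0 (fun i => b i i) (fun i => b i i) ≤
      1 / r * ∑ i, Q0 (b i) (b i) + 1 / ρ * ∑ i, (b (i + 1) i - b i (i + 1)) ^ 2 := by
  set a : Fin 3 → ℝ := fun i => b i i with ha
  have h1 := harmonicValue_Q0 hr hρ a b
  have h2 := harmonicValue_Q0 hr hρ a (harmonicValue r a)
  simp only [harmonicValue_self] at h2
  rw [h, div_one] at h1 h2
  set c := harmonicValue r a with hc
  have h3 : 0 ≤ 1 / r * ∑ i, Q0 (b i - c i) (b i - c i) + 1 / ρ * ∑ i,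
      (b (i + 1) i - b i (i + 1) - (c (i + 1) i - c i (i + 1))) ^ 2 := by
    have := Finset.sum_nonneg fun i (_ : i ∈ Finset.univ) => Q0_self_nonneg (b i - c i)
    positivity
  have h4 : ∀ i, Q0 (b i - c i) (b i - c i) = Q0 (b i) (b i) - 2 * Q0 (c i) (b i)
      + Q0 (c i) (c i) := fun i => by
    simp only [Q0, Finset.mul_sum, ← Finset.sum_sub_distrib, ← Finset.sum_add_distrib]
    exact Finset.sum_congr rfl fun i _ => by simp only [Pi.sub_apply]; ring
  have h5 : ∀ i, (b (i + 1) i - b i (i + 1) - (c (i + 1) i - c i (i + 1))) ^ 2 =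
    (b (i + 1) i - b i (i + 1)) ^ 2 -
      2 * ((c (i + 1) i - c i (i + 1)) * (b (i + 1) i - b i (i + 1))) +
      (c (i + 1) i - c i (i + 1)) * (c (i + 1) i - c i (i + 1)) := fun i => by ring
  simp only [h4, h5, Finset.sum_add_distrib, Finset.sum_sub_distrib, ← Finset.mul_sum] at h3
  have h6 : (fun i => b i i) = a := rfl
  rw [h6] at h1
  have h7 : (fun i => a i) = a := rfl
  rw [h7] at h2
  nlinarith [h1, h2, h3]

theorem GK_vertex (i : Fin 3) : GK p α i (vertex p α i) = vertex p α i :=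
  Subtype.ext (by simp [GK, vertex, G])

theorem onBond_zero (u : K p α → ℝ) (i : Fin 3) :
    onBond p α u [] i 0 = (u ∘ GK p α i) (vertex p α (i + 1)) := by
  change u (bondPath p α i 0) = _
  rw [Standard.bondPath_zero]; rfl

theorem onBond_one (u : K p α → ℝ) (i : Fin 3) :
    onBond p α u [] i 1 = (u ∘ GK p α (i + 1)) (vertex p α i) := by
  change u (bondPath p α i 1) = _
  rw [Standard.bondPath_one]; rfl

/-- Self-similarity reduces to the step from level `0` to level `1`. There the network inequality
applies, since a Dirichlet integral over a bond is at least the squared difference of the end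
values. -/
theorem approxForm_le_succ (hR : R ∈ MPSeq) (m : ℕ) {u : K p α → ℝ} (hu : u ∈ FTilde p α)
    (H : Standard p α) : approxForm p α R m u u ≤ approxForm p α R (m + 1) u u := by
  induction m generalizing R u with
  | zero =>
    rw [approxForm_succ, approxForm_zero]
    simp only [approxForm_zero]
    have h := Q0_le_of_matching (hR 0).1 (hR 0).2.1 (hR 0).2.2
      fun i j => u (GK p α i (vertex p α j))
    simp only [GK_vertex] at h
    refine h.trans (add_le_add_right (mul_le_mul_of_nonneg_left ?_
      (one_div_pos.2 (snd_pos hR 0)).le) _)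
    rw [DI_zero]
    refine Finset.sum_le_sum fun i _ => ?_
    have := (hu.2 [] i).sq_sub_le 0 1
    rw [onBond_zero, onBond_one] at this
    simpa using this
  | succ m ih =>
    rw [approxForm_succ, approxForm_succ]
    refine add_le_add_left (mul_le_mul_of_nonneg_left (Finset.sum_le_sum fun i _ => ?_)
      (one_div_pos.2 (fst_pos hR 0)).le) _
    exact ih (shift_mem hR 1) (((H.mem_FTilde_iff u).1 hu).1 i)

theorem approxForm_mono (hR : R ∈ MPSeq) {u : K p α → ℝ} (hu : u ∈ FTilde p α)
    (H : Standard p α) : Monotone fun m => approxForm p α R m u u :=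
  monotone_nat_of_le_succ fun m => approxForm_le_succ hR m hu H

/-! ## The line form -/

/-- The domain of the line form. -/
abbrev lineDom (p : Fin 3 → Plane) (α : ℝ) (R : ℕ → ℝ × ℝ) : Set (K p α → ℝ) :=
  (lineForm p α R).dom

theorem approxForm_eq (m : ℕ) (u v : K p α → ℝ) : approxForm p α R m u v =
    1 / delta R m * QSigma p α m u v + ∑ k ∈ Finset.range m, 1 / gamma R k * DI p α k u v := rfl

theorem lineTerm_nonneg (hR : R ∈ MPSeq) {u : K p α → ℝ} (hu : u ∈ FTilde p α) (k : ℕ) :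
    0 ≤ 1 / gamma R k * DI p α k u u :=
  mul_nonneg (one_div_pos.2 (gamma_pos hR k)).le ((isBilin_DI k).nonneg u hu)

theorem sgTerm_nonneg (hR : R ∈ MPSeq) {u : K p α → ℝ} (hu : u ∈ FTilde p α) (k : ℕ) :
    0 ≤ 1 / delta R k * QSigma p α k u u :=
  mul_nonneg (one_div_pos.2 (delta_pos hR k)).le ((isBilin_QSigma k).nonneg u hu)

theorem fullForm_form_eq {u v : K p α → ℝ} {l : ℝ}
    (h : Tendsto (fun m => approxForm p α R m u v) atTop (𝓝 l)) :
    (fullForm p α R).form u v = l := h.limUnder_eq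

theorem summable_of_tendsto_approxForm (hR : R ∈ MPSeq) (H : Standard p α) {u : K p α → ℝ}
    (hu : u ∈ FTilde p α) {l : ℝ}
    (h : Tendsto (fun m => approxForm p α R m u u) atTop (𝓝 l)) :
    Summable fun k => 1 / gamma R k * DI p α k u u := by
  refine summable_of_sum_range_le (c := l) (lineTerm_nonneg hR hu) fun n => ?_
  have h1 := (approxForm_mono hR hu H).ge_of_tendsto h n
  rw [approxForm_eq] at h1
  linarith [sgTerm_nonneg hR hu n]

/-- As `𝓔_{𝓡,m}` and the partial sums of line terms converge separately, `𝓔_𝓡^Σ(u, u)` is the limit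
of `δ_m⁻¹ Q_m^Σ(u, u)`. This description needs no value of `limUnder`. -/
theorem mem_lineDom_iff (hR : R ∈ MPSeq) (H : Standard p α) (u : K p α → ℝ) :
    u ∈ lineDom p α R ↔ u ∈ FTilde p α ∧ (Summable fun k => 1 / gamma R k * DI p α k u u) ∧
      Tendsto (fun m => 1 / delta R m * QSigma p α m u u) atTop (𝓝 0) := by
  constructor
  · rintro ⟨⟨hu, l, hl⟩, h0⟩
    have hs := summable_of_tendsto_approxForm hR H hu hl
    refine ⟨hu, hs, ?_⟩
    rw [sgEnergy, fullForm_form_eq hl, lineEnergy] at h0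
    rw [← h0]
    refine (hl.sub hs.hasSum.tendsto_sum_nat).congr fun m => ?_
    rw [approxForm_eq]; ring
  · rintro ⟨hu, hs, h0⟩
    have hl : Tendsto (fun m => approxForm p α R m u u) atTop
        (𝓝 (0 + ∑' k, 1 / gamma R k * DI p α k u u)) := h0.add hs.hasSum.tendsto_sum_nat
    refine ⟨⟨hu, _, hl⟩, ?_⟩
    rw [sgEnergy, fullForm_form_eq hl, lineEnergy]
    ring

section

variable (hR : R ∈ MPSeq) (H : Standard p α)
include hR H

theorem lineDom_subset : lineDom p α R ⊆ FTilde p α := fun u hu =>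
  ((mem_lineDom_iff hR H u).1 hu).1

theorem lineDom_add {u v : K p α → ℝ} (hu : u ∈ lineDom p α R) (hv : v ∈ lineDom p α R) :
    u + v ∈ lineDom p α R := by
  rw [mem_lineDom_iff hR H] at hu hv ⊢
  obtain ⟨hu, hus, hu0⟩ := hu
  obtain ⟨hv, hvs, hv0⟩ := hv
  have huv := FTilde_add hu hv
  refine ⟨huv, ?_, ?_⟩
  · refine Summable.of_nonneg_of_le (lineTerm_nonneg hR huv) (fun k => ?_)
      ((hus.mul_left 2).add (hvs.mul_left 2))
    exact ((isBilin_DI k).const_mul (one_div_pos.2 (gamma_pos hR k)).le).add_self_le hu hv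
  · refine squeeze_zero (sgTerm_nonneg hR huv) (fun k => ?_)
      (by simpa only [mul_zero, add_zero] using (hu0.const_mul 2).add (hv0.const_mul 2))
    exact ((isBilin_QSigma k).const_mul (one_div_pos.2 (delta_pos hR k)).le).add_self_le hu hv

theorem lineDom_smul (c : ℝ) {u : K p α → ℝ} (hu : u ∈ lineDom p α R) :
    c • u ∈ lineDom p α R := by
  rw [mem_lineDom_iff hR H] at hu ⊢
  obtain ⟨hu, hus, hu0⟩ := hu
  refine ⟨FTilde_smul hu c, ?_, ?_⟩
  · refine (hus.mul_left (c * c)).congr fun k => ?_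
    rw [(isBilin_DI k).smul_left c u hu _ (FTilde_smul hu c), (isBilin_DI k).smul_right c hu hu]
    ring
  · have := hu0.const_mul (c * c)
    rw [mul_zero] at this
    refine this.congr fun k => ?_
    rw [(isBilin_QSigma k).smul_left c u hu _ (FTilde_smul hu c),
      (isBilin_QSigma k).smul_right c hu hu]
    ring

theorem summable_lineTerm {u v : K p α → ℝ} (hu : u ∈ lineDom p α R) (hv : v ∈ lineDom p α R) :
    Summable fun k => 1 / gamma R k * DI p α k u v := by
  obtain ⟨hu, hus, -⟩ := (mem_lineDom_iff hR H _).1 hu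
  obtain ⟨hv, hvs, -⟩ := (mem_lineDom_iff hR H _).1 hv
  refine Summable.of_norm_bounded (hus.add hvs) fun k => ?_
  exact ((isBilin_DI k).const_mul (one_div_pos.2 (gamma_pos hR k)).le).abs_le hu hv

theorem isBilin_lineEnergy : IsBilin (lineDom p α R) (lineEnergy p α R) where
  add_mem u hu v hv := lineDom_add hR H hu hv
  smul_mem c u hu := lineDom_smul hR H c hu
  add_left u hu v hv w hw := by
    rw [lineEnergy, lineEnergy, lineEnergy,
      ← (summable_lineTerm hR H hu hw).tsum_add (summable_lineTerm hR H hv hw)]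
    refine tsum_congr fun k => ?_
    rw [(isBilin_DI k).add_left u (lineDom_subset hR H hu) v (lineDom_subset hR H hv) w
      (lineDom_subset hR H hw)]
    ring
  smul_left c u hu v hv := by
    rw [lineEnergy, lineEnergy, ← tsum_mul_left]
    refine tsum_congr fun k => ?_
    rw [(isBilin_DI k).smul_left c u (lineDom_subset hR H hu) v (lineDom_subset hR H hv)]
    ring
  symm u hu v hv := tsum_congr fun k => by
    rw [(isBilin_DI k).symm u (lineDom_subset hR H hu) v (lineDom_subset hR H hv)]
  nonneg u hu := tsum_nonneg fun k => lineTerm_nonneg hR (lineDom_subset hR H hu) k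

theorem tendsto_approxForm_lineEnergy {u : K p α → ℝ} (hu : u ∈ lineDom p α R) :
    Tendsto (fun m => approxForm p α R m u u) atTop (𝓝 (lineEnergy p α R u u)) := by
  obtain ⟨-, hs, h0⟩ := (mem_lineDom_iff hR H _).1 hu
  have := h0.add hs.hasSum.tendsto_sum_nat
  rwa [zero_add] at this

/-- Here the increasing approximations converge to the line energy, the SG part being zero. Although
`Q_m^Σ` has disappeared from the limit, it still bounds it from below; level `0` gives `r_0 ≤ 1`. -/
theorem approxForm_le_lineEnergy {u : K p α → ℝ} (hu : u ∈ lineDom p α R) (m : ℕ) :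
    approxForm p α R m u u ≤ lineEnergy p α R u u :=
  (approxForm_mono hR (lineDom_subset hR H hu) H).ge_of_tendsto
    (tendsto_approxForm_lineEnergy hR H hu) m

theorem lineDom_const (c : ℝ) : (fun _ => c) ∈ lineDom p α R := by
  rw [mem_lineDom_iff hR H]
  have h1 : ∀ k, DI p α k (fun _ => c) (fun _ => c) = 0 := fun k =>
    Finset.sum_eq_zero fun w _ => Finset.sum_eq_zero fun i _ =>
      dirichlet_const_left c (memH1_const c)
  have h2 : ∀ k, QSigma p α k (fun _ => c) (fun _ => c) = 0 := fun k =>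
    Finset.sum_eq_zero fun w _ => by simp [Q0]
  refine ⟨FTilde_const c, ?_, ?_⟩
  · simp [h1]
  · simp [h2]

theorem lineEnergy_const_left (c : ℝ) {u : K p α → ℝ} (hu : u ∈ lineDom p α R) :
    lineEnergy p α R (fun _ => c) u = 0 := by
  have h1 : ∀ k, DI p α k (fun _ => c) u = 0 := fun k =>
    Finset.sum_eq_zero fun w _ => Finset.sum_eq_zero fun i _ =>
      dirichlet_const_left c ((lineDom_subset hR H hu).2 _ _)
  simp [lineEnergy, h1]

/-- The self-similarity of the domain of the line form. -/
theorem mem_lineDom_iff_pieces (u : K p α → ℝ) : u ∈ lineDom p α R ↔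
    (∀ i, u ∘ GK p α i ∈ lineDom p α (shift R 1)) ∧ ∀ i, MemH1 (onBond p α u [] i) := by
  have hR1 := shift_mem hR 1
  have hr := fst_pos hR 0
  have e1 : ∀ k, 1 / gamma R (k + 1) * DI p α (k + 1) u u =
      1 / (R 0).1 * ∑ i, 1 / gamma (shift R 1) k * DI p α k (u ∘ GK p α i) (u ∘ GK p α i) := by
    intro k
    rw [DI_succ, gamma_shift, ← Finset.mul_sum]
    simp only [one_div, mul_inv, mul_assoc]
  have e2 : ∀ k, 1 / delta R (k + 1) * QSigma p α (k + 1) u u =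
      1 / (R 0).1 * ∑ i, 1 / delta (shift R 1) k *
        QSigma p α k (u ∘ GK p α i) (u ∘ GK p α i) := by
    intro k
    rw [QSigma_succ, delta_shift, ← Finset.mul_sum]
    simp only [one_div, mul_inv, mul_assoc]
  simp only [mem_lineDom_iff hR1 H, mem_lineDom_iff hR H]
  rw [← summable_nat_add_iff 1, ← tendsto_add_atTop_iff_nat 1, H.mem_FTilde_iff]
  simp only [e1, e2]
  constructor
  · rintro ⟨⟨h1, h2⟩, h3, h4⟩
    have h3' := h3.mul_left (R 0).1
    have h4' := h4.const_mul (R 0).1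
    simp only [mul_one_div_cancel hr.ne', ← mul_assoc, one_mul, mul_zero] at h3' h4'
    refine ⟨fun i => ⟨h1 i, ?_, ?_⟩, h2⟩
    · refine Summable.of_nonneg_of_le (lineTerm_nonneg hR1 (h1 i)) (fun k => ?_) h3'
      exact Finset.single_le_sum (f := fun i => 1 / gamma (shift R 1) k *
        DI p α k (u ∘ GK p α i) (u ∘ GK p α i)) (fun j _ => lineTerm_nonneg hR1 (h1 j) k)
        (Finset.mem_univ i)
    · refine squeeze_zero (sgTerm_nonneg hR1 (h1 i)) (fun k => ?_) h4'
      exact Finset.single_le_sum (f := fun i => 1 / delta (shift R 1) k *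
        QSigma p α k (u ∘ GK p α i) (u ∘ GK p α i)) (fun j _ => sgTerm_nonneg hR1 (h1 j) k)
        (Finset.mem_univ i)
  · rintro ⟨h1, h2⟩
    refine ⟨⟨fun i => (h1 i).1, h2⟩, ?_, ?_⟩
    · exact (summable_sum fun i _ => (h1 i).2.1).mul_left _
    · simpa using (tendsto_finsetSum Finset.univ fun i _ => (h1 i).2.2).const_mul (1 / (R 0).1)

theorem comp_GK_mem {u : K p α → ℝ} (hu : u ∈ lineDom p α R) (i : Fin 3) :
    u ∘ GK p α i ∈ lineDom p α (shift R 1) := ((mem_lineDom_iff_pieces hR H u).1 hu).1 i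

/-- The first term of the series is the contribution of the three bonds; all later terms live on the
cells and carry a factor `1 / r_1`. -/
theorem lineEnergy_succ {u v : K p α → ℝ} (hu : u ∈ lineDom p α R) (hv : v ∈ lineDom p α R) :
    lineEnergy p α R u v =
      1 / (R 0).1 * ∑ i, lineEnergy p α (shift R 1) (u ∘ GK p α i) (v ∘ GK p α i) +
        1 / (R 0).2 * DI p α 0 u v := by
  have hR1 := shift_mem hR 1
  have hs : ∀ i, Summable fun k => 1 / gamma (shift R 1) k *
      DI p α k (u ∘ GK p α i) (v ∘ GK p α i) := fun i =>
    summable_lineTerm hR1 H (comp_GK_mem hR H hu i) (comp_GK_mem hR H hv i)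
  have e1 : ∀ k, 1 / gamma R (k + 1) * DI p α (k + 1) u v =
      1 / (R 0).1 * ∑ i, 1 / gamma (shift R 1) k * DI p α k (u ∘ GK p α i) (v ∘ GK p α i) := by
    intro k
    rw [DI_succ, gamma_shift, ← Finset.mul_sum]
    simp only [one_div, mul_inv, mul_assoc]
  rw [lineEnergy, (summable_lineTerm hR H hu hv).tsum_eq_zero_add, gamma_zero, add_comm]
  simp only [e1, tsum_mul_left]
  rw [Summable.tsum_finsetSum fun i _ => hs i]
  rfl

theorem Q0_le_lineEnergy {u : K p α → ℝ} (hu : u ∈ lineDom p α R) :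
    Q0 (fun i => u (vertex p α i)) (fun i => u (vertex p α i)) ≤ lineEnergy p α R u u := by
  rw [← approxForm_zero (R := R)]
  exact approxForm_le_lineEnergy hR H hu 0

theorem lineEnergy_piece_le {u : K p α → ℝ} (hu : u ∈ lineDom p α R) (i : Fin 3) :
    lineEnergy p α (shift R 1) (u ∘ GK p α i) (u ∘ GK p α i) ≤
      (R 0).1 * lineEnergy p α R u u := by
  have hR1 := shift_mem hR 1
  rw [lineEnergy_succ hR H hu hu]
  have h1 := Finset.single_le_sum (f := fun i => lineEnergy p α (shift R 1) (u ∘ GK p α i)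
    (u ∘ GK p α i)) (fun j _ => (isBilin_lineEnergy hR1 H).nonneg _ (comp_GK_mem hR H hu j))
    (Finset.mem_univ i)
  have h2 := (isBilin_DI 0).nonneg u (lineDom_subset hR H hu)
  have hr := fst_pos hR 0
  have hρ := snd_pos hR 0
  rw [mul_add, ← mul_assoc, mul_one_div_cancel hr.ne', one_mul]
  have : 0 ≤ (R 0).1 * (1 / (R 0).2 * DI p α 0 u u) := by positivity
  linarith

theorem dirichlet_bond_le {u : K p α → ℝ} (hu : u ∈ lineDom p α R) (i : Fin 3) :
    dirichlet (onBond p α u [] i) (onBond p α u [] i) ≤ lineEnergy p α R u u := by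
  have hR1 := shift_mem hR 1
  rw [lineEnergy_succ hR H hu hu, DI_zero]
  have h1 := Finset.single_le_sum (f := fun i => dirichlet (onBond p α u [] i) (onBond p α u [] i))
    (fun j _ => dirichlet_self_nonneg _) (Finset.mem_univ i)
  have h2 := Finset.sum_nonneg fun i (_ : i ∈ Finset.univ) =>
    (isBilin_lineEnergy hR1 H).nonneg _ (comp_GK_mem hR H hu i)
  have hr := fst_pos hR 0
  have hρ := snd_pos hR 0
  have h3 : 1 ≤ 1 / (R 0).2 := by
    rw [le_div_iff₀ hρ]; linarith [snd_le_one hR 0]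
  have h4 : 0 ≤ 1 / (R 0).1 * ∑ i, lineEnergy p α (shift R 1) (u ∘ GK p α i) (u ∘ GK p α i) := by
    positivity
  have h5 := dirichlet_self_nonneg (onBond p α u [] i)
  nlinarith [mul_le_mul h3 h1 h5 (by linarith)]

end

/-! ## Oscillation estimates -/

theorem sq_sub_le_Q0 (a : Fin 3 → ℝ) (i j : Fin 3) : (a i - a j) ^ 2 ≤ Q0 a a := by
  have e1 : (1 : Fin 3) + 1 = 2 := rfl
  have e2 : (2 : Fin 3) + 1 = 0 := rfl
  simp only [Q0, Fin.sum_univ_three, zero_add, e1, e2]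
  fin_cases i <;> fin_cases j <;> simp <;>
    nlinarith [sq_nonneg (a 0 - a 1), sq_nonneg (a 1 - a 2), sq_nonneg (a 2 - a 0)]

section

variable (H : Standard p α)
include H

/-- The factor comes from `r_1 ≤ 3/5 ≤ (4/5)²`. Any ratio below one, uniform in `𝓡`, would make the
oscillations in nested cells summable. -/
theorem sqrt_piece_le (hR : R ∈ MPSeq) {u : K p α → ℝ} (hu : u ∈ lineDom p α R) (i : Fin 3) :
    √(lineEnergy p α (shift R 1) (u ∘ GK p α i) (u ∘ GK p α i)) ≤
      4 / 5 * √(lineEnergy p α R u u) := by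
  refine Real.sqrt_le_left (by positivity) |>.2 ?_
  have hE := (isBilin_lineEnergy hR H).nonneg u hu
  rw [mul_pow, Real.sq_sqrt hE]
  refine (lineEnergy_piece_le hR H hu i).trans ?_
  nlinarith [fst_le hR 0]

/-- Go from `p k` to the fixed point `p i` of the first cell at the cost of one root of the energy,
then continue inside that cell. The constant solves `5 = 1 + 5 · 4/5`. -/
theorem abs_sub_vertex_le (hR : R ∈ MPSeq) {u : K p α → ℝ} (hu : u ∈ lineDom p α R)
    (w : List (Fin 3)) (j k : Fin 3) :
    |u (GwK p α w (vertex p α j)) - u (vertex p α k)| ≤ 5 * √(lineEnergy p α R u u) := by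
  have hv : ∀ {R : ℕ → ℝ × ℝ}, R ∈ MPSeq → ∀ {u : K p α → ℝ}, u ∈ lineDom p α R → ∀ j k,
      |u (vertex p α j) - u (vertex p α k)| ≤ √(lineEnergy p α R u u) := by
    intro R hR u hu j k
    exact Real.abs_le_sqrt ((sq_sub_le_Q0 (fun i => u (vertex p α i)) j k).trans
      (Q0_le_lineEnergy hR H hu))
  induction w generalizing R u k with
  | nil =>
    refine (hv hR hu j k).trans ?_
    linarith [Real.sqrt_nonneg (lineEnergy p α R u u)]
  | cons i w ih =>
    have h1 := ih (shift_mem hR 1) (comp_GK_mem hR H hu i) i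
    have h2 := hv hR hu i k
    have h0 : (u ∘ GK p α i) (vertex p α i) = u (vertex p α i) := by
      simp [GK_vertex]
    rw [h0] at h1
    have h3 := sqrt_piece_le H hR hu i
    have h4 : |u (GwK p α (i :: w) (vertex p α j)) - u (vertex p α k)| ≤
        |u (GwK p α (i :: w) (vertex p α j)) - u (vertex p α i)| +
          |u (vertex p α i) - u (vertex p α k)| := abs_sub_le _ _ _
    have h5 : u (GwK p α (i :: w) (vertex p α j)) =
        (u ∘ GK p α i) (GwK p α w (vertex p α j)) := rfl
    rw [h5] at h4 ⊢
    linarith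

/-- The constant is `5` for reaching an end of the bond plus `1` for the Hölder estimate along it;
it survives the induction as `1 + 6 · 4/5 ≤ 6`. -/
theorem abs_sub_bond_le (hR : R ∈ MPSeq) {u : K p α → ℝ} (hu : u ∈ lineDom p α R)
    (w : List (Fin 3)) (i k : Fin 3) (t : I) :
    |u (GwK p α w (bondPath p α i t)) - u (vertex p α k)| ≤ 6 * √(lineEnergy p α R u u) := by
  induction w generalizing R u k with
  | nil =>
    have h1 := (((lineDom_subset hR H) hu).2 [] i).sq_sub_le 0 t
    have h2 := dirichlet_bond_le hR H hu i
    have ht := t.2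
    have h3 : (onBond p α u [] i t - onBond p α u [] i 0) ^ 2 ≤ lineEnergy p α R u u := by
      refine h1.trans (le_trans ?_ h2)
      have h0 := dirichlet_self_nonneg (onBond p α u [] i)
      have : |(t : ℝ) - (0 : I)| ≤ 1 := by
        rw [Icc.coe_zero, sub_zero, abs_of_nonneg ht.1]; exact ht.2
      nlinarith
    have h4 := Real.abs_le_sqrt h3
    have h5 := abs_sub_vertex_le H hR hu [i] (i + 1) k
    rw [onBond_zero] at h4
    have h6 : u (GwK p α [] (bondPath p α i t)) = onBond p α u [] i t := rfl
    have h7 : u (GwK p α [i] (vertex p α (i + 1))) = (u ∘ GK p α i) (vertex p α (i + 1)) := rfl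
    rw [h6]
    rw [h7] at h5
    linarith [abs_sub_le (onBond p α u [] i t) ((u ∘ GK p α i) (vertex p α (i + 1)))
      (u (vertex p α k))]
  | cons l w ih =>
    have h1 := ih (shift_mem hR 1) (comp_GK_mem hR H hu l) l
    have h0 : (u ∘ GK p α l) (vertex p α l) = u (vertex p α l) := by
      simp [GK_vertex]
    have h2' : |u (vertex p α l) - u (vertex p α k)| ≤ √(lineEnergy p α R u u) :=
      Real.abs_le_sqrt ((sq_sub_le_Q0 (fun i => u (vertex p α i)) l k).trans
        (Q0_le_lineEnergy hR H hu))
    rw [h0] at h1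
    have h3 := sqrt_piece_le H hR hu l
    have h4 : |u (GwK p α (l :: w) (bondPath p α i t)) - u (vertex p α k)| ≤
        |u (GwK p α (l :: w) (bondPath p α i t)) - u (vertex p α l)| +
          |u (vertex p α l) - u (vertex p α k)| := abs_sub_le _ _ _
    have h5 : u (GwK p α (l :: w) (bondPath p α i t)) =
        (u ∘ GK p α l) (GwK p α w (bondPath p α i t)) := rfl
    rw [h5] at h4 ⊢
    linarith [Real.sqrt_nonneg (lineEnergy p α R u u)]

/-- The oscillation of a function is controlled by its energy. -/
theorem abs_sub_le_sqrt (hR : R ∈ MPSeq) {u : K p α → ℝ} (hu : u ∈ lineDom p α R) (x y : K p α) :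
    |u x - u y| ≤ 12 * √(lineEnergy p α R u u) := by
  have hc := (lineDom_subset hR H hu).1
  have h : ∀ x, |u x - u (vertex p α 0)| ≤ 6 * √(lineEnergy p α R u u) := fun x =>
    forall_mem_of_isClosed (C := {x | |u x - u (vertex p α 0)| ≤ 6 * √(lineEnergy p α R u u)})
      (isClosed_le (by fun_prop) continuous_const)
      (fun w i => (abs_sub_vertex_le H hR hu w i 0).trans (by
        linarith [Real.sqrt_nonneg (lineEnergy p α R u u)]))
      (fun w i t => abs_sub_bond_le H hR hu w i 0 t) x
  have h1 := h x
  have h2 := h y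
  rw [abs_sub_comm] at h2
  linarith [abs_sub_le (u x) (u (vertex p α 0)) (u y)]

theorem sq_sub_le_lineEnergy (hR : R ∈ MPSeq) {u : K p α → ℝ} (hu : u ∈ lineDom p α R)
    (x y : K p α) : (u x - u y) ^ 2 ≤ 144 * lineEnergy p α R u u := by
  have h := abs_sub_le_sqrt H hR hu x y
  have hE := (isBilin_lineEnergy hR H).nonneg u hu
  rw [← sq_abs, show 144 * lineEnergy p α R u u = (12 * √(lineEnergy p α R u u)) ^ 2 by
    rw [mul_pow, Real.sq_sqrt hE]; norm_num]
  exact pow_le_pow_left₀ (abs_nonneg _) h 2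

end

/-! ## The line form is a resistance form -/

theorem isBilin_of_isResistanceForm {X : Type*} {A : FormPair X} (hA : A.IsResistanceForm) :
    IsBilin A.dom A.form :=
  ⟨hA.add_mem, hA.smul_mem, hA.add_left, hA.smul_left, hA.symm, hA.nonneg⟩

theorem dirichlet_le_DI (u : K p α → ℝ) (w : List (Fin 3)) (i : Fin 3) :
    dirichlet (onBond p α u w i) (onBond p α u w i) ≤ DI p α w.length u u := by
  have h1 := Finset.single_le_sum (f := fun v : Fin w.length → Fin 3 => ∑ i, dirichlet
    (onBond p α u (List.ofFn v) i) (onBond p α u (List.ofFn v) i))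
    (fun v _ => Finset.sum_nonneg fun i _ => dirichlet_self_nonneg _) (Finset.mem_univ w.get)
  refine le_trans ?_ h1
  have h2 := Finset.single_le_sum (f := fun i => dirichlet (onBond p α u w i) (onBond p α u w i))
    (fun i _ => dirichlet_self_nonneg _) (Finset.mem_univ i)
  simpa [List.ofFn_get] using h2

section

variable (hR : R ∈ MPSeq) (H : Standard p α)
include hR H

theorem dirichlet_onBond_le {u : K p α → ℝ} (hu : u ∈ lineDom p α R) (w : List (Fin 3))
    (i : Fin 3) : dirichlet (onBond p α u w i) (onBond p α u w i) ≤
      gamma R w.length * lineEnergy p α R u u := by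
  refine (dirichlet_le_DI u w i).trans ?_
  have h1 := (summable_lineTerm hR H hu hu).le_tsum w.length
    fun k _ => lineTerm_nonneg hR (lineDom_subset hR H hu) k
  have hg := gamma_pos hR w.length
  rw [one_div, inv_mul_le_iff₀ hg] at h1
  exact h1

theorem exists_lineDom_glue (f : Fin 3 → K p α → ℝ) (g : Fin 3 → I → ℝ)
    (hf : ∀ i, f i ∈ lineDom p α (shift R 1)) (hg : ∀ i, MemH1 (g i))
    (h0 : ∀ i, g i 0 = f i (vertex p α (i + 1))) (h1 : ∀ i, g i 1 = f (i + 1) (vertex p α i)) :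
    ∃ u ∈ lineDom p α R, (∀ i, u ∘ GK p α i = f i) ∧ ∀ i, onBond p α u [] i = g i := by
  obtain ⟨u, h2, h3⟩ := H.exists_glue f g h0 h1
  refine ⟨u, (mem_lineDom_iff_pieces hR H u).2 ⟨fun i => ?_, fun i => ?_⟩, h2, h3⟩
  · rw [h2]; exact hf i
  · rw [h3]; exact hg i

/-- Gluing along affine functions on the bonds. -/
theorem exists_lineDom_glue_affine (f : Fin 3 → K p α → ℝ)
    (hf : ∀ i, f i ∈ lineDom p α (shift R 1)) :
    ∃ u ∈ lineDom p α R, (∀ i, u ∘ GK p α i = f i) ∧ ∀ i, onBond p α u [] i = fun t : I =>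
      f i (vertex p α (i + 1)) + (f (i + 1) (vertex p α i) - f i (vertex p α (i + 1))) * (t : ℝ) :=
  exists_lineDom_glue hR H f _ hf (fun i => memH1_affine _ _) (fun i => by simp)
    (fun i => by simp)

/-- Zero on the other cells and affine interpolation on the bonds extend any `f`. Thus restriction
to a cell is onto, as the domains of a resolution require. -/
theorem exists_lineDom_cell (f : K p α → ℝ) (hf : f ∈ lineDom p α (shift R 1)) (i : Fin 3) :
    ∃ u ∈ lineDom p α R, u ∘ GK p α i = f := by
  obtain ⟨u, h1, h2, -⟩ := exists_lineDom_glue_affine hR H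
    (fun j => if j = i then f else fun _ => 0) fun j => by
      split_ifs
      · exact hf
      · exact lineDom_const (shift_mem hR 1) H 0
  exact ⟨u, h1, by rw [h2, if_pos rfl]⟩

theorem exists_lineDom_const_cells (a : Fin 3 → ℝ) :
    ∃ u ∈ lineDom p α R, (∀ i x, u (GK p α i x) = a i) ∧
      ∀ i t, u (bondPath p α i t) = a i + (a (i + 1) - a i) * (t : ℝ) := by
  obtain ⟨u, h1, h2, h3⟩ := exists_lineDom_glue_affine hR H (fun i _ => a i)
    fun i => lineDom_const (shift_mem hR 1) H (a i)
  exact ⟨u, h1, fun i x => congrFun (h2 i) x, fun i t => congrFun (h3 i) t⟩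

omit hR in
theorem cover_open (x : K p α) : (∃ i y, GK p α i y = x) ∨
    ∃ i t, bondPath p α i t = x ∧ (t : ℝ) ≠ 0 ∧ (t : ℝ) ≠ 1 := by
  rcases H.cover x with h | ⟨i, t, h⟩
  · exact Or.inl h
  · by_cases h0 : (t : ℝ) = 0
    · have : t = 0 := Subtype.ext h0
      subst this
      exact Or.inl ⟨i, _, by rw [← h, Standard.bondPath_zero]⟩
    by_cases h1 : (t : ℝ) = 1
    · have : t = 1 := Subtype.ext h1
      subst this
      exact Or.inl ⟨i + 1, _, by rw [← h, Standard.bondPath_one]⟩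
    exact Or.inr ⟨i, t, h, h0, h1⟩

/-- Functions that are `1` on one cell, `0` on the two others and affine on the bonds already
separate points that do not share a cell. -/
theorem separates_of_not_same_cell {x y : K p α} (hxy : x ≠ y)
    (hne : ¬∃ i x' y', GK p α i x' = x ∧ GK p α i y' = y) :
    ∃ u ∈ lineDom p α R, u x ≠ u y := by
  have key : ∀ (j i : Fin 3) (t : I), (t : ℝ) ≠ 0 → (t : ℝ) ≠ 1 → ∃ u ∈ lineDom p α R,
      (∀ x', u (GK p α j x') = 1) ∧ u (bondPath p α i t) ≠ 1 := by
    intro j i t h0 h1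
    obtain ⟨u, hu, h2, h3⟩ := exists_lineDom_const_cells hR H fun k => if k = j then 1 else 0
    refine ⟨u, hu, fun x' => by rw [h2, if_pos rfl], ?_⟩
    rw [h3]
    rcases fin3_cases i j with rfl | rfl | rfl
    · simpa [fin3_one_ne] using h0
    · simpa [(fin3_one_ne i).symm] using h1
    · simp [(fin3_two_ne i).symm, (fin3_two_ne_one i).symm]
  have key2 : ∀ (i : Fin 3) (s t : I), (s : ℝ) ≠ 1 → ∃ u ∈ lineDom p α R,
      u (bondPath p α i s) ≠ u (bondPath p α (i + 1) t) := by
    intro i s t h1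
    obtain ⟨u, hu, h2, h3⟩ := exists_lineDom_const_cells hR H fun k => if k = i then 1 else 0
    refine ⟨u, hu, ?_⟩
    rw [h3, h3, fin3_one_one]
    simp only [if_pos, fin3_one_ne, fin3_two_ne, if_false]
    intro h
    exact h1 (by linarith)
  rcases cover_open H x with ⟨i, x, rfl⟩ | ⟨i, s, rfl, hs0, hs1⟩ <;>
    rcases cover_open H y with ⟨j, y, rfl⟩ | ⟨j, t, rfl, ht0, ht1⟩
  · have hij : j ≠ i := fun h => hne ⟨i, x, y, rfl, by rw [h]⟩
    obtain ⟨u, hu, h2, -⟩ := exists_lineDom_const_cells hR H fun k => if k = i then 1 else 0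
    refine ⟨u, hu, ?_⟩
    rw [h2, h2, if_pos rfl, if_neg hij]
    norm_num
  · obtain ⟨u, hu, h1, h2⟩ := key i j t ht0 ht1
    exact ⟨u, hu, by rw [h1]; exact h2.symm⟩
  · obtain ⟨u, hu, h1, h2⟩ := key j i s hs0 hs1
    exact ⟨u, hu, by rw [h1]; exact h2⟩
  · rcases fin3_cases i j with rfl | rfl | rfl
    · obtain ⟨u, hu, h2, h3⟩ := exists_lineDom_const_cells hR H fun k => if k = j then 1 else 0
      refine ⟨u, hu, fun h => hxy ?_⟩
      rw [h3, h3] at h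
      simp only [if_pos, fin3_one_ne, if_false] at h
      have : s = t := Subtype.ext (by linarith)
      rw [this]
    · exact key2 i s t hs1
    · obtain ⟨u, hu, h⟩ := key2 (i + 2) t s ht1
      rw [fin3_two_one] at h
      exact ⟨u, hu, h.symm⟩

omit hR in
-- Two points in a common cell are pulled back by `G_i`, which divides their distance by `(1 - α) /
-- 2 < 1`. As `K` is bounded, this stops after finitely many steps at two points without a common
-- cell.
theorem lineDom_separates (hR : R ∈ MPSeq) {x y : K p α} (hxy : x ≠ y) :
    ∃ u ∈ lineDom p α R, u x ≠ u y := by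
  have hb := (isCompact_gasket p α H.pos H.lt_one).isBounded
  set D := Metric.diam (gasket p α) with hD
  have hdist : ∀ x y : K p α, dist x y ≤ D := fun x y =>
    Metric.dist_le_diam_of_mem hb x.2 y.2
  set c := (1 - α) / 2 with hc
  have hc0 : 0 < c := by have := H.lt_one; rw [hc]; linarith
  have hc1 : c < 1 := by have := H.pos; rw [hc]; linarith
  have key : ∀ n : ℕ, ∀ R ∈ MPSeq, ∀ x y : K p α, D * c ^ n < dist x y →
      ∃ u ∈ lineDom p α R, u x ≠ u y := by
    intro n
    induction n with
    | zero =>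
      intro R _ x y h
      rw [pow_zero, mul_one] at h
      exact absurd (hdist x y) (not_le.2 h)
    | succ n ih =>
      intro R hR x y h
      by_cases hsame : ∃ i x' y', GK p α i x' = x ∧ GK p α i y' = y
      · obtain ⟨i, x', y', rfl, rfl⟩ := hsame
        have hd : dist (GK p α i x') (GK p α i y') = c * dist x' y' :=
          dist_G p α H.lt_one i x' y'
        rw [hd, pow_succ, ← mul_assoc, mul_comm _ c] at h
        obtain ⟨f, hf, hfxy⟩ := ih _ (shift_mem hR 1) x' y' (lt_of_mul_lt_mul_left h hc0.le)
        obtain ⟨u, hu, rfl⟩ := exists_lineDom_cell hR H f hf i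
        exact ⟨u, hu, hfxy⟩
      · refine separates_of_not_same_cell hR H (fun hxy => ?_) hsame
        rw [hxy, dist_self] at h
        have : 0 ≤ D * c ^ (n + 1) := mul_nonneg Metric.diam_nonneg (by positivity)
        linarith
  have hlim : Tendsto (fun n : ℕ => D * c ^ n) atTop (𝓝 (D * 0)) :=
    (tendsto_pow_atTop_nhds_zero_of_lt_one hc0.le hc1).const_mul D
  rw [mul_zero] at hlim
  obtain ⟨n, hn⟩ := (hlim.eventually (gt_mem_nhds (dist_pos.2 hxy))).exists
  exact key n R hR x y hn

theorem lineEnergy_sub_const {u : K p α → ℝ} (hu : u ∈ lineDom p α R) (c : ℝ) :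
    lineEnergy p α R (u - fun _ => c) (u - fun _ => c) = lineEnergy p α R u u := by
  have hB := isBilin_lineEnergy hR H
  have hcm := lineDom_const hR H c
  rw [hB.sub_self hu hcm, hB.symm u hu _ hcm, lineEnergy_const_left hR H c hu,
    lineEnergy_const_left hR H c hcm]
  ring

theorem lineEnergy_eq_zero_iff {u : K p α → ℝ} (hu : u ∈ lineDom p α R) :
    lineEnergy p α R u u = 0 ↔ ∃ c : ℝ, u = fun _ => c := by
  constructor
  · intro h
    refine ⟨u (vertex p α 0), funext fun x => ?_⟩
    have := sq_sub_le_lineEnergy H hR hu x (vertex p α 0)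
    rw [h, mul_zero] at this
    have := pow_eq_zero_iff two_ne_zero |>.1 (le_antisymm this (sq_nonneg _))
    linarith
  · rintro ⟨c, rfl⟩
    exact lineEnergy_const_left hR H c hu

omit hR H in
/-- Approximating energies of a pointwise limit of a sequence that is Cauchy in energy. -/
theorem approxForm_sub_tendsto {s : ℕ → K p α → ℝ} {u : K p α → ℝ} (hl : ∀ x, Tendsto (fun n => s n x) atTop (𝓝 (u x)))
    (hD : ∀ w i, Tendsto (fun n => dirichlet (onBond p α (s n - u) w i)
      (onBond p α (s n - u) w i)) atTop (𝓝 0)) (m : ℕ) :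
    Tendsto (fun n => approxForm p α R m (s n - u) (s n - u)) atTop (𝓝 0) := by
  have hx : ∀ x, Tendsto (fun n => (s n - u) x) atTop (𝓝 0) := fun x => by
    simpa using (hl x).sub_const (u x)
  have h1 : Tendsto (fun n => QSigma p α m (s n - u) (s n - u)) atTop (𝓝 0) := by
    have : Tendsto (fun n => QSigma p α m (s n - u) (s n - u)) atTop
        (𝓝 (∑ w : Fin m → Fin 3, ∑ i : Fin 3, ((0 : ℝ) - 0) * (0 - 0))) :=
      tendsto_finsetSum _ fun w _ => tendsto_finsetSum _ fun i _ =>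
        ((hx _).sub (hx _)).mul ((hx _).sub (hx _))
    simpa using this
  have h2 : ∀ k, Tendsto (fun n => DI p α k (s n - u) (s n - u)) atTop (𝓝 0) := fun k => by
    have : Tendsto (fun n => DI p α k (s n - u) (s n - u)) atTop
        (𝓝 (∑ w : Fin k → Fin 3, ∑ i : Fin 3, (0 : ℝ))) :=
      tendsto_finsetSum _ fun w _ => tendsto_finsetSum _ fun i _ => hD _ _
    simpa using this
  have h3 := (h1.const_mul (1 / delta R m)).add
    (tendsto_finsetSum (Finset.range m) fun k _ => (h2 k).const_mul (1 / gamma R k))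
  simp only [mul_zero, Finset.sum_const_zero, add_zero] at h3
  exact h3

/-- A pointwise limit of functions that form a Cauchy sequence in energy is a limit in energy. -/
theorem lineDom_of_cauchy {s : ℕ → K p α → ℝ} (hs : ∀ n, s n ∈ lineDom p α R)
    (hc : ∀ ε > 0, ∃ N, ∀ m ≥ N, ∀ n ≥ N, lineEnergy p α R (s m - s n) (s m - s n) < ε)
    {u : K p α → ℝ} (hu : Continuous u) (hl : ∀ x, Tendsto (fun n => s n x) atTop (𝓝 (u x))) :
    u ∈ lineDom p α R ∧
      Tendsto (fun n => lineEnergy p α R (s n - u) (s n - u)) atTop (𝓝 0) := by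
  have hB := isBilin_lineEnergy hR H
  have hbond : ∀ w i, MemH1 (onBond p α u w i) ∧ Tendsto (fun n => dirichlet
      (onBond p α (s n) w i - onBond p α u w i) (onBond p α (s n) w i - onBond p α u w i))
        atTop (𝓝 0) := by
    intro w i
    refine MemH1.of_cauchy (fun n => (lineDom_subset hR H (hs n)).2 w i) (fun ε hε => ?_)
      fun t => hl _
    have hg := gamma_pos hR w.length
    obtain ⟨N, hN⟩ := hc (ε / gamma R w.length) (by positivity)
    refine ⟨N, fun m hm n hn => ?_⟩
    refine (dirichlet_onBond_le hR H (hB.sub_mem (hs m) (hs n)) w i).trans_lt ?_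
    rw [← lt_div_iff₀' hg]
    exact hN m hm n hn
  have huF : u ∈ FTilde p α := ⟨hu, fun w i => (hbond w i).1⟩
  have hlim := approxForm_sub_tendsto (R := R) hl fun w i => (hbond w i).2
  -- At a fixed level the approximation passes to the limit, whereas the Cauchy bound does not
  -- depend on the level. The result is a bound uniform in `m` before membership of `u` is known.
  have key : ∀ ε > 0, ∃ N, ∀ n ≥ N, ∀ m, approxForm p α R m (s n - u) (s n - u) ≤ 2 * ε := by
    intro ε hε
    obtain ⟨N, hN⟩ := hc ε hε
    refine ⟨N, fun n hn m => ?_⟩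
    have h1 : ∀ᶠ k in atTop, approxForm p α R m (s n - u) (s n - u) ≤
        2 * ε + 2 * approxForm p α R m (s k - u) (s k - u) := by
      filter_upwards [eventually_ge_atTop N] with k hk
      have h2 := (isBilin_approxForm hR m).add_self_le
        (FTilde_sub (lineDom_subset hR H (hs n)) (lineDom_subset hR H (hs k)))
        (FTilde_sub (lineDom_subset hR H (hs k)) huF)
      rw [sub_add_sub_cancel] at h2
      have h3 := approxForm_le_lineEnergy hR H (hB.sub_mem (hs n) (hs k)) m
      linarith [hN n hn k hk]
    have h4 := ge_of_tendsto ((hlim m).const_mul 2 |>.const_add (2 * ε)) h1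
    simpa using h4
  have hmem : u ∈ lineDom p α R := by
    rw [mem_lineDom_iff hR H]
    refine ⟨huF, ?_, ?_⟩
    · obtain ⟨N, hN⟩ := key 1 one_pos
      refine summable_of_sum_range_le (c := 4 + 2 * lineEnergy p α R (s N) (s N))
        (lineTerm_nonneg hR huF) fun m => ?_
      have h1 := (isBilin_approxForm hR m).add_self_le
        (FTilde_sub huF (lineDom_subset hR H (hs N))) (lineDom_subset hR H (hs N))
      rw [sub_add_cancel] at h1
      have h2 := hN N le_rfl m
      have h3 := approxForm_le_lineEnergy hR H (hs N) m
      have h4 := sgTerm_nonneg hR huF m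
      have h5 : approxForm p α R m (u - s N) (u - s N) =
          approxForm p α R m (s N - u) (s N - u) := by
        rw [(isBilin_approxForm hR m).sub_self huF (lineDom_subset hR H (hs N)),
          (isBilin_approxForm hR m).sub_self (lineDom_subset hR H (hs N)) huF,
          (isBilin_approxForm hR m).symm u huF _ (lineDom_subset hR H (hs N))]
        ring
      rw [approxForm_eq m u u] at h1
      linarith
    -- The SG term of `u` is at most twice that of `s N - u`, small uniformly in `m`, plus twice
    -- that of `s N`, which tends to zero.
    · rw [Metric.tendsto_atTop]
      intro ε hε
      obtain ⟨N, hN⟩ := key (ε / 8) (by positivity)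
      obtain ⟨M, hM⟩ := (Metric.tendsto_atTop.1 ((mem_lineDom_iff hR H _).1 (hs N)).2.2)
        (ε / 8) (by positivity)
      refine ⟨M, fun m hm => ?_⟩
      have hsN := lineDom_subset hR H (hs N)
      have hQ := (isBilin_QSigma (p := p) (α := α) m).const_mul
        (one_div_pos.2 (delta_pos hR m)).le
      have h1 := hQ.add_self_le (FTilde_sub huF hsN) hsN
      rw [sub_add_cancel] at h1
      have h5 : 1 / delta R m * QSigma p α m (u - s N) (u - s N) =
          1 / delta R m * QSigma p α m (s N - u) (s N - u) := by
        rw [hQ.sub_self huF hsN, hQ.sub_self hsN huF, hQ.symm u huF _ hsN]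
        ring
      have h2 := hN N le_rfl m
      have h6 : 0 ≤ ∑ k ∈ Finset.range m, 1 / gamma R k * DI p α k (s N - u) (s N - u) :=
        Finset.sum_nonneg fun k _ => lineTerm_nonneg hR (FTilde_sub hsN huF) k
      rw [approxForm_eq] at h2
      have h3 := hM m hm
      rw [Real.dist_eq, sub_zero, abs_of_nonneg (sgTerm_nonneg hR hsN m)] at h3
      rw [Real.dist_eq, sub_zero, abs_of_nonneg (sgTerm_nonneg hR huF m)]
      linarith
  refine ⟨hmem, ?_⟩
  rw [Metric.tendsto_atTop]
  intro ε hε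
  obtain ⟨N, hN⟩ := key (ε / 4) (by positivity)
  refine ⟨N, fun n hn => ?_⟩
  have h1 := le_of_tendsto' (tendsto_approxForm_lineEnergy hR H (hB.sub_mem (hs n) hmem)) (hN n hn)
  rw [Real.dist_eq, sub_zero, abs_of_nonneg (hB.nonneg _ (hB.sub_mem (hs n) hmem))]
  linarith

/-- Once normalised to vanish at a vertex, a sequence that is Cauchy in energy is uniformly Cauchy
by the oscillation bound. So it has a continuous limit, to which `lineDom_of_cauchy` applies. -/
theorem lineDom_complete {s : ℕ → K p α → ℝ} (hs : ∀ n, s n ∈ lineDom p α R)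
    (hc : ∀ ε > 0, ∃ N, ∀ m ≥ N, ∀ n ≥ N, lineEnergy p α R (s m - s n) (s m - s n) < ε) :
    ∃ u ∈ lineDom p α R,
      Tendsto (fun n => lineEnergy p α R (s n - u) (s n - u)) atTop (𝓝 0) := by
  have hB := isBilin_lineEnergy hR H
  set x₀ : K p α := vertex p α 0
  set v : ℕ → K p α → ℝ := fun n => s n - fun _ => s n x₀ with hv
  have hvm : ∀ n, v n ∈ lineDom p α R := fun n => hB.sub_mem (hs n) (lineDom_const hR H _)
  have hdiff : ∀ m n, v m - v n = (s m - s n) - fun _ => (s m x₀ - s n x₀) := fun m n => by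
    ext x; simp only [hv, Pi.sub_apply]; ring
  have hE : ∀ m n, lineEnergy p α R (v m - v n) (v m - v n) =
      lineEnergy p α R (s m - s n) (s m - s n) := fun m n => by
    rw [hdiff, lineEnergy_sub_const hR H (hB.sub_mem (hs m) (hs n))]
  have hcv : ∀ ε > 0, ∃ N, ∀ m ≥ N, ∀ n ≥ N,
      lineEnergy p α R (v m - v n) (v m - v n) < ε := by simpa only [hE] using hc
  have hpt : ∀ ε > 0, ∃ N, ∀ m ≥ N, ∀ n ≥ N, ∀ x, dist (v m x) (v n x) < ε := by
    intro ε hε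
    obtain ⟨N, hN⟩ := hcv ((ε / 12) ^ 2) (by positivity)
    refine ⟨N, fun m hm n hn x => ?_⟩
    have h1 := abs_sub_le_sqrt H hR (hB.sub_mem (hvm m) (hvm n)) x x₀
    have h2 : (v m - v n) x - (v m - v n) x₀ = v m x - v n x := by simp [hv]
    rw [h2] at h1
    have h3 := Real.sqrt_lt_sqrt (hB.nonneg _ (hB.sub_mem (hvm m) (hvm n))) (hN m hm n hn)
    rw [Real.sqrt_sq (by positivity)] at h3
    rw [Real.dist_eq]
    linarith
  have hex : ∀ x, ∃ l, Tendsto (fun n => v n x) atTop (𝓝 l) := fun x =>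
    cauchySeq_tendsto_of_complete (Metric.cauchySeq_iff.2 fun ε hε => by
      obtain ⟨N, hN⟩ := hpt ε hε
      exact ⟨N, fun m hm n hn => hN m hm n hn x⟩)
  choose u hu using hex
  have hunif : TendstoUniformly v u atTop := by
    rw [Metric.tendstoUniformly_iff]
    intro ε hε
    obtain ⟨N, hN⟩ := hpt (ε / 2) (by positivity)
    filter_upwards [eventually_ge_atTop N] with n hn x
    have h1 : dist (u x) (v n x) ≤ ε / 2 := by
      refine le_of_tendsto ((hu x).dist tendsto_const_nhds) ?_
      filter_upwards [eventually_ge_atTop N] with m hm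
      exact (hN m hm n hn x).le
    linarith
  have hcont : Continuous u :=
    hunif.continuous (Frequently.of_forall fun n => (lineDom_subset hR H (hvm n)).1)
  obtain ⟨h1, h2⟩ := lineDom_of_cauchy hR H hvm hcv hcont hu
  refine ⟨u, h1, h2.congr fun n => ?_⟩
  have : v n - u = (s n - u) - fun _ => s n x₀ := by
    ext x; simp only [hv, Pi.sub_apply]; ring
  rw [this, lineEnergy_sub_const hR H (hB.sub_mem (hs n) h1)]

/-- Truncation is a contraction of the line and decreases each Dirichlet integral and each squared
difference separately. -/
theorem lineDom_truncate {u : K p α → ℝ} (hu : u ∈ lineDom p α R) :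
    FormPair.truncate u ∈ lineDom p α R ∧
      lineEnergy p α R (FormPair.truncate u) (FormPair.truncate u) ≤ lineEnergy p α R u u := by
  have hu' := hu
  rw [mem_lineDom_iff hR H] at hu
  obtain ⟨⟨hc, hb⟩, hs, h0⟩ := hu
  have hb' : ∀ w i, MemH1 (onBond p α (FormPair.truncate u) w i) ∧
      dirichlet (onBond p α (FormPair.truncate u) w i) (onBond p α (FormPair.truncate u) w i) ≤
        dirichlet (onBond p α u w i) (onBond p α u w i) := fun w i =>
    (hb w i).comp_contraction fun s t => abs_truncate_sub_le _ _
  have hF : FormPair.truncate u ∈ FTilde p α :=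
    ⟨continuous_const.max (hc.min continuous_const), fun w i => (hb' w i).1⟩
  have hD : ∀ k, 1 / gamma R k * DI p α k (FormPair.truncate u) (FormPair.truncate u) ≤
      1 / gamma R k * DI p α k u u := fun k =>
    mul_le_mul_of_nonneg_left (Finset.sum_le_sum fun w _ => Finset.sum_le_sum fun i _ =>
      (hb' _ i).2) (one_div_pos.2 (gamma_pos hR k)).le
  have hQ : ∀ k, 1 / delta R k * QSigma p α k (FormPair.truncate u) (FormPair.truncate u) ≤
      1 / delta R k * QSigma p α k u u := fun k =>
    mul_le_mul_of_nonneg_left (Finset.sum_le_sum fun w _ => Finset.sum_le_sum fun i _ => by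
      rw [← abs_mul_abs_self (u _ - u _), ← abs_mul_abs_self (FormPair.truncate u _ - _)]
      exact mul_self_le_mul_self (abs_nonneg _) (abs_truncate_sub_le _ _))
      (one_div_pos.2 (delta_pos hR k)).le
  have hmem : FormPair.truncate u ∈ lineDom p α R := by
    rw [mem_lineDom_iff hR H]
    exact ⟨hF, Summable.of_nonneg_of_le (lineTerm_nonneg hR hF) hD hs,
      squeeze_zero (sgTerm_nonneg hR hF) hQ h0⟩
  exact ⟨hmem, (summable_lineTerm hR H hmem hmem).tsum_le_tsum hD
    (summable_lineTerm hR H hu' hu')⟩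

theorem isResistanceForm_lineForm : (lineForm p α R).IsResistanceForm where
  const_mem := lineDom_const hR H
  add_mem := (isBilin_lineEnergy hR H).add_mem
  smul_mem := (isBilin_lineEnergy hR H).smul_mem
  add_left := (isBilin_lineEnergy hR H).add_left
  smul_left := (isBilin_lineEnergy hR H).smul_left
  symm := (isBilin_lineEnergy hR H).symm
  nonneg := (isBilin_lineEnergy hR H).nonneg
  eq_zero_iff u hu := lineEnergy_eq_zero_iff hR H hu
  complete s hs hc := lineDom_complete hR H hs hc
  separates x y hxy := lineDom_separates H hR hxy
  bounded x y := by
    refine ⟨144, ?_⟩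
    rintro _ ⟨u, hu, hpos, rfl⟩
    rw [div_le_iff₀ hpos, sq_abs]
    exact sq_sub_le_lineEnergy H hR hu x y
  markov u hu := lineDom_truncate hR H hu

end

/-! ## Harmonic functions of resistance forms -/

theorem IsBilin.cauchy_schwarz {X : Type*} {S : Set (X → ℝ)} {B : (X → ℝ) → (X → ℝ) → ℝ}
    (h : IsBilin S B) {u v : X → ℝ} (hu : u ∈ S) (hv : v ∈ S) :
    (B u v) ^ 2 ≤ B u u * B v v := by
  have key : ∀ t : ℝ, 0 ≤ B v v * (t * t) + 2 * B u v * t + B u u := fun t => by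
    have h1 := h.nonneg _ (h.add_mem u hu _ (h.smul_mem t v hv))
    rw [h.add_self hu (h.smul_mem t v hv), h.smul_right t hu hv,
      h.smul_left t v hv _ (h.smul_mem t v hv), h.smul_right t hv hv] at h1
    linarith
  have := discrim_le_zero key
  rw [discrim] at this
  linarith

theorem IsBilin.tendsto_self {X : Type*} {S : Set (X → ℝ)} {B : (X → ℝ) → (X → ℝ) → ℝ}
    (h : IsBilin S B) {s : ℕ → X → ℝ} {u : X → ℝ} (hs : ∀ n, s n ∈ S) (hu : u ∈ S)
    (hl : Tendsto (fun n => B (s n - u) (s n - u)) atTop (𝓝 0)) :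
    Tendsto (fun n => B (s n) (s n)) atTop (𝓝 (B u u)) := by
  have h1 : Tendsto (fun n => B (s n - u) u) atTop (𝓝 0) := by
    have h2 : Tendsto (fun n => √(B (s n - u) (s n - u) * B u u)) atTop (𝓝 0) := by
      have := (hl.mul_const (B u u)).sqrt
      simpa using this
    exact squeeze_zero_norm (fun n => Real.abs_le_sqrt
      (h.cauchy_schwarz (h.sub_mem (hs n) hu) hu)) h2
  have h3 := (hl.add (h1.const_mul 2)).add_const (B u u)
  simp only [mul_zero, add_zero, zero_add] at h3
  refine h3.congr fun n => ?_
  have := h.add_self (h.sub_mem (hs n) hu) hu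
  rw [sub_add_cancel] at this
  exact this.symm

namespace FormPair

variable {X : Type*} {A : FormPair X}

theorem IsResistanceForm.sq_sub_le (hA : A.IsResistanceForm) {u : X → ℝ} (hu : u ∈ A.dom)
    (x y : X) : (u x - u y) ^ 2 ≤ A.resistance x y * A.form u u := by
  rcases (hA.nonneg u hu).eq_or_lt with h | h
  · obtain ⟨c, rfl⟩ := (hA.eq_zero_iff u hu).1 h.symm
    rw [← h]; simp
  · rw [← div_le_iff₀ h, ← sq_abs]
    exact le_csSup (hA.bounded x y) ⟨u, hu, h, rfl⟩

theorem IsResistanceForm.form_const_left (hA : A.IsResistanceForm) (c : ℝ) {u : X → ℝ}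
    (hu : u ∈ A.dom) : A.form (fun _ => c) u = 0 := by
  have h := (isBilin_of_isResistanceForm hA).cauchy_schwarz (hA.const_mem c) hu
  rw [(hA.eq_zero_iff _ (hA.const_mem c)).2 ⟨c, rfl⟩, zero_mul] at h
  exact pow_eq_zero_iff two_ne_zero |>.1 (le_antisymm h (sq_nonneg _))

theorem IsResistanceForm.form_add_const (hA : A.IsResistanceForm) (c : ℝ) {u : X → ℝ}
    (hu : u ∈ A.dom) : A.form (u + fun _ => c) (u + fun _ => c) = A.form u u := by
  have hB := isBilin_of_isResistanceForm hA
  have hc := hA.const_mem c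
  rw [hB.add_self hu hc, hB.symm u hu _ hc, hA.form_const_left c hu, hA.form_const_left c hc]
  ring

/-- Energy minimisers are orthogonal to functions vanishing on the prescribed set. -/
theorem IsHarmonic.form_eq_zero (hA : A.IsResistanceForm) {Y : Set X} {u w : X → ℝ}
    (hu : A.IsHarmonic Y u) (hw : w ∈ A.dom) (h0 : ∀ y ∈ Y, w y = 0) : A.form u w = 0 := by
  have hB := isBilin_of_isResistanceForm hA
  -- Competing with `u + t w` gives a nonnegative quadratic in `t` without constant term; its linear
  -- coefficient must vanish.
  have key : ∀ t : ℝ, 0 ≤ A.form w w * (t * t) + 2 * A.form u w * t + 0 := fun t => by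
    have h1 := hu.2 _ (hB.add_mem u hu.1 _ (hB.smul_mem t w hw)) fun y hy => by simp [h0 y hy]
    rw [hB.add_self hu.1 (hB.smul_mem t w hw), hB.smul_right t hu.1 hw,
      hB.smul_left t w hw _ (hB.smul_mem t w hw), hB.smul_right t hw hw] at h1
    linarith
  have := discrim_le_zero key
  rw [discrim] at this
  have h2 : (A.form u w) ^ 2 ≤ 0 := by linarith
  exact pow_eq_zero_iff two_ne_zero |>.1 (le_antisymm h2 (sq_nonneg _))

theorem IsHarmonic.form_congr (hA : A.IsResistanceForm) {Y : Set X} {u v w : X → ℝ}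
    (hu : A.IsHarmonic Y u) (hv : v ∈ A.dom) (hw : w ∈ A.dom) (h : EqOn v w Y) :
    A.form u v = A.form u w := by
  have hB := isBilin_of_isResistanceForm hA
  rw [← sub_eq_zero, ← hB.sub_right hu.1 hv hw]
  exact hu.form_eq_zero hA (hB.sub_mem hv hw) fun y hy => by simp [h hy]

theorem isHarmonic_of_orthogonal (hA : A.IsResistanceForm) {Y : Set X} {u : X → ℝ}
    (hu : u ∈ A.dom) (h : ∀ w ∈ A.dom, (∀ y ∈ Y, w y = 0) → A.form u w = 0) :
    A.IsHarmonic Y u := by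
  have hB := isBilin_of_isResistanceForm hA
  refine ⟨hu, fun v hv hvu => ?_⟩
  have h1 := h (v - u) (hB.sub_mem hv hu) fun y hy => by simp [hvu hy]
  have h2 := hB.add_self hu (hB.sub_mem hv hu)
  rw [add_sub_cancel, h1] at h2
  linarith [hB.nonneg _ (hB.sub_mem hv hu)]

/-- Existence of harmonic extensions. -/
theorem IsResistanceForm.exists_isHarmonic (hA : A.IsResistanceForm) {Y : Set X} (hY : Y.Nonempty)
    {u₀ : X → ℝ} (hu₀ : u₀ ∈ A.dom) : ∃ u, A.IsHarmonic Y u ∧ EqOn u u₀ Y := by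
  have hB := isBilin_of_isResistanceForm hA
  obtain ⟨y₀, hy₀⟩ := hY
  set S : Set ℝ := {t | ∃ v ∈ A.dom, EqOn v u₀ Y ∧ A.form v v = t} with hS
  have hbdd : BddBelow S := ⟨0, by rintro _ ⟨v, hv, -, rfl⟩; exact hB.nonneg v hv⟩
  have hne : S.Nonempty := ⟨_, u₀, hu₀, fun _ _ => rfl, rfl⟩
  set M := sInf S with hM
  have hMle : ∀ v ∈ A.dom, EqOn v u₀ Y → M ≤ A.form v v := fun v hv h =>
    csInf_le hbdd ⟨v, hv, h, rfl⟩
  have hseq : ∀ n : ℕ, ∃ v ∈ A.dom, EqOn v u₀ Y ∧ A.form v v < M + 1 / ((n : ℝ) + 1) := by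
    intro n
    obtain ⟨_, ⟨v, hv, h, rfl⟩, hlt⟩ := exists_lt_of_csInf_lt hne
      (lt_add_of_pos_right M (Nat.one_div_pos_of_nat (n := n)))
    exact ⟨v, hv, h, hlt⟩
  choose v hv hvY hvlt using hseq
  have hcauchy : ∀ ε > 0, ∃ N, ∀ m ≥ N, ∀ n ≥ N, A.form (v m - v n) (v m - v n) < ε := by
    intro ε hε
    obtain ⟨N, hN⟩ := exists_nat_one_div_lt (show 0 < ε / 4 by positivity)
    refine ⟨N, fun m hm n hn => ?_⟩
    have hb : ∀ m ≥ N, A.form (v m) (v m) < M + ε / 4 := fun m hm => by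
      have : 1 / ((m : ℝ) + 1) ≤ 1 / ((N : ℝ) + 1) := Nat.one_div_le_one_div hm
      linarith [hvlt m]
    -- The midpoint has the prescribed values too, so its energy is at least `M`; the parallelogram
    -- law then makes `v m - v n` small.
    have h1 := hMle ((1 / 2 : ℝ) • (v m + v n)) (hB.smul_mem _ _ (hB.add_mem _ (hv m) _ (hv n)))
      fun y hy => by simp [hvY m hy, hvY n hy]; ring
    have hadd := hB.add_mem _ (hv m) _ (hv n)
    rw [hB.smul_left _ _ hadd _ (hB.smul_mem _ _ hadd), hB.smul_right _ hadd hadd,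
      hB.add_self (hv m) (hv n)] at h1
    rw [hB.sub_self (hv m) (hv n)]
    linarith [hb m hm, hb n hn]
  obtain ⟨u, hu, hlim⟩ := hA.complete v hv hcauchy
  -- Completeness yields a limit modulo constants only. The constant is chosen to be right at `y₀`,
  -- and the resistance estimate settles the rest of `Y`.
  set c := u₀ y₀ - u y₀ with hc
  have hform : A.form (u + fun _ => c) (u + fun _ => c) = M := by
    rw [hA.form_add_const c hu]
    refine tendsto_nhds_unique (hB.tendsto_self hv hu hlim) ?_
    refine tendsto_of_tendsto_of_tendsto_of_le_of_le tendsto_const_nhds ?_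
      (fun n => hMle (v n) (hv n) (hvY n)) fun n => (hvlt n).le
    simpa using tendsto_one_div_add_atTop_nhds_zero_nat.const_add M
  have heq : EqOn (u + fun _ => c) u₀ Y := by
    intro y hy
    have h1 : Tendsto (fun n => A.resistance y y₀ * A.form (v n - u) (v n - u)) atTop (𝓝 0) := by
      simpa using hlim.const_mul (A.resistance y y₀)
    have h2 : ((u₀ y - u y) - (u₀ y₀ - u y₀)) ^ 2 ≤ 0 := by
      refine ge_of_tendsto' h1 fun n => ?_
      have := hA.sq_sub_le (hB.sub_mem (hv n) hu) y y₀
      simp only [Pi.sub_apply, hvY n hy, hvY n hy₀] at this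
      exact this
    have h3 := pow_eq_zero_iff two_ne_zero |>.1 (le_antisymm h2 (sq_nonneg _))
    simp only [Pi.add_apply, hc]
    linarith
  refine ⟨_, ⟨hB.add_mem u hu _ (hA.const_mem c), fun w hw hwu => ?_⟩, heq⟩
  rw [hform]
  exact hMle w hw (hwu.trans heq)

theorem harmonicExt_spec (hA : A.IsResistanceForm) {Y : Set X} (hY : Y.Nonempty) {f : Y → ℝ}
    {u₀ : X → ℝ} (hu₀ : u₀ ∈ A.dom) (hf : ∀ y : Y, u₀ y = f y) :
    A.IsHarmonic Y (A.harmonicExt Y f) ∧ ∀ y : Y, A.harmonicExt Y f y = f y := by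
  obtain ⟨u, hu, hY⟩ := hA.exists_isHarmonic hY hu₀
  have hex : ∃ u, A.IsHarmonic Y u ∧ Y.domRestrict u = f :=
    ⟨u, hu, funext fun y => (hY y.2).trans (hf y)⟩
  rw [harmonicExt, dif_pos hex]
  exact ⟨hex.choose_spec.1, fun y => congrFun hex.choose_spec.2 y⟩

end FormPair

/-! ## Invariance under symmetries -/

/-- Even permutations keep the cyclic order and odd ones reverse it, so a symmetry preserves the
orientation of all bonds or reverses all of them. -/
theorem perm_fin3_cases (s : Equiv.Perm (Fin 3)) :
    (∀ i, s (i + 1) = s i + 1) ∨ ∀ i, s i = s (i + 1) + 1 := by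
  revert s; decide

namespace IsSymmetry

variable {s : Equiv.Perm (Fin 3)} {Φ : K p α → K p α} (hΦ : IsSymmetry p α s Φ)
include hΦ

theorem comp_comp_GK (u : K p α → ℝ) (i : Fin 3) :
    (u ∘ Φ) ∘ GK p α i = (u ∘ GK p α (s i)) ∘ Φ := by
  rw [Function.comp_assoc, hΦ.comp_GK, Function.comp_assoc]

theorem onBond_pos (h : ∀ i, s (i + 1) = s i + 1) (u : K p α → ℝ) (i : Fin 3) :
    onBond p α (u ∘ Φ) [] i = onBond p α u [] (s i) :=
  funext fun t => congrArg u (hΦ.bond_pos i t (h i))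

theorem onBond_neg (h : ∀ i, s i = s (i + 1) + 1) (u : K p α → ℝ) (i : Fin 3) :
    onBond p α (u ∘ Φ) [] i = onBond p α u [] (s (i + 1)) ∘ σ :=
  funext fun t => congrArg u (hΦ.bond_neg i t (h i))

theorem comp_mem_FTilde (H : Standard p α) {u : K p α → ℝ} (hu : u ∈ FTilde p α) :
    u ∘ Φ ∈ FTilde p α := by
  refine ⟨hu.1.comp hΦ.continuous, fun w i => ?_⟩
  induction w generalizing u with
  | nil =>
    rcases perm_fin3_cases s with h | h
    · rw [hΦ.onBond_pos h]; exact hu.2 _ _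
    · rw [hΦ.onBond_neg h]; exact (hu.2 _ _).symm
  | cons j w ih =>
    change MemH1 (onBond p α ((u ∘ Φ) ∘ GK p α j) w i)
    rw [hΦ.comp_comp_GK]
    exact ih (((H.mem_FTilde_iff u).1 hu).1 _)

theorem DI_comp (H : Standard p α) (k : ℕ) {u : K p α → ℝ} (hu : u ∈ FTilde p α) :
    DI p α k (u ∘ Φ) (u ∘ Φ) = DI p α k u u := by
  induction k generalizing u with
  | zero =>
    rw [DI_zero, DI_zero]
    rcases perm_fin3_cases s with h | h
    · simp only [hΦ.onBond_pos h]
      exact Equiv.sum_comp s fun i => dirichlet (onBond p α u [] i) (onBond p α u [] i)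
    · simp only [hΦ.onBond_neg h, dirichlet_symm (hu.2 _ _) (hu.2 _ _)]
      exact Equiv.sum_comp ((Equiv.addRight 1).trans s)
        fun i => dirichlet (onBond p α u [] i) (onBond p α u [] i)
  | succ k ih =>
    rw [DI_succ, DI_succ]
    simp only [hΦ.comp_comp_GK]
    rw [← Equiv.sum_comp s fun i => DI p α k (u ∘ GK p α i) (u ∘ GK p α i)]
    exact Finset.sum_congr rfl fun i _ => ih (((H.mem_FTilde_iff u).1 hu).1 _)

theorem QSigma_comp (k : ℕ) (u : K p α → ℝ) :
    QSigma p α k (u ∘ Φ) (u ∘ Φ) = QSigma p α k u u := by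
  induction k generalizing u with
  | zero =>
    rw [QSigma_zero, QSigma_zero]
    simp only [Q0, Function.comp_apply, hΦ.vertex]
    rcases perm_fin3_cases s with h | h
    · simp only [h]
      exact Equiv.sum_comp s fun i => (u (SSG.vertex p α i) - u (SSG.vertex p α (i + 1))) *
        (u (SSG.vertex p α i) - u (SSG.vertex p α (i + 1)))
    · rw [← Equiv.sum_comp ((Equiv.addRight 1).trans s) fun i =>
        (u (SSG.vertex p α i) - u (SSG.vertex p α (i + 1))) *
          (u (SSG.vertex p α i) - u (SSG.vertex p α (i + 1)))]
      refine Finset.sum_congr rfl fun i _ => ?_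
      rw [h i]
      simp only [Equiv.trans_apply, Equiv.coe_addRight]
      ring
  | succ k ih =>
    rw [QSigma_succ, QSigma_succ]
    simp only [hΦ.comp_comp_GK, ih]
    exact Equiv.sum_comp s fun i => QSigma p α k (u ∘ GK p α i) (u ∘ GK p α i)

theorem comp_mem_lineDom (H : Standard p α) (hR : R ∈ MPSeq) {u : K p α → ℝ}
    (hu : u ∈ lineDom p α R) : u ∘ Φ ∈ lineDom p α R := by
  rw [mem_lineDom_iff hR H] at hu ⊢
  refine ⟨hΦ.comp_mem_FTilde H hu.1, ?_, ?_⟩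
  · simpa only [hΦ.DI_comp H _ hu.1] using hu.2.1
  · simpa only [hΦ.QSigma_comp] using hu.2.2

theorem lineEnergy_comp (H : Standard p α) (hR : R ∈ MPSeq) {u : K p α → ℝ}
    (hu : u ∈ lineDom p α R) :
    lineEnergy p α R (u ∘ Φ) (u ∘ Φ) = lineEnergy p α R u u := by
  simp only [lineEnergy, hΦ.DI_comp H _ (lineDom_subset hR H hu)]

end IsSymmetry

/-! ## The trace on the vertices -/

theorem Q0_eq (a b : Fin 3 → ℝ) : Q0 a b =
    2 * (a 0 * b 0 + a 1 * b 1 + a 2 * b 2) - (a 0 * b 1 + a 1 * b 0) - (a 0 * b 2 + a 2 * b 0)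
      - (a 1 * b 2 + a 2 * b 1) := by
  have e1 : (1 : Fin 3) + 1 = 2 := rfl
  have e2 : (2 : Fin 3) + 1 = 0 := rfl
  simp only [Q0, Fin.sum_univ_three, zero_add, e1, e2]
  ring

/-- The set of vertices. -/
abbrev vertices (p : Fin 3 → Plane) (α : ℝ) : Set (K p α) := range (vertex p α)

theorem vertices_nonempty : (vertices p α).Nonempty := ⟨_, 0, rfl⟩

section

variable (hR : R ∈ MPSeq) (H : Standard p α)
include hR H

theorem exists_lineDom_vertex (a : Fin 3 → ℝ) : ∃ u ∈ lineDom p α R, ∀ i, u (vertex p α i) = a i := by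
  obtain ⟨u, hu, h, -⟩ := exists_lineDom_const_cells hR H a
  exact ⟨u, hu, fun i => by rw [← GK_vertex, h]⟩

theorem exists_isHarmonic_vertex (a : Fin 3 → ℝ) :
    ∃ u, (lineForm p α R).IsHarmonic (vertices p α) u ∧ ∀ i, u (vertex p α i) = a i := by
  obtain ⟨u₀, hu₀, h⟩ := exists_lineDom_vertex hR H a
  obtain ⟨u, hu, hY⟩ := (isResistanceForm_lineForm hR H).exists_isHarmonic vertices_nonempty hu₀
  exact ⟨u, hu, fun i => (hY ⟨i, rfl⟩).trans (h i)⟩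

omit hR in
theorem exists_rotation_symmetry :
    ∃ (s : Equiv.Perm (Fin 3)) (Φ : K p α → K p α), IsSymmetry p α s Φ ∧ ∀ i, s i = i + 1 := by
  obtain ⟨φ, h1, h2⟩ := H.exists_rotation
  exact ⟨Equiv.addRight 1, _, isSymmetry_of_linear φ (Equiv.addRight 1) h2
    (mapsTo_iff_image_subset.2 h1.subset), fun i => rfl⟩

/-- The energies of the harmonic functions with vertex values `0` and `1` form a symmetric 3 × 3
matrix. Its rows sum to zero because constants have no energy, and its diagonal is constant by
rotation. Hence the entries off the diagonal are `-d/2`, and the trace is `d/2` times `Q_0^Σ`. -/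
theorem exists_harmonic_constant : ∃ r : ℝ, 0 < r ∧
    ∀ u, (lineForm p α R).IsHarmonic (vertices p α) u → ∀ w ∈ lineDom p α R,
      lineEnergy p α R u w =
        1 / r * Q0 (fun i => u (vertex p α i)) (fun i => w (vertex p α i)) := by
  have hA := isResistanceForm_lineForm hR H
  have hB := isBilin_lineEnergy hR H
  have hcongr : ∀ {u v w : K p α → ℝ}, (lineForm p α R).IsHarmonic (vertices p α) u →
      v ∈ lineDom p α R → w ∈ lineDom p α R →
      (∀ i, v (vertex p α i) = w (vertex p α i)) → lineEnergy p α R u v = lineEnergy p α R u w :=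
    fun hu hv hw h => hu.form_congr hA hv hw (by rintro _ ⟨i, rfl⟩; exact h i)
  have hex : ∀ i : Fin 3, ∃ u, (lineForm p α R).IsHarmonic (vertices p α) u ∧
      ∀ j, u (vertex p α j) = if j = i then 1 else 0 := fun i =>
    exists_isHarmonic_vertex hR H fun j => if j = i then 1 else 0
  choose h hh hv using hex
  have hm : ∀ i, h i ∈ lineDom p α R := fun i => (hh i).1
  obtain ⟨s, Φ, hΦ, hs⟩ := exists_rotation_symmetry H
  -- The rotated `h (i + 1)` competes with `h i`. Around the cycle of length three these
  -- inequalities become equalities.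
  have hrot : ∀ i, lineEnergy p α R (h i) (h i) ≤ lineEnergy p α R (h (i + 1)) (h (i + 1)) := by
    intro i
    rw [← hΦ.lineEnergy_comp H hR (hm (i + 1))]
    refine (hh i).2 _ (hΦ.comp_mem_lineDom H hR (hm (i + 1))) ?_
    rintro _ ⟨j, rfl⟩
    simp only [Function.comp_apply, hΦ.vertex, hs, hv]
    simp
  have hr0 := hrot 0
  have hr1 := hrot 1
  have hr2 := hrot 2
  rw [show (0 : Fin 3) + 1 = 1 from rfl] at hr0
  rw [show (1 : Fin 3) + 1 = 2 from rfl] at hr1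
  rw [show (2 : Fin 3) + 1 = 0 from rfl] at hr2
  have hcomb : ∀ b : Fin 3 → ℝ, b 0 • h 0 + b 1 • h 1 + b 2 • h 2 ∈ lineDom p α R := fun b =>
    hB.add_mem _ (hB.add_mem _ (hB.smul_mem _ _ (hm 0)) _ (hB.smul_mem _ _ (hm 1))) _
      (hB.smul_mem _ _ (hm 2))
  have hcombv : ∀ b : Fin 3 → ℝ, ∀ i,
      (b 0 • h 0 + b 1 • h 1 + b 2 • h 2) (vertex p α i) = b i := fun b i => by
    simp only [Pi.add_apply, Pi.smul_apply, hv, smul_eq_mul]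
    fin_cases i <;> simp
  have hE : ∀ {u : K p α → ℝ}, (lineForm p α R).IsHarmonic (vertices p α) u →
      ∀ b : Fin 3 → ℝ, ∀ w ∈ lineDom p α R, (∀ i, w (vertex p α i) = b i) →
      lineEnergy p α R u w = b 0 * lineEnergy p α R u (h 0) + b 1 * lineEnergy p α R u (h 1) +
        b 2 * lineEnergy p α R u (h 2) := by
    intro u hu b w hw hwb
    rw [hcongr hu hw (hcomb b) fun i => by rw [hwb, hcombv],
      hB.add_right hu.1 (hB.add_mem _ (hB.smul_mem _ _ (hm 0)) _ (hB.smul_mem _ _ (hm 1)))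
        (hB.smul_mem _ _ (hm 2)), hB.add_right hu.1 (hB.smul_mem _ _ (hm 0))
        (hB.smul_mem _ _ (hm 1)), hB.smul_right _ hu.1 (hm 0), hB.smul_right _ hu.1 (hm 1),
      hB.smul_right _ hu.1 (hm 2)]
  have hone : ∀ i, lineEnergy p α R (h i) (h 0) + lineEnergy p α R (h i) (h 1) +
      lineEnergy p α R (h i) (h 2) = 0 := fun i => by
    have h1 := hE (hh i) (fun _ => 1) (fun _ => 1) (lineDom_const hR H 1) fun _ => rfl
    rw [hB.symm _ (hm i) _ (lineDom_const hR H 1), lineEnergy_const_left hR H 1 (hm i)] at h1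
    linarith
  have o0 := hone 0
  have o1 := hone 1
  have o2 := hone 2
  rw [hB.symm _ (hm 1) _ (hm 0)] at o1
  rw [hB.symm _ (hm 2) _ (hm 0), hB.symm _ (hm 2) _ (hm 1)] at o2
  set d := lineEnergy p α R (h 0) (h 0) with hd
  have d1 : lineEnergy p α R (h 1) (h 1) = d := by linarith
  have d2 : lineEnergy p α R (h 2) (h 2) = d := by linarith
  have t01 : lineEnergy p α R (h 0) (h 1) = -(d / 2) := by linarith
  have t02 : lineEnergy p α R (h 0) (h 2) = -(d / 2) := by linarith
  have t12 : lineEnergy p α R (h 1) (h 2) = -(d / 2) := by linarith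
  have hdpos : 0 < d := by
    refine lt_of_le_of_ne (hB.nonneg _ (hm 0)) fun hd0 => ?_
    obtain ⟨c, hc⟩ := (lineEnergy_eq_zero_iff hR H (hm 0)).1 hd0.symm
    have a0 := hv 0 0
    have a1 := hv 0 1
    rw [hc] at a0 a1
    simp at a0 a1
    linarith
  refine ⟨2 / d, by positivity, fun u hu w hw => ?_⟩
  rw [hE hu (fun i => w (vertex p α i)) w hw fun _ => rfl]
  have hu' : ∀ j, lineEnergy p α R u (h j) = u (vertex p α 0) * lineEnergy p α R (h j) (h 0) +
      u (vertex p α 1) * lineEnergy p α R (h j) (h 1) +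
      u (vertex p α 2) * lineEnergy p α R (h j) (h 2) := fun j => by
    rw [hB.symm u hu.1 _ (hm j)]
    exact hE (hh j) (fun i => u (vertex p α i)) u hu.1 fun _ => rfl
  rw [hu', hu', hu', hB.symm _ (hm 1) _ (hm 0), hB.symm _ (hm 2) _ (hm 0),
    hB.symm _ (hm 2) _ (hm 1), d1, d2, t01, t02, t12, ← hd, Q0_eq, one_div_div]
  ring

theorem lineForm_harmonicExt_spec (f : vertices p α → ℝ) :
    (lineForm p α R).IsHarmonic (vertices p α) ((lineForm p α R).harmonicExt (vertices p α) f) ∧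
      ∀ i, (lineForm p α R).harmonicExt (vertices p α) f (vertex p α i) =
        f ⟨vertex p α i, mem_range_self i⟩ := by
  obtain ⟨u, hu, h⟩ := exists_lineDom_vertex hR H fun i => f ⟨vertex p α i, mem_range_self i⟩
  obtain ⟨h1, h2⟩ := FormPair.harmonicExt_spec (isResistanceForm_lineForm hR H) vertices_nonempty
    (f := f) hu (by rintro ⟨_, i, rfl⟩; exact h i)
  exact ⟨h1, fun i => h2 ⟨_, i, rfl⟩⟩

theorem isTraceConstant_r0 : IsTraceConstant p α (lineForm p α R) (r0 p α (lineForm p α R)) := by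
  obtain ⟨r, hr, h⟩ := exists_harmonic_constant hR H
  refine Classical.epsilon_spec (p := IsTraceConstant p α (lineForm p α R)) ⟨r, hr, fun f g => ?_⟩
  obtain ⟨f1, f2⟩ := lineForm_harmonicExt_spec hR H f
  obtain ⟨g1, g2⟩ := lineForm_harmonicExt_spec hR H g
  have := h _ f1 _ g1.1
  simp only [f2, g2] at this
  exact this

/-- The constant of the trace of the line form on the vertices. -/
abbrev lineConst (p : Fin 3 → Plane) (α : ℝ) (R : ℕ → ℝ × ℝ) : ℝ := r0 p α (lineForm p α R)

theorem lineConst_pos : 0 < lineConst p α R := (isTraceConstant_r0 hR H).1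

/-- Against a harmonic function only the vertex values of the other argument count. Both arguments
may thus be exchanged for the harmonic extensions in the definition of the trace. -/
theorem lineEnergy_of_isHarmonic {u : K p α → ℝ}
    (hu : (lineForm p α R).IsHarmonic (vertices p α) u) {w : K p α → ℝ} (hw : w ∈ lineDom p α R) :
    lineEnergy p α R u w = 1 / lineConst p α R *
      Q0 (fun i => u (vertex p α i)) (fun i => w (vertex p α i)) := by
  have hA := isResistanceForm_lineForm hR H
  have hB := isBilin_lineEnergy hR H
  set f : vertices p α → ℝ := fun y => u y
  set g : vertices p α → ℝ := fun y => w y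
  obtain ⟨f1, f2⟩ := lineForm_harmonicExt_spec hR H f
  obtain ⟨g1, g2⟩ := lineForm_harmonicExt_spec hR H g
  have e1 : lineEnergy p α R u w = lineEnergy p α R u
      ((lineForm p α R).harmonicExt (vertices p α) g) :=
    hu.form_congr hA hw g1.1 (by rintro _ ⟨i, rfl⟩; exact (g2 i).symm)
  have e2 : lineEnergy p α R ((lineForm p α R).harmonicExt (vertices p α) g) u =
      lineEnergy p α R ((lineForm p α R).harmonicExt (vertices p α) g)
        ((lineForm p α R).harmonicExt (vertices p α) f) :=
    g1.form_congr hA hu.1 f1.1 (by rintro _ ⟨i, rfl⟩; exact (f2 i).symm)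
  rw [e1, hB.symm _ hu.1 _ g1.1, e2, hB.symm _ g1.1 _ f1.1]
  exact (isTraceConstant_r0 hR H).2 f g

/-- The line energy dominates `Q_0^Σ`; one harmonic function with nonconstant vertex values is
enough to compare the two multiples. -/
theorem lineConst_le_one : lineConst p α R ≤ 1 := by
  obtain ⟨u, hu, hv⟩ := exists_isHarmonic_vertex hR H fun i => if i = 0 then 1 else 0
  have h1 := lineEnergy_of_isHarmonic hR H hu hu.1
  have h2 := Q0_le_lineEnergy hR H hu.1
  have h3 : Q0 (fun i => u (vertex p α i)) (fun i => u (vertex p α i)) = 2 := by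
    rw [Q0_eq, hv, hv, hv]; simp
  rw [h1, h3] at h2
  have hp := lineConst_pos hR H
  rw [one_div, inv_mul_eq_div, le_div_iff₀ hp] at h2
  linarith

end

/-! ## The topology of the resistance metric -/

namespace FormPair

variable {X : Type*} {A : FormPair X}

theorem resistance_le {x y : X} {c : ℝ} (hc : 0 ≤ c)
    (h : ∀ u ∈ A.dom, (u x - u y) ^ 2 ≤ c * A.form u u) : A.resistance x y ≤ c := by
  refine Real.sSup_le ?_ hc
  rintro _ ⟨u, hu, hpos, rfl⟩
  rw [div_le_iff₀ hpos, sq_abs]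
  exact h u hu

/-- If this failed, points outside `U` would tend to `x` in resistance while a subsequence converges
to some `z ∉ U`. By continuity no function of the domain could tell `x` from `z`. -/
theorem IsResistanceForm.mem_of_resistance_lt [TopologicalSpace X] [SeqCompactSpace X]
    (hA : A.IsResistanceForm) (hc : ∀ u ∈ A.dom, Continuous u) {U : Set X} (hU : IsOpen U)
    {x : X} (hx : x ∈ U) : ∃ ε > 0, ∀ y, A.resistance x y < ε → y ∈ U := by
  by_contra! hcon
  have : ∀ n : ℕ, ∃ y, A.resistance x y < 1 / ((n : ℝ) + 1) ∧ y ∉ U := fun n =>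
    hcon _ Nat.one_div_pos_of_nat
  choose y hy hyU using this
  obtain ⟨z, φ, hφ, hz⟩ := SeqCompactSpace.tendsto_subseq y
  have hzU : z ∉ U := hU.isClosed_compl.mem_of_tendsto hz (Eventually.of_forall fun n => hyU _)
  obtain ⟨u, hu, hne⟩ := hA.separates x z fun h => hzU (h ▸ hx)
  have h1 : Tendsto (fun n => (u x - u (y (φ n))) ^ 2) atTop (𝓝 ((u x - u z) ^ 2)) :=
    ((((hc u hu).tendsto z).comp hz).const_sub _).pow 2
  have h2 : Tendsto (fun n => 1 / ((φ n : ℝ) + 1) * A.form u u) atTop (𝓝 (0 * A.form u u)) :=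
    (tendsto_one_div_add_atTop_nhds_zero_nat.comp hφ.tendsto_atTop).mul_const _
  rw [zero_mul] at h2
  have h3 : (u x - u z) ^ 2 ≤ 0 := le_of_tendsto_of_tendsto' h1 h2 fun n =>
    (hA.sq_sub_le hu _ _).trans (mul_le_mul_of_nonneg_right (hy _).le (hA.nonneg u hu))
  exact hne (sub_eq_zero.1 (pow_eq_zero_iff two_ne_zero |>.1 (le_antisymm h3 (sq_nonneg _))))

open scoped Pointwise in
theorem resistance_scale {c : ℝ} (hc : 0 < c) (x y : X) :
    (A.scale c).resistance x y = c⁻¹ * A.resistance x y := by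
  have : (A.scale c).resistanceSet x y = c⁻¹ • A.resistanceSet x y := by
    ext t
    simp only [resistanceSet, mem_smul_set, mem_ofPred_eq, smul_eq_mul]
    constructor
    · rintro ⟨u, hu, hpos, rfl⟩
      refine ⟨_, ⟨u, hu, (mul_pos_iff_of_pos_left hc).1 hpos, rfl⟩, ?_⟩
      change c⁻¹ * (_ / _) = _ / (c * A.form u u)
      rw [inv_mul_eq_div, div_div, mul_comm c]
    · rintro ⟨_, ⟨u, hu, hpos, rfl⟩, rfl⟩
      refine ⟨u, hu, mul_pos hc hpos, ?_⟩
      change c⁻¹ * (_ / _) = _ / (c * A.form u u)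
      rw [inv_mul_eq_div, div_div, mul_comm c]
  rw [resistance, this, Real.sSup_smul_of_nonneg (by positivity)]
  rfl

theorem IsResistanceForm.scale (hA : A.IsResistanceForm) {c : ℝ} (hc : 0 < c) :
    (A.scale c).IsResistanceForm where
  const_mem := hA.const_mem
  add_mem := hA.add_mem
  smul_mem := hA.smul_mem
  add_left u hu v hv w hw := by
    simp only [FormPair.scale, hA.add_left u hu v hv w hw, mul_add]
  smul_left a u hu v hv := by
    simp only [FormPair.scale, hA.smul_left a u hu v hv]; ring
  symm u hu v hv := by simp only [FormPair.scale, hA.symm u hu v hv]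
  nonneg u hu := mul_nonneg hc.le (hA.nonneg u hu)
  eq_zero_iff u hu := by
    rw [← hA.eq_zero_iff u hu]
    simp [FormPair.scale, hc.ne']
  complete s hs hC := by
    obtain ⟨u, hu, hl⟩ := hA.complete s hs fun ε hε => by
      obtain ⟨N, hN⟩ := hC (c * ε) (by positivity)
      exact ⟨N, fun m hm n hn => lt_of_mul_lt_mul_left (hN m hm n hn) hc.le⟩
    refine ⟨u, hu, ?_⟩
    have h := hl.const_mul c
    rw [mul_zero] at h
    exact h
  separates := hA.separates
  bounded x y := by
    obtain ⟨M, hM⟩ := hA.bounded x y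
    refine ⟨c⁻¹ * M, ?_⟩
    rintro _ ⟨u, hu, hpos, rfl⟩
    have hpos' : 0 < A.form u u := (mul_pos_iff_of_pos_left hc).1 hpos
    have := hM ⟨u, hu, hpos', rfl⟩
    change _ / (c * A.form u u) ≤ _
    rw [mul_comm c, ← div_div, ← inv_mul_eq_div]
    exact mul_le_mul_of_nonneg_left this (by positivity)
  markov u hu := ⟨(hA.markov u hu).1, mul_le_mul_of_nonneg_left (hA.markov u hu).2 hc.le⟩

end FormPair

theorem IsRF0.scale {A : FormPair (K p α)} (hA : IsRF0 p α A) {c : ℝ} (hc : 0 < c) :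
    IsRF0 p α (A.scale c) where
  isResistanceForm := hA.isResistanceForm.scale hc
  continuous := hA.continuous
  mem_iff := hA.mem_iff
  isOpen_iff U := by
    rw [hA.isOpen_iff]
    refine forall₂_congr fun x _ => ⟨?_, ?_⟩
    · rintro ⟨ε, hε, h⟩
      refine ⟨c⁻¹ * ε, by positivity, fun y hy => h y ?_⟩
      rw [FormPair.resistance_scale hc] at hy
      exact lt_of_mul_lt_mul_left hy (by positivity)
    · rintro ⟨ε, hε, h⟩
      refine ⟨c * ε, by positivity, fun y hy => h y ?_⟩
      rwa [FormPair.resistance_scale hc, inv_mul_lt_iff₀ hc]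
  invariant φ hφ u hu :=
    ⟨(hA.invariant φ hφ u hu).1, congrArg (c * ·) (hA.invariant φ hφ u hu).2⟩

/-- Neighbourhoods in the gasket can be checked on the pieces. -/
theorem Standard.eventually_nhds (H : Standard p α) {P : K p α → Prop} {x : K p α}
    (h1 : ∀ i x', GK p α i x' = x → ∀ᶠ y in 𝓝 x', P (GK p α i y))
    (h2 : ∀ i t, bondPath p α i t = x → ∀ᶠ s in 𝓝 t, P (bondPath p α i s)) :
    ∀ᶠ y in 𝓝 x, P y := by
  have := H.compactSpace
  have hq := H.isQuotientMap_assemble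
  have hcl : IsClosedMap (assemble p α) := hq.continuous.isClosedMap
  -- All preimages of `x` lie in this open set. Since `assemble` is a closed map, the image of the
  -- complement is closed and misses `x`.
  set U := interior (assemble p α ⁻¹' {y | P y}) with hU
  have hx : x ∉ assemble p α '' Uᶜ := by
    rintro ⟨a, ha, hax⟩
    refine ha ?_
    rw [hU, mem_interior_iff_mem_nhds]
    rcases a with ⟨i, x'⟩ | ⟨i, t⟩
    · rw [nhds_inl, Sigma.nhds_mk, mem_map, mem_map]
      exact h1 i x' hax
    · rw [nhds_inr, Sigma.nhds_mk, mem_map, mem_map]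
      exact h2 i t hax
  filter_upwards [(hcl _ isOpen_interior.isClosed_compl).isOpen_compl.mem_nhds hx] with y hy
  obtain ⟨a, rfl⟩ := hq.surjective y
  have ha : a ∈ U := by
    by_contra h
    exact hy ⟨a, h, rfl⟩
  exact (interior_subset ha : a ∈ assemble p α ⁻¹' {y | P y})

section

variable (H : Standard p α)
include H

/-- Equicontinuity on sets of bounded energy. Near `x` one either descends into a cell, gaining a
factor `4/5` per level, or moves along a bond, where the Hölder estimate yields `η`. The
neighbourhood must not depend on `u`. -/
theorem eventually_abs_sub_le (n : ℕ) (hR : R ∈ MPSeq) (x : K p α) {η : ℝ} (hη : 0 < η) :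
    ∀ᶠ y in 𝓝 x, ∀ u ∈ lineDom p α R,
      |u x - u y| ≤ (12 * (4 / 5) ^ n + η) * √(lineEnergy p α R u u) := by
  induction n generalizing R x with
  | zero =>
    refine Eventually.of_forall fun y u hu => (abs_sub_le_sqrt H hR hu x y).trans ?_
    refine mul_le_mul_of_nonneg_right ?_ (Real.sqrt_nonneg _)
    simp [hη.le]
  | succ n ih =>
    refine H.eventually_nhds ?_ ?_
    · rintro i x' rfl
      filter_upwards [ih (shift_mem hR 1) x'] with y hy u hu
      refine (hy _ (comp_GK_mem hR H hu i)).trans ?_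
      refine (mul_le_mul_of_nonneg_left (sqrt_piece_le H hR hu i) (by positivity)).trans ?_
      rw [← mul_assoc]
      refine mul_le_mul_of_nonneg_right ?_ (Real.sqrt_nonneg _)
      rw [pow_succ]
      linarith
    · rintro i t rfl
      have h0 : ∀ᶠ s : I in 𝓝 t, |(t : ℝ) - s| < η ^ 2 := by
        have : Tendsto (fun s : I => |(t : ℝ) - s|) (𝓝 t) (𝓝 |(t : ℝ) - t|) :=
          (by fun_prop : Continuous fun s : I => |(t : ℝ) - s|).tendsto t
        rw [sub_self, abs_zero] at this
        exact this.eventually (gt_mem_nhds (by positivity))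
      filter_upwards [h0] with s hs u hu
      have hE := (isBilin_lineEnergy hR H).nonneg u hu
      have h1 := ((lineDom_subset hR H hu).2 [] i).sq_sub_le s t
      have h2 : (u (bondPath p α i t) - u (bondPath p α i s)) ^ 2 ≤
          (η * √(lineEnergy p α R u u)) ^ 2 := by
        rw [mul_pow, Real.sq_sqrt hE]
        exact h1.trans (mul_le_mul hs.le (dirichlet_bond_le hR H hu i)
          (dirichlet_self_nonneg _) (by positivity))
      refine (abs_le_of_sq_le_sq h2 (by positivity)).trans ?_
      refine mul_le_mul_of_nonneg_right ?_ (Real.sqrt_nonneg _)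
      have : (0 : ℝ) ≤ 12 * (4 / 5) ^ (n + 1) := by positivity
      linarith

theorem eventually_resistance_lt (hR : R ∈ MPSeq) (x : K p α) {ε : ℝ} (hε : 0 < ε) :
    ∀ᶠ y in 𝓝 x, (lineForm p α R).resistance x y < ε := by
  have hlim : Tendsto (fun n : ℕ => 12 * (4 / 5 : ℝ) ^ n) atTop (𝓝 (12 * 0)) :=
    (tendsto_pow_atTop_nhds_zero_of_lt_one (by norm_num) (by norm_num)).const_mul 12
  rw [mul_zero] at hlim
  have hsq : 0 < √ε := Real.sqrt_pos.2 hε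
  obtain ⟨n, hn⟩ := (hlim.eventually (gt_mem_nhds (show 0 < √ε / 4 by positivity))).exists
  filter_upwards [eventually_abs_sub_le H n hR x (show 0 < √ε / 4 by positivity)] with y hy
  refine (FormPair.resistance_le (c := ε / 4) (by positivity) fun u hu => ?_).trans_lt (by linarith)
  have hE := (isBilin_lineEnergy hR H).nonneg u hu
  have h1 : |u x - u y| ≤ √ε / 2 * √(lineEnergy p α R u u) :=
    (hy u hu).trans (mul_le_mul_of_nonneg_right (by linarith) (Real.sqrt_nonneg _))
  have h2 := pow_le_pow_left₀ (abs_nonneg _) h1 2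
  rw [sq_abs, mul_pow, div_pow, Real.sq_sqrt hε.le, Real.sq_sqrt hE] at h2
  norm_num at h2
  exact h2

theorem isRF0_lineForm (hR : R ∈ MPSeq) : IsRF0 p α (lineForm p α R) where
  isResistanceForm := isResistanceForm_lineForm hR H
  continuous u hu := (lineDom_subset hR H hu).1
  mem_iff u := by
    constructor
    · intro hu
      exact ⟨fun i => ⟨u, hu, fun _ _ => rfl⟩, fun i => (lineDom_subset hR H hu).2 [] i⟩
    · rintro ⟨h1, h2⟩
      refine (mem_lineDom_iff_pieces hR H u).2 ⟨fun i => ?_, h2⟩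
      obtain ⟨v, hv, huv⟩ := h1 i
      have : u ∘ GK p α i = v ∘ GK p α i := funext fun x => huv ⟨x, rfl⟩
      rw [this]
      exact comp_GK_mem hR H hv i
  isOpen_iff U := by
    have := H.compactSpace
    constructor
    · intro hU x hx
      exact (isResistanceForm_lineForm hR H).mem_of_resistance_lt
        (fun u hu => (lineDom_subset hR H hu).1) hU hx
    · intro h
      rw [isOpen_iff_mem_nhds]
      intro x hx
      obtain ⟨ε, hε, hU⟩ := h x hx
      filter_upwards [eventually_resistance_lt H hR x hε] with y hy using hU y hy
  invariant φ hφ u hu := by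
    obtain ⟨s, hs⟩ := H.exists_perm_of_image_eq φ hφ
    have hΦ := isSymmetry_of_linear φ s hs (mapsTo_iff_image_subset.2 hφ.subset)
    exact ⟨hΦ.comp_mem_lineDom H hR hu, hΦ.lineEnergy_comp H hR hu⟩

/-! ## The resolution -/

/-- The splitting of the line form of `𝓡^{(m)}`, divided by `δ_m`: then `1 / r_{m+1}` becomes `1 /
δ_{m+1}`, and `1 / ρ_{m+1}` becomes `1 / γ_{m+1}`. -/
theorem isResolution_lineForm (hR : R ∈ MPSeq) : IsResolution p α (lineForm p α R)
    (fun m => (lineForm p α (shift R m)).scale (delta R m)⁻¹) (gamma R) where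
  isRF0 m := (isRF0_lineForm H (shift_mem hR m)).scale (inv_pos.2 (delta_pos hR m))
  pos m := gamma_pos hR m
  zero := by
    refine ⟨by simp only [shift_zero]; rfl, fun u _ v _ => ?_⟩
    simp only [shift_zero, delta_zero, FormPair.scale, inv_one, one_mul]
  dom_succ m i := by
    have hRm := shift_mem hR m
    have e : shift R (m + 1) = shift (shift R m) 1 := (shift_shift m 1).symm
    change lineDom p α (shift R (m + 1)) = {f | ∃ u ∈ lineDom p α (shift R m), f = u ∘ GK p α i}
    rw [e]
    ext f
    constructor
    · intro hf
      obtain ⟨u, hu, rfl⟩ := exists_lineDom_cell hRm H f hf i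
      exact ⟨u, hu, rfl⟩
    · rintro ⟨u, hu, rfl⟩
      exact comp_GK_mem hRm H hu i
  form_eq m u hu v hv := by
    have hRm := shift_mem hR m
    have e : shift R (m + 1) = shift (shift R m) 1 := (shift_shift m 1).symm
    have e0 : shift R m 0 = R m := rfl
    change (delta R m)⁻¹ * lineEnergy p α (shift R m) u v = ∑ i, (delta R (m + 1))⁻¹ *
      lineEnergy p α (shift R (m + 1)) (u ∘ GK p α i) (v ∘ GK p α i) + _
    rw [lineEnergy_succ hRm H hu hv, e, e0, delta_succ, gamma, ← Finset.mul_sum, mul_add,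
      ← mul_assoc, ← mul_assoc]
    simp only [one_div, mul_inv]

end

/-! ### Uniqueness of resolutions -/

/-- The properties of resolutions that make them unique. -/
structure IsDecomposition (B : ℕ → FormPair (K p α)) (η : ℕ → ℝ) : Prop where
  const_mem : ∀ m (c : ℝ), (fun _ => c) ∈ (B m).dom
  form_const : ∀ m (c : ℝ), (B m).form (fun _ => c) (fun _ => c) = 0
  comp_mem : ∀ m i, ∀ u ∈ (B m).dom, u ∘ GK p α i ∈ (B (m + 1)).dom
  glue : ∀ m u, (∀ i, u ∘ GK p α i ∈ (B (m + 1)).dom) → (∀ i, MemH1 (onBond p α u [] i)) →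
    u ∈ (B m).dom
  form_eq : ∀ m, ∀ u ∈ (B m).dom, ∀ v ∈ (B m).dom, (B m).form u v =
    ∑ i, (B (m + 1)).form (u ∘ GK p α i) (v ∘ GK p α i) + 1 / η m * DI p α 0 u v

/-- The forms `𝓔_{𝓡'}` have these weaker properties too (`isDecomposition_fullForm`), so one
uniqueness argument serves both for resolutions and for the sequence `𝓡'`. -/
theorem IsResolution.isDecomposition {A : FormPair (K p α)} {B : ℕ → FormPair (K p α)}
    {η : ℕ → ℝ} (h : IsResolution p α A B η) : IsDecomposition B η where
  const_mem m c := (h.isRF0 m).isResistanceForm.const_mem c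
  form_const m c := (h.isRF0 m).isResistanceForm.form_const_left c
    ((h.isRF0 m).isResistanceForm.const_mem c)
  comp_mem m i u hu := by
    rw [h.dom_succ m i]
    exact ⟨u, hu, rfl⟩
  glue m u h1 h2 := by
    refine ((h.isRF0 m).mem_iff u).2 ⟨fun i => ?_, h2⟩
    have := h1 i
    rw [h.dom_succ m i] at this
    obtain ⟨v, hv, huv⟩ := this
    refine ⟨v, hv, ?_⟩
    rintro _ ⟨x, rfl⟩
    exact congrFun huv x
  form_eq := h.form_eq

namespace FormPair

theorem Same.symm {X : Type*} {A B : FormPair X} (h : A.Same B) : B.Same A :=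
  ⟨h.1.symm, fun u hu v hv => (h.2 u (h.1 ▸ hu) v (h.1 ▸ hv)).symm⟩

theorem Same.trans {X : Type*} {A B C : FormPair X} (h : A.Same B) (h' : B.Same C) : A.Same C :=
  ⟨h.1.trans h'.1, fun u hu v hv => (h.2 u hu v hv).trans (h'.2 u (h.1 ▸ hu) v (h.1 ▸ hv))⟩

end FormPair

/-- A function given on one cell, constant on the two others, and affine on the bonds. -/
theorem Standard.exists_extend_cell (H : Standard p α) (f : K p α → ℝ) :
    ∃ u : K p α → ℝ, u ∘ GK p α 0 = f ∧ (∀ i, i ≠ 0 → u ∘ GK p α i = fun _ => 0) ∧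
      ∀ i, MemH1 (onBond p α u [] i) := by
  obtain ⟨u, h1, h2⟩ := H.exists_glue (fun i => if i = 0 then f else fun _ => 0)
    (fun i t => (if i = 0 then f else fun _ => 0) (vertex p α (i + 1)) +
      ((if i + 1 = 0 then f else fun _ => 0) (vertex p α i) -
        (if i = 0 then f else fun _ => 0) (vertex p α (i + 1))) * (t : ℝ))
    (fun i => by simp) (fun i => by simp)
  refine ⟨u, by simp [h1], fun i hi => by simp [h1, hi], fun i => ?_⟩
  rw [h2]
  exact memH1_affine _ _

namespace IsDecomposition

variable {B B' : ℕ → FormPair (K p α)} {η η' : ℕ → ℝ}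

theorem mem_of_extend (hB : IsDecomposition B η) {m : ℕ} {f u : K p α → ℝ}
    (hf : f ∈ (B (m + 1)).dom) (h0 : u ∘ GK p α 0 = f)
    (h1 : ∀ i, i ≠ 0 → u ∘ GK p α i = fun _ => 0) (h2 : ∀ i, MemH1 (onBond p α u [] i)) :
    u ∈ (B m).dom := by
  refine hB.glue m u (fun i => ?_) h2
  by_cases hi : i = 0
  · rw [hi, h0]; exact hf
  · rw [h1 i hi]; exact hB.const_mem _ _

theorem form_extend (hB : IsDecomposition B η) {m : ℕ} {f g u v : K p α → ℝ}
    (hu : u ∈ (B m).dom) (hv : v ∈ (B m).dom) (hu0 : u ∘ GK p α 0 = f)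
    (hu1 : ∀ i, i ≠ 0 → u ∘ GK p α i = fun _ => 0) (hv0 : v ∘ GK p α 0 = g)
    (hv1 : ∀ i, i ≠ 0 → v ∘ GK p α i = fun _ => 0) :
    (B m).form u v = (B (m + 1)).form f g + 1 / η m * DI p α 0 u v := by
  rw [hB.form_eq m u hu v hv, Fin.sum_univ_three, hu0, hv0, hu1 1 (by decide), hu1 2 (by decide),
    hv1 1 (by decide), hv1 2 (by decide), hB.form_const]
  ring

theorem dom_subset (H : Standard p α) (hB : IsDecomposition B η) (hB' : IsDecomposition B' η')
    {m : ℕ} (h : (B m).dom = (B' m).dom) : (B (m + 1)).dom ⊆ (B' (m + 1)).dom := by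
  intro f hf
  obtain ⟨u, h0, h1, h2⟩ := H.exists_extend_cell f
  have hu := hB.mem_of_extend hf h0 h1 h2
  rw [h] at hu
  rw [← h0]
  exact hB'.comp_mem m 0 u hu

/-- A function equal to `1` on one cell and `0` on the others has no energy in the cells. What
remains is `1 / η m` times a Dirichlet sum, positive because the values differ at the ends of a
bond. -/
theorem scale_eq (H : Standard p α) (hB : IsDecomposition B η) (hB' : IsDecomposition B' η')
    {m : ℕ} (h : (B m).Same (B' m)) : η m = η' m := by
  obtain ⟨u, h0, h1, h2⟩ := H.exists_extend_cell (p := p) (α := α) fun _ => 1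
  have hu := hB.mem_of_extend (hB.const_mem (m + 1) 1) h0 h1 h2
  have hu' := hB'.mem_of_extend (hB'.const_mem (m + 1) 1) h0 h1 h2
  have e := h.2 u hu u hu
  rw [hB.form_extend hu hu h0 h1 h0 h1, hB'.form_extend hu' hu' h0 h1 h0 h1, hB.form_const,
    hB'.form_const, zero_add, zero_add] at e
  have hpos : 0 < DI p α 0 u u := by
    rw [DI_zero]
    refine lt_of_lt_of_le ?_ (Finset.single_le_sum (f := fun i => dirichlet (onBond p α u [] i)
      (onBond p α u [] i)) (fun i _ => dirichlet_self_nonneg _) (Finset.mem_univ 0))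
    have := (h2 0).sq_sub_le 0 1
    rw [onBond_zero, onBond_one, h0, h1 (0 + 1) (by decide)] at this
    norm_num at this
    linarith
  have e2 := mul_right_cancel₀ hpos.ne' e
  rw [one_div, one_div] at e2
  exact inv_injective e2

/-- Extend functions on one cell by zero to the others. Once the weights of the bonds agree, equal
energies of the extensions mean equal energies on the cell. -/
theorem same_succ (H : Standard p α) (hB : IsDecomposition B η) (hB' : IsDecomposition B' η')
    {m : ℕ} (h : (B m).Same (B' m)) : (B (m + 1)).Same (B' (m + 1)) := by
  refine ⟨Subset.antisymm (dom_subset H hB hB' h.1) (dom_subset H hB' hB h.1.symm),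
    fun f hf g hg => ?_⟩
  obtain ⟨u, hu0, hu1, hu2⟩ := H.exists_extend_cell f
  obtain ⟨v, hv0, hv1, hv2⟩ := H.exists_extend_cell g
  have hu := hB.mem_of_extend hf hu0 hu1 hu2
  have hv := hB.mem_of_extend hg hv0 hv1 hv2
  have e := h.2 u hu v hv
  rw [hB.form_extend hu hv hu0 hu1 hv0 hv1,
    hB'.form_extend (h.1 ▸ hu) (h.1 ▸ hv) hu0 hu1 hv0 hv1, scale_eq H hB hB' h] at e
  linarith

/-- Uniqueness of resolutions. -/
theorem same (H : Standard p α) (hB : IsDecomposition B η) (hB' : IsDecomposition B' η')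
    (h : (B 0).Same (B' 0)) (m : ℕ) : (B m).Same (B' m) ∧ η m = η' m := by
  have h2 : (B m).Same (B' m) := by
    induction m with
    | zero => exact h
    | succ m ih => exact same_succ H hB hB' ih
  exact ⟨h2, scale_eq H hB hB' h2⟩

end IsDecomposition

/-! ## The decomposition of the form of a sequence of matching pairs -/

abbrev fullDom (p : Fin 3 → Plane) (α : ℝ) (R : ℕ → ℝ × ℝ) : Set (K p α → ℝ) :=
  (fullForm p α R).dom

theorem lineDom_subset_fullDom : lineDom p α R ⊆ fullDom p α R := fun _ hu => hu.1

section

variable (hR : R ∈ MPSeq) (H : Standard p α)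
include hR H

theorem mem_fullDom_iff (u : K p α → ℝ) :
    u ∈ fullDom p α R ↔ u ∈ FTilde p α ∧ ∃ M, ∀ m, approxForm p α R m u u ≤ M := by
  refine and_congr_right fun hu => ⟨?_, ?_⟩
  · rintro ⟨l, hl⟩
    exact ⟨l, (approxForm_mono hR hu H).ge_of_tendsto hl⟩
  · rintro ⟨M, hM⟩
    refine ⟨_, tendsto_atTop_ciSup (approxForm_mono hR hu H) ⟨M, ?_⟩⟩
    rintro _ ⟨m, rfl⟩
    exact hM m

theorem fullDom_add {u v : K p α → ℝ} (hu : u ∈ fullDom p α R) (hv : v ∈ fullDom p α R) :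
    u + v ∈ fullDom p α R := by
  rw [mem_fullDom_iff hR H] at hu hv ⊢
  obtain ⟨hu, M, hM⟩ := hu
  obtain ⟨hv, N, hN⟩ := hv
  refine ⟨FTilde_add hu hv, 2 * M + 2 * N, fun m => ?_⟩
  have := (isBilin_approxForm hR m).add_self_le hu hv
  linarith [hM m, hN m]

theorem tendsto_approxForm {u v : K p α → ℝ} (hu : u ∈ fullDom p α R) (hv : v ∈ fullDom p α R) :
    Tendsto (fun m => approxForm p α R m u v) atTop (𝓝 ((fullForm p α R).form u v)) := by
  obtain ⟨a, ha⟩ := hu.2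
  obtain ⟨b, hb⟩ := hv.2
  obtain ⟨c, hc⟩ := (fullDom_add hR H hu hv).2
  have h : Tendsto (fun m => approxForm p α R m u v) atTop (𝓝 ((c - a - b) / 2)) :=
    (((hc.sub ha).sub hb).div_const 2).congr fun m =>
      ((isBilin_approxForm hR m).polar hu.1 hv.1).symm
  rwa [fullForm_form_eq h]

theorem mem_fullDom_iff_pieces (u : K p α → ℝ) : u ∈ fullDom p α R ↔
    (∀ i, u ∘ GK p α i ∈ fullDom p α (shift R 1)) ∧ ∀ i, MemH1 (onBond p α u [] i) := by
  have hr := fst_pos hR 0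
  simp only [mem_fullDom_iff hR H, mem_fullDom_iff (shift_mem hR 1) H, H.mem_FTilde_iff u]
  constructor
  · rintro ⟨⟨h1, h2⟩, M, hM⟩
    refine ⟨fun i => ⟨h1 i, (R 0).1 * M, fun m => ?_⟩, h2⟩
    have h3 := hM (m + 1)
    have h4 : 0 ≤ 1 / (R 0).2 * DI p α 0 u u :=
      mul_nonneg (one_div_pos.2 (snd_pos hR 0)).le
        ((isBilin_DI 0).nonneg u ((H.mem_FTilde_iff u).2 ⟨h1, h2⟩))
    have h5 := Finset.single_le_sum (f := fun i => approxForm p α (shift R 1) m (u ∘ GK p α i)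
      (u ∘ GK p α i)) (fun i _ => (isBilin_approxForm (shift_mem hR 1) m).nonneg _ (h1 i))
      (Finset.mem_univ i)
    rw [approxForm_succ, one_div, inv_mul_eq_div] at h3
    exact h5.trans ((div_le_iff₀' hr).1 ((le_add_of_nonneg_right h4).trans h3))
  · rintro ⟨h1, h2⟩
    choose h1 M hM using h1
    have hu := (H.mem_FTilde_iff u).2 ⟨h1, h2⟩
    refine ⟨⟨h1, h2⟩, 1 / (R 0).1 * ∑ i, M i + 1 / (R 0).2 * DI p α 0 u u, fun m => ?_⟩
    refine (approxForm_mono hR hu H m.le_succ).trans ?_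
    change approxForm p α R (m + 1) u u ≤ _
    rw [approxForm_succ]
    have := Finset.sum_le_sum fun i (_ : i ∈ Finset.univ) => hM i m
    gcongr

theorem fullForm_succ {u v : K p α → ℝ} (hu : u ∈ fullDom p α R) (hv : v ∈ fullDom p α R) :
    (fullForm p α R).form u v =
      1 / (R 0).1 * ∑ i, (fullForm p α (shift R 1)).form (u ∘ GK p α i) (v ∘ GK p α i) +
        1 / (R 0).2 * DI p α 0 u v := by
  have h1 := (tendsto_add_atTop_iff_nat 1).2 (tendsto_approxForm hR H hu hv)
  simp only [approxForm_succ] at h1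
  refine tendsto_nhds_unique h1 (((tendsto_finsetSum _ fun i _ => ?_).const_mul _).add_const _)
  exact tendsto_approxForm (shift_mem hR 1) H (((mem_fullDom_iff_pieces hR H u).1 hu).1 i)
    (((mem_fullDom_iff_pieces hR H v).1 hv).1 i)

theorem isDecomposition_fullForm : IsDecomposition
    (fun m => (fullForm p α (shift R m)).scale (delta R m)⁻¹) (gamma R) where
  const_mem m c := lineDom_subset_fullDom (lineDom_const (shift_mem hR m) H c)
  form_const m c := by
    have hc := lineDom_const (shift_mem hR m) H c
    change (delta R m)⁻¹ * _ = 0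
    rw [fullForm_form_eq (tendsto_approxForm_lineEnergy (shift_mem hR m) H hc),
      lineEnergy_const_left (shift_mem hR m) H c hc, mul_zero]
  comp_mem m i u hu := by
    have := ((mem_fullDom_iff_pieces (shift_mem hR m) H u).1 hu).1 i
    rwa [shift_shift] at this
  glue m u h1 h2 := by
    refine (mem_fullDom_iff_pieces (shift_mem hR m) H u).2 ⟨fun i => ?_, h2⟩
    rw [shift_shift]
    exact h1 i
  form_eq m u hu v hv := by
    change (delta R m)⁻¹ * (fullForm p α (shift R m)).form u v = ∑ i, (delta R (m + 1))⁻¹ *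
      (fullForm p α (shift R (m + 1))).form (u ∘ GK p α i) (v ∘ GK p α i) + _
    have e0 : shift R m 0 = R m := rfl
    rw [fullForm_succ (shift_mem hR m) H hu hv, shift_shift, e0, delta_succ, gamma,
      ← Finset.mul_sum, mul_add, ← mul_assoc, ← mul_assoc]
    simp only [one_div, mul_inv]

end

/-- From `γ_{m+1} = δ_m ρ_{m+1}` and the earlier pairs one reads off `ρ_{m+1}`; the matching
condition then gives `r_{m+1}`. -/
theorem eq_of_gamma_eq {R' : ℕ → ℝ × ℝ} (hR : R ∈ MPSeq) (hR' : R' ∈ MPSeq)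
    (h : ∀ m, gamma R m = gamma R' m) : R = R' := by
  funext m
  induction m using Nat.strong_induction_on with
  | _ m ih =>
    have hd : delta R m = delta R' m :=
      Finset.prod_congr rfl fun k hk => by rw [ih k (Finset.mem_range.1 hk)]
    have h2 := h m
    rw [gamma, gamma, hd] at h2
    have h3 : (R m).2 = (R' m).2 := mul_left_cancel₀ (delta_pos hR' m).ne' h2
    refine Prod.ext ?_ h3
    have h4 := (hR m).2.2
    have h5 := (hR' m).2.2
    linarith

/-- A sequence of matching pairs is determined by its form. -/
theorem eq_of_same_fullForm {R' : ℕ → ℝ × ℝ} (H : Standard p α) (hR : R ∈ MPSeq)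
    (hR' : R' ∈ MPSeq) (h : (fullForm p α R).Same (fullForm p α R')) : R = R' := by
  refine eq_of_gamma_eq hR hR' fun m => ?_
  refine ((isDecomposition_fullForm hR H).same H (isDecomposition_fullForm hR' H) ?_ m).2
  simp only [shift_zero, delta_zero, inv_one]
  exact ⟨h.1, fun u hu v hv => congrArg (1 * ·) (h.2 u hu v hv)⟩

/-! ## The sequence of matching pairs of the line part -/

section

variable (hR : R ∈ MPSeq) (H : Standard p α)
include hR H

/-- Seen from their vertices the cells are triangles of resistance `A`, and the bonds are resistors
`ρ_1`. Gluing harmonic functions on the cells along the potentials `harmonicValue` gives a function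
`v` whose pairings involve only vertex values. It is therefore harmonic, and its energy computes the
constant in a second way. -/
theorem lineConst_eq : lineConst p α R =
    5 / 3 * ((R 0).1 * lineConst p α (shift R 1)) + (R 0).2 := by
  have hr := fst_pos hR 0
  have hρ := snd_pos hR 0
  have hR1 := shift_mem hR 1
  have hs := lineConst_pos hR H
  have hs1 := lineConst_pos hR1 H
  set A := (R 0).1 * lineConst p α (shift R 1) with hA
  have hApos : 0 < A := by positivity
  -- Any nonconstant vertex values would do; only `Q0 a a ≠ 0` is needed to compare the constants.
  set a : Fin 3 → ℝ := ![1, 0, 0]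
  choose f hf hfv using fun i => exists_isHarmonic_vertex hR1 H
    (harmonicValue (A / (5 / 3 * A + (R 0).2)) a i)
  obtain ⟨v, hv, hvf, hvb⟩ := exists_lineDom_glue_affine hR H f fun i => (hf i).1
  have hval : ∀ i, v (vertex p α i) = a i := fun i => by
    have : v (GK p α i (vertex p α i)) = f i (vertex p α i) := congrFun (hvf i) _
    rw [GK_vertex] at this
    rw [this, hfv, harmonicValue_self]
  have key : ∀ w ∈ lineDom p α R, lineEnergy p α R v w =
      1 / (5 / 3 * A + (R 0).2) * Q0 a fun i => w (vertex p α i) := by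
    intro w hw
    have h1 := harmonicValue_Q0 hApos hρ a fun i j => (w ∘ GK p α i) (vertex p α j)
    have h2 : ∀ i, (w ∘ GK p α i) (vertex p α i) = w (vertex p α i) := fun i =>
      congrArg w (GK_vertex i)
    simp only [h2] at h1
    rw [← h1, lineEnergy_succ hR H hv hw, DI_zero]
    congr 1
    · rw [show 1 / A = 1 / (R 0).1 * (1 / lineConst p α (shift R 1)) by
        rw [hA, one_div_mul_one_div], mul_assoc, Finset.mul_sum _ _ (1 / lineConst p α (shift R 1))]
      congr 1
      refine Finset.sum_congr rfl fun i _ => ?_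
      rw [hvf, lineEnergy_of_isHarmonic hR1 H (hf i) (comp_GK_mem hR H hw i)]
      simp only [hfv]
    · congr 1
      refine Finset.sum_congr rfl fun i _ => ?_
      rw [hvb, dirichlet_affine_left _ _ ((lineDom_subset hR H hw).2 [] i), onBond_zero, onBond_one]
      simp only [hfv]
  have hharm : (lineForm p α R).IsHarmonic (vertices p α) v := by
    refine FormPair.isHarmonic_of_orthogonal (isResistanceForm_lineForm hR H) hv fun w hw h0 => ?_
    refine (key w hw).trans ?_
    have : (fun i => w (vertex p α i)) = fun _ => 0 := funext fun i => h0 _ ⟨i, rfl⟩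
    rw [this]
    simp [Q0]
  have h1 := key v hv
  rw [lineEnergy_of_isHarmonic hR H hharm hv] at h1
  simp only [hval] at h1
  have hQ : Q0 a a ≠ 0 := by simp [Q0_eq, a]
  have h2 := mul_right_cancel₀ hQ h1
  rw [one_div, one_div] at h2
  exact inv_injective h2

end

/-- The sequence `𝓡'` of matching pairs whose form is a multiple of the line part for `𝓡`. -/
def lineSeq (p : Fin 3 → Plane) (α : ℝ) (R : ℕ → ℝ × ℝ) (m : ℕ) : ℝ × ℝ :=
  ((R m).1 * lineConst p α (shift R (m + 1)) / lineConst p α (shift R m),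
    (R m).2 / lineConst p α (shift R m))

theorem shift_lineSeq (n : ℕ) : shift (lineSeq p α R) n = lineSeq p α (shift R n) := by
  funext m
  change lineSeq p α R (n + m) = _
  simp only [lineSeq, shift_shift, add_assoc]
  rfl

section

variable (hR : R ∈ MPSeq) (H : Standard p α)
include hR H

/-- The matching condition is the recursion `lineConst_eq`, applied to the shifted sequence and
divided by its left-hand side. -/
theorem lineSeq_mem : lineSeq p α R ∈ MPSeq := by
  intro m
  have h0 := lineConst_pos (shift_mem hR m) H
  have h1 := lineConst_pos (shift_mem hR (m + 1)) H
  refine ⟨div_pos (mul_pos (fst_pos hR m) h1) h0, div_pos (snd_pos hR m) h0, ?_⟩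
  have h2 := lineConst_eq (shift_mem hR m) H
  rw [shift_shift] at h2
  change _ = 5 / 3 * ((R m).1 * _) + (R m).2 at h2
  simp only [lineSeq]
  rw [← mul_div_assoc, ← add_div, ← h2, div_self h0.ne']

/-- Divided by the trace constant, the approximating forms of `𝓡'` obey the recursion of the line
energy, with the weights `r_1` and `ρ_1` of `𝓡` itself. -/
theorem approxForm_lineSeq_succ (m : ℕ) (u v : K p α → ℝ) :
    approxForm p α (lineSeq p α R) (m + 1) u v = lineConst p α R * (1 / (R 0).1 *
      ∑ i, 1 / lineConst p α (shift R 1) *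
        approxForm p α (lineSeq p α (shift R 1)) m (u ∘ GK p α i) (v ∘ GK p α i) +
      1 / (R 0).2 * DI p α 0 u v) := by
  have hs := (lineConst_pos hR H).ne'
  have hs1 := (lineConst_pos (shift_mem hR 1) H).ne'
  have hr := (fst_pos hR 0).ne'
  have hρ := (snd_pos hR 0).ne'
  rw [approxForm_succ, shift_lineSeq, ← Finset.mul_sum]
  simp only [lineSeq, shift_zero, zero_add]
  field_simp

end

/-! ### Traces of the line form on finite levels -/

theorem approxForm_congr (m : ℕ) {u v v' : K p α → ℝ}
    (h1 : ∀ w : List (Fin 3), w.length ≤ m → ∀ i,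
      v (GwK p α w (vertex p α i)) = v' (GwK p α w (vertex p α i)))
    (h2 : ∀ w : List (Fin 3), w.length < m → ∀ i, onBond p α v w i = onBond p α v' w i) :
    approxForm p α R m u v = approxForm p α R m u v' := by
  have e1 : QSigma p α m u v = QSigma p α m u v' := by
    refine Finset.sum_congr rfl fun w _ => ?_
    simp only [h1 (List.ofFn w) (by simp)]
  have e2 : ∀ k ∈ Finset.range m, 1 / gamma R k * DI p α k u v = 1 / gamma R k * DI p α k u v' := by
    intro k hk
    congr 1
    refine Finset.sum_congr rfl fun w _ => Finset.sum_congr rfl fun i _ => ?_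
    rw [h2 (List.ofFn w) (by simpa using hk)]
  rw [approxForm_eq, approxForm_eq, e1, Finset.sum_congr rfl e2]

/-- `v` is the function of least line energy with the values of `u` on `V_m` and on the bonds of
the first `m` levels. -/
structure IsLevelApprox (R : ℕ → ℝ × ℝ) (m : ℕ) (u v : K p α → ℝ) : Prop where
  mem : v ∈ lineDom p α R
  vertex_eq : ∀ w : List (Fin 3), w.length ≤ m → ∀ i,
    v (GwK p α w (vertex p α i)) = u (GwK p α w (vertex p α i))
  bond_eq : ∀ w : List (Fin 3), w.length < m → ∀ i, onBond p α v w i = onBond p α u w i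
  energy : ∀ g ∈ lineDom p α R,
    lineEnergy p α R v g = 1 / lineConst p α R * approxForm p α (lineSeq p α R) m u g

/-- At level `0` this is the harmonic function with the vertex values of `u`. At the next level,
approximants on the cells are glued along the restrictions of `u` to the bonds, and both sides of
the energy identity follow the same recursion. -/
theorem exists_isLevelApprox (hR : R ∈ MPSeq) (H : Standard p α) (m : ℕ) {u : K p α → ℝ}
    (hu : u ∈ FTilde p α) : ∃ v, IsLevelApprox R m u v := by
  induction m generalizing R u with
  | zero =>
    obtain ⟨v, hv, hval⟩ := exists_isHarmonic_vertex hR H fun i => u (vertex p α i)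
    refine ⟨v, hv.1, fun w hw i => ?_, fun w hw => absurd hw (Nat.not_lt_zero _), fun g hg => ?_⟩
    · rw [List.length_eq_zero_iff.1 (Nat.le_zero.1 hw)]
      exact hval i
    · rw [lineEnergy_of_isHarmonic hR H hv hg, approxForm_zero]
      simp only [hval]
  | succ m ih =>
    obtain ⟨hu1, hu2⟩ := (H.mem_FTilde_iff u).1 hu
    choose f hf using fun i => ih (shift_mem hR 1) (hu1 i)
    obtain ⟨v, hv, hvf, hvb⟩ := exists_lineDom_glue hR H f (fun i => onBond p α u [] i)
      (fun i => (hf i).mem) hu2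
      (fun i => (onBond_zero u i).trans ((hf i).vertex_eq [] (Nat.zero_le _) _).symm)
      (fun i => (onBond_one u i).trans ((hf (i + 1)).vertex_eq [] (Nat.zero_le _) _).symm)
    refine ⟨v, hv, fun w hw i => ?_, fun w hw i => ?_, fun g hg => ?_⟩
    · have key : ∀ j w, w.length ≤ m →
          v (GK p α j (GwK p α w (vertex p α i))) = u (GK p α j (GwK p α w (vertex p α i))) :=
        fun j w hw => (congrFun (hvf j) _).trans ((hf j).vertex_eq w hw i)
      cases w with
      | nil =>
        have := key i [] (Nat.zero_le _)
        simp only [GwK, id_eq, GK_vertex] at this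
        exact this
      | cons j w => exact key j w (Nat.le_of_succ_le_succ hw)
    · cases w with
      | nil => exact hvb i
      | cons j w =>
        have h1 := (hf j).bond_eq w (Nat.lt_of_succ_lt_succ hw) i
        rw [← hvf j] at h1
        exact h1
    · have hs := (lineConst_pos hR H).ne'
      rw [approxForm_lineSeq_succ hR H, lineEnergy_succ hR H hv hg, ← mul_assoc,
        one_div_mul_cancel hs, one_mul, DI_zero, DI_zero]
      simp only [hvb, hvf]
      congr 2
      exact Finset.sum_congr rfl fun i _ => (hf i).energy _ (comp_GK_mem hR H hg i)

namespace IsLevelApprox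

variable {m n : ℕ} {u v v' : K p α → ℝ}

/-- The finer approximant agrees with `u` on everything that the form of level `m` sees. -/
theorem energy_of_le (hv : IsLevelApprox R m u v) (hv' : IsLevelApprox R n u v') (hmn : m ≤ n) :
    lineEnergy p α R v v' = 1 / lineConst p α R * approxForm p α (lineSeq p α R) m u u := by
  rw [hv.energy v' hv'.mem]
  congr 1
  exact approxForm_congr m (fun w hw => hv'.vertex_eq w (hw.trans hmn))
    fun w hw => hv'.bond_eq w (hw.trans_le hmn)

theorem energy_sub (hR : R ∈ MPSeq) (H : Standard p α) (hv : IsLevelApprox R m u v)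
    (hv' : IsLevelApprox R n u v') (hmn : m ≤ n) :
    lineEnergy p α R (v - v') (v - v') = 1 / lineConst p α R *
      (approxForm p α (lineSeq p α R) n u u - approxForm p α (lineSeq p α R) m u u) := by
  rw [(isBilin_lineEnergy hR H).sub_self hv.mem hv'.mem, hv.energy_of_le hv le_rfl,
    hv'.energy_of_le hv' le_rfl, hv.energy_of_le hv' hmn]
  ring

end IsLevelApprox

section

variable (hR : R ∈ MPSeq) (H : Standard p α)
include hR H

/-- The approximant `v` satisfies `𝓔^I(v, v) = 𝓔^I(v, u)`, so the energy of `v - u` is `𝓔^I(u, u) -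
𝓔^I(v, v) ≥ 0`. This bounds the approximating forms of `𝓡'` uniformly. -/
theorem lineDom_subset_fullDom_lineSeq : lineDom p α R ⊆ fullDom p α (lineSeq p α R) := by
  intro u hu
  have hu' := lineDom_subset hR H hu
  refine (mem_fullDom_iff (lineSeq_mem hR H) H u).2
    ⟨hu', lineConst p α R * lineEnergy p α R u u, fun m => ?_⟩
  obtain ⟨v, hv⟩ := exists_isLevelApprox hR H m hu'
  have h := (isBilin_lineEnergy hR H).nonneg _ ((isBilin_lineEnergy hR H).sub_mem hv.mem hu)
  rw [(isBilin_lineEnergy hR H).sub_self hv.mem hu, hv.energy_of_le hv le_rfl, hv.energy u hu] at h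
  rw [← div_le_iff₀' (lineConst_pos hR H), ← inv_mul_eq_div, ← one_div]
  linarith

/-- The approximants of `u` are Cauchy in line energy because the forms `𝓔_{𝓡',m}(u, u)` converge.
Their limit differs from `u` by a constant, so `u` itself is in the domain and inherits the limit of
the energies. -/
theorem mem_lineDom_of_mem_fullDom_lineSeq {u : K p α → ℝ}
    (hu : u ∈ fullDom p α (lineSeq p α R)) : u ∈ lineDom p α R ∧
      Tendsto (fun m => approxForm p α (lineSeq p α R) m u u) atTop
        (𝓝 (lineConst p α R * lineEnergy p α R u u)) := by
  have hs := lineConst_pos hR H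
  obtain ⟨l, hl⟩ := hu.2
  choose s hs' using fun m => exists_isLevelApprox hR H m hu.1
  have hcau : CauchySeq fun m => 1 / lineConst p α R * approxForm p α (lineSeq p α R) m u u :=
    (hl.const_mul _).cauchySeq
  obtain ⟨v, hv, hlim⟩ := lineDom_complete hR H (fun m => (hs' m).mem) fun ε hε => by
    obtain ⟨N, hN⟩ := Metric.cauchySeq_iff.1 hcau ε hε
    refine ⟨N, fun m hm n hn => ?_⟩
    have hmn := abs_lt.1 (hN m hm n hn)
    rcases le_total m n with h | h
    · rw [(hs' m).energy_sub hR H (hs' n) h]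
      linarith [hmn.1]
    · rw [(isBilin_lineEnergy hR H).sub_self (hs' m).mem (hs' n).mem,
        (isBilin_lineEnergy hR H).symm _ (hs' m).mem _ (hs' n).mem,
        (hs' n).energy_of_le (hs' m) h, (hs' m).energy_of_le (hs' m) le_rfl,
        (hs' n).energy_of_le (hs' n) le_rfl]
      linarith [hmn.2]
  have hv' := lineDom_subset hR H hv
  -- Convergence in energy controls differences from the value at a vertex. The points in question
  -- include all images of vertices and all bonds, so they are dense.
  have key : ∀ x, (∃ N, ∀ n ≥ N, s n x = u x) → u x - v x = u (vertex p α 0) - v (vertex p α 0) := by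
    rintro x ⟨N, hN⟩
    have h2 : (u x - v x - (u (vertex p α 0) - v (vertex p α 0))) ^ 2 ≤ 144 * 0 := by
      refine ge_of_tendsto (hlim.const_mul 144) ?_
      filter_upwards [eventually_ge_atTop N] with n hn
      have h3 := sq_sub_le_lineEnergy H hR ((isBilin_lineEnergy hR H).sub_mem (hs' n).mem hv) x
        (vertex p α 0)
      have h4 : s n (vertex p α 0) = u (vertex p α 0) := (hs' n).vertex_eq [] (Nat.zero_le _) 0
      rwa [Pi.sub_apply, Pi.sub_apply, hN n hn, h4] at h3
    rw [mul_zero] at h2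
    exact sub_eq_zero.1 (pow_eq_zero_iff two_ne_zero |>.1 (le_antisymm h2 (sq_nonneg _)))
  have huv : u = v + fun _ => u (vertex p α 0) - v (vertex p α 0) := by
    funext x
    have : x ∈ {x | u x - v x = u (vertex p α 0) - v (vertex p α 0)} := by
      refine forall_mem_of_isClosed (isClosed_eq (hu.1.1.sub hv'.1) continuous_const) ?_ ?_ x
      · exact fun w i => key _ ⟨w.length, fun n hn => (hs' n).vertex_eq w hn i⟩
      · exact fun w i t => key _ ⟨w.length + 1, fun n hn => congrFun ((hs' n).bond_eq w hn i) t⟩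
    have h : u x - v x = _ := this
    rw [Pi.add_apply, ← h]
    ring
  have hmem : u ∈ lineDom p α R := by
    rw [huv]
    exact (isBilin_lineEnergy hR H).add_mem _ hv _ (lineDom_const hR H _)
  refine ⟨hmem, ?_⟩
  have hE : lineEnergy p α R u u = lineEnergy p α R v v := by
    conv_lhs => rw [huv]
    exact (isResistanceForm_lineForm hR H).form_add_const _ hv
  rw [hE]
  refine (((isBilin_lineEnergy hR H).tendsto_self (fun n => (hs' n).mem) hv hlim).const_mul
    (lineConst p α R)).congr fun n => ?_
  rw [(hs' n).energy_of_le (hs' n) le_rfl, ← mul_assoc, mul_one_div_cancel hs.ne', one_mul]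

/-- A multiple of the line part is the form of a sequence of matching pairs. -/
theorem same_lineSeq : ((lineForm p α R).scale (lineConst p α R)).Same
    (fullForm p α (lineSeq p α R)) := by
  have hE := isBilin_lineEnergy hR H
  have hlim : ∀ u ∈ lineDom p α R, Tendsto (fun m => approxForm p α (lineSeq p α R) m u u) atTop
      (𝓝 (lineConst p α R * lineEnergy p α R u u)) := fun u hu =>
    (mem_lineDom_of_mem_fullDom_lineSeq hR H (lineDom_subset_fullDom_lineSeq hR H hu)).2
  refine ⟨Subset.antisymm (lineDom_subset_fullDom_lineSeq hR H) fun u hu =>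
    (mem_lineDom_of_mem_fullDom_lineSeq hR H hu).1, fun u hu v hv => ?_⟩
  refine (fullForm_form_eq ?_).symm
  change Tendsto _ _ (𝓝 (lineConst p α R * lineEnergy p α R u v))
  have e : lineConst p α R * lineEnergy p α R u v =
      (lineConst p α R * lineEnergy p α R (u + v) (u + v) - lineConst p α R * lineEnergy p α R u u -
        lineConst p α R * lineEnergy p α R v v) / 2 := by
    rw [hE.polar hu hv]; ring
  rw [e]
  exact ((((hlim _ (hE.add_mem u hu v hv)).sub (hlim u hu)).sub (hlim v hv)).div_const 2).congr
    fun m => ((isBilin_approxForm (lineSeq_mem hR H) m).polar (lineDom_subset hR H hu)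
      (lineDom_subset hR H hv)).symm

end

end SSG

end

/-! ### The theorem -/

theorem mainTheorem8 (p : Fin 3 → SSG.Plane) (hp_sum : ∑ i, p i = 0)
    (hp_dist : ∀ i j, i ≠ j → dist (p i) (p j) = 1) (α : ℝ) (hα_pos : 0 < α) (hα_lt : α < 1)
    (R : ℕ → ℝ × ℝ) (hR : R ∈ SSG.MPSeq) :
    SSG.IsRFS p α (SSG.lineForm p α R) ∧
    SSG.IsResolution p α (SSG.lineForm p α R)
      (fun m => (SSG.lineForm p α (SSG.shift R m)).scale (SSG.delta R m)⁻¹) (SSG.gamma R) ∧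
    (∀ B η, SSG.IsResolution p α (SSG.lineForm p α R) B η →
      ∀ m, (B m).Same ((SSG.lineForm p α (SSG.shift R m)).scale (SSG.delta R m)⁻¹) ∧
        η m = SSG.gamma R m) ∧
    SSG.IsTraceConstant p α (SSG.lineForm p α R) (SSG.r0 p α (SSG.lineForm p α R)) ∧
    SSG.r0 p α (SSG.lineForm p α R) ≤ 1 ∧
    ∃! R' : ℕ → ℝ × ℝ, R' ∈ SSG.MPSeq ∧
      ((SSG.lineForm p α R).scale (SSG.r0 p α (SSG.lineForm p α R))).Same
        (SSG.fullForm p α R') := by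
  have H : SSG.Standard p α := ⟨hp_sum, hp_dist, hα_pos, hα_lt⟩
  have hres := SSG.isResolution_lineForm H hR
  refine ⟨⟨SSG.isRF0_lineForm H hR, _, _, hres⟩, hres, fun B η hB m => ?_,
    SSG.isTraceConstant_r0 hR H, SSG.lineConst_le_one hR H, SSG.lineSeq p α R,
    ⟨SSG.lineSeq_mem hR H, SSG.same_lineSeq hR H⟩, fun R' ⟨hR', h⟩ => ?_⟩
  · exact hB.isDecomposition.same H hres.isDecomposition (hB.zero.trans hres.zero.symm) m
  · exact SSG.eq_of_same_fullForm H hR' (SSG.lineSeq_mem hR H)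
      (h.symm.trans (SSG.same_lineSeq hR H))
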